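/- Notation. Let $n\ge 2$ and equip $\mathbb R^n$ with its Euclidean norm. A subspace of $\mathbb R^n$ is rational if it has a basis in $\mathbb Q^n$; $\mathcal R_n(e)$ is the set of rational subspaces of dimension $e$. The height of $B\in\mathcal R_n(e)$ is $H(B)=\|\eta\|/|q|$, where $\eta\in\mathbb Q^{\binom ne}$ is the vector of $e\times e$ minors of a rational basis of $B$ and $q\mathbb Z$ is the fractional ideal generated by the coordinates of $\eta$. For nonzero $X,Y\in\mathbb R^n$ put $\omega(X,Y)=\|X\wedge Y\|/(\|X\|\,\|Y\|)$; for subspaces $A,B$ of dimensions $d,e\ge 1$ with $d+e\le n$ put $\psi_1(A,B)=\min\{\omega(X,Y): X\in A\setminus\{0\},\,Y\in B\setminus\{0\}\}$. For $d+e\le n$, $\mathcal I_n(d,e)_1$ is the set of $d$-dimensional subspaces $A$ with $A\cap B=\{0\}$ for all $B\in\mathcal R_n(e)$, and for a subspace $A$ of dimension $d$, $\mu_n(A|e)_1\in[0,+\infty]$ is the supremum of the $\mu>0$ such that $\psi_1(A,B)\le H(B)^{-\mu}$ for infinitely many $B\in\mathcal R_n(e)$. Define $C_1=\frac{3+\sqrt5}{2}$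 and $C_d=5n^2C_{d-1}^{2n}$ for $2\le d\le n-1$. Theorem. Let $1\le d\le n-1$. (a) For every $(\beta_1,\dots,\beta_{n-d})\in[C_d,+\infty)^{n-d}$ there is an explicitly constructed $A\in\mathcal I_n(d,n-d)_1$ (in the sense below) such that for all $e\in\{1,\dots,n-d\}$ $$\mu_n(A|e)_1=\max_{0\le i\le n-d-e}\beta_{i+1}\cdots\beta_{i+e}.$$ (b) Let $\gamma_1,\dots,\gamma_{n-d}\in\mathbb R$ satisfy $\gamma_1\ge C_d$, $\gamma_i\ge C_d\gamma_{i-1}$ for $2\le i\le n-d$, and $\gamma_{i+j}\le\gamma_i\gamma_j$ for all $i,j\ge1$ with $i+j\le n-d$. Then there is $A\in\mathcal I_n(d,n-d)_1$, explicitly constructed from $\beta_1=\gamma_1$, $\beta_j=\gamma_j/\gamma_{j-1}$ $(2\le j\le n-d)$, such that $\mu_n(A|e)_1=\gamma_e$ for all $e\in\{1,\dots,n-d\}$. Explicit construction. "$A$ is explicitly constructed from $(\beta_1,\dots,\beta_{n-d})$" means that $A$ is spanned by vectors $$Y_j=(1,\underbrace{0,\dots,0}_{d-j-1},\sigma_{j,0},\dots,\sigma_{j,m_j-1}),\qquad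 m_j=n-d+j,\quad 0\le j\le d-1,$$ $$\sigma_{j,\ell}=\sum_{k\ge0,\ k\equiv\ell\ (\mathrm{mod}\ m_j)}u_{j,k}\,\theta^{-\lfloor\alpha_{j,k}\rfloor}\qquad(0\le\ell<m_j),$$ for some prime $\theta\ge5$ and some digits $u_{j,k}\in\{1,2\}$ for which all the numbers $\sigma_{j,\ell}$ together are algebraically independent over $\mathbb Q$. Here $\alpha_{j,k}=C_{d-j}^{\,k}$ for $j\ge1$, and $\alpha_{0,k}=\tilde\beta_1\cdots\tilde\beta_k$, where $\tilde\beta$ is the sequence of period $2(n-d)$ with $\tilde\beta_i=\beta_i$ for $1\le i\le n-d$ and $\tilde\beta_i=C_d$ for $n-d<i\le2(n-d)$. -/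

import Mathlib

noncomputable section

namespace RatApprox

/-- The ambient space `ℝⁿ` with its canonical Euclidean norm. -/
abbrev E (n : ℕ) := EuclideanSpace ℝ (Fin n)

/-- A rational vector, seen in `ℝⁿ`. -/
def ratVec {n : ℕ} (v : Fin n → ℚ) : E n := WithLp.toLp 2 fun i => (v i : ℝ)

/-- `v` is a rational basis of the subspace `B` of `ℝⁿ`. -/
def IsRatBasis {n e : ℕ} (v : Fin e → Fin n → ℚ) (B : Submodule ℝ (E n)) : Prop :=
  LinearIndependent ℝ (fun j => ratVec (v j)) ∧
    Submodule.span ℝ (Set.range fun j => ratVec (v j)) = B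

/-- `𝓡ₙ(e)`: the rational subspaces of `ℝⁿ` of dimension `e`. -/
def ratSubspaces (n e : ℕ) : Set (Submodule ℝ (E n)) :=
  {B | ∃ v : Fin e → Fin n → ℚ, IsRatBasis v B}

/-- The Grassmann (Plücker) coordinate, indexed by an `e`-element set `I` of rows, associated with
the basis `v`: the minor with rows in `I` of the `n × e` matrix whose columns are the `v j`. -/
def grassmannCoord {n e : ℕ} (v : Fin e → Fin n → ℚ) (I : {I : Finset (Fin n) // I.card = e}) : ℚ :=
  Matrix.det (Matrix.of fun a b : Fin e => v b (I.1.orderEmbOfFin I.2 a))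

/-- The height of a rational subspace: the Euclidean norm of the Grassmann coordinates `η` of a
rational basis, divided by the norm `|q|` of the fractional ideal `∑ ℤ η_I = qℤ` they generate.
The value does not depend on the rational basis: for rational `B` the set below is a singleton. -/
def height {n : ℕ} (B : Submodule ℝ (E n)) : ℝ :=
  sInf {h | ∃ (e : ℕ) (v : Fin e → Fin n → ℚ) (q : ℚ), IsRatBasis v B ∧ 0 < q ∧
    AddSubgroup.closure (Set.range (grassmannCoord v)) = AddSubgroup.zmultiples q ∧
    h = √(∑ I, (grassmannCoord v I : ℝ) ^ 2) / (q : ℝ)}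

/-- `‖X ∧ Y‖`, for the Euclidean norm of `Λ²(ℝⁿ)` in the coordinates `(xᵢyⱼ - xⱼyᵢ)_{i<j}`. -/
def wedgeNorm {n : ℕ} (X Y : E n) : ℝ :=
  √(∑ p : Fin n × Fin n with p.1 < p.2, (X p.1 * Y p.2 - X p.2 * Y p.1) ^ 2)

/-- `ω(X, Y)`, the sine of the angle between two nonzero vectors. -/
def sinAngle {n : ℕ} (X Y : E n) : ℝ := wedgeNorm X Y / (‖X‖ * ‖Y‖)

/-- `ω₁(A, B)`, the minimum of `ω(X, Y)` over nonzero `X ∈ A`, `Y ∈ B`. When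
`dim A + dim B ≤ n` this is the first angle `ψ₁(A, B)`. -/
def firstAngle {n : ℕ} (A B : Submodule ℝ (E n)) : ℝ :=
  sInf {r | ∃ X ∈ A, ∃ Y ∈ B, X ≠ 0 ∧ Y ≠ 0 ∧ r = sinAngle X Y}

/-- `𝓘ₙ(d, e)ⱼ`: the `(e, j)`-irrational subspaces of `ℝⁿ` of dimension `d`. The truncated
subtraction `d + e - n` is `max(0, d + e - n)`. -/
def irrationalSubspaces (n d e j : ℕ) : Set (Submodule ℝ (E n)) :=
  {A | Module.finrank ℝ A = d ∧
    ∀ B ∈ ratSubspaces n e, Module.finrank ℝ (A ⊓ B : Submodule ℝ (E n)) < j + (d + e - n)}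

/-- `μₙ(A|e)₁`, for `dim A + e ≤ n`: the supremum, possibly infinite, of the `μ > 0` such that
`ψ₁(A, B) ≤ H(B)^{-μ}` for infinitely many rational subspaces `B` of dimension `e`. -/
def firstExponent {n : ℕ} (A : Submodule ℝ (E n)) (e : ℕ) : EReal :=
  sSup {x | ∃ μ : ℝ, 0 < μ ∧
    {B | B ∈ ratSubspaces n e ∧ firstAngle A B ≤ 1 / height B ^ μ}.Infinite ∧ x = (μ : EReal)}

/-- The constants `C_d` (for fixed `n`): `C₁ = (3 + √5)/2` and `C_d = 5 n² C_{d-1}^{2n}` for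
`d ≥ 2`. The value at `d = 0` is not used. -/
def constC (n : ℕ) : ℕ → ℝ
  | 0 => 0
  | 1 => (3 + √5) / 2
  | d + 2 => 5 * (n : ℝ) ^ 2 * constC n (d + 1) ^ (2 * n)

/-- The sequence `(β̃_k)_{k ≥ 1}` of period `2m` with `β̃_k = β_k` for `1 ≤ k ≤ m` and
`β̃_k = c` for `m < k ≤ 2m`. -/
def periodicExt (m : ℕ) (c : ℝ) (β : ℕ → ℝ) (k : ℕ) : ℝ :=
  if (k - 1) % (2 * m) < m then β ((k - 1) % (2 * m) + 1) else c

/-- `σ_ℓ = ∑_{k ≡ ℓ mod m} u_k θ^{-⌊α_k⌋}` for `0 ≤ ℓ < m`, where `α_k = b_1 ⋯ b_k`. -/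
def lacunary (θ m : ℕ) (b : ℕ → ℝ) (u : ℕ → ℕ) (l : ℕ) : ℝ :=
  ∑' k : ℕ, (u (m * k + l) : ℝ) / (θ : ℝ) ^ ⌊∏ i ∈ Finset.Icc 1 (m * k + l), b i⌋₊

/-- The multipliers `b` behind the `j`-th spanning vector (`0 ≤ j < d`): for `j = 0` the periodic
extension of the prescribed `(β_1, …, β_{n-d})`, for `j > 0` the constant `C_{d-j}`. -/
def multipliers (n d : ℕ) (β : ℕ → ℝ) (j : ℕ) : ℕ → ℝ :=
  if j = 0 then periodicExt (n - d) (constC n d) β else fun _ => constC n (d - j)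

/-- The `l`-th number `σ_{j,l}` (`0 ≤ l < n - d + j`) of the `j`-th spanning vector. -/
def sigma (n d θ : ℕ) (β : ℕ → ℝ) (u : ℕ → ℕ → ℕ) (j l : ℕ) : ℝ :=
  lacunary θ (n - d + j) (multipliers n d β j) (u j) l

/-- The vector `(1, 0, …, 0, σ_{j,0}, …, σ_{j,n-d+j-1})` of `ℝⁿ`, with `d - j - 1` zeros. -/
def spanVec (n d θ : ℕ) (β : ℕ → ℝ) (u : ℕ → ℕ → ℕ) (j : ℕ) : E n :=
  WithLp.toLp 2 fun i : Fin n =>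
    if (i : ℕ) = 0 then 1
    else if (i : ℕ) < d - j then 0
    else sigma n d θ β u j (i - (d - j))

/-- `A` is given by the explicit construction attached to `(β_1, …, β_{n-d})`: it is spanned by the
`d` vectors `spanVec`, for some prime `θ ≥ 5` and some digits in `{1, 2}` that make the family of
all the `σ_{j,l}` algebraically independent over `ℚ`. -/
def IsExplicit (n d : ℕ) (β : ℕ → ℝ) (A : Submodule ℝ (E n)) : Prop :=
  ∃ (θ : ℕ) (u : ℕ → ℕ → ℕ), θ.Prime ∧ 5 ≤ θ ∧ (∀ j k, u j k = 1 ∨ u j k = 2) ∧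
    AlgebraicIndependent ℚ
      (fun p : (j : Fin d) × Fin (n - d + (j : ℕ)) => sigma n d θ β u p.1 p.2) ∧
    A = Submodule.span ℝ (Set.range fun j : Fin d => spanVec n d θ β u j)

/-- `max_{0 ≤ i ≤ m - e} β_{i+1} ⋯ β_{i+e}`. -/
def maxWindow (m : ℕ) (β : ℕ → ℝ) (e : ℕ) : ℝ :=
  (Finset.range (m - e + 1)).sup' Finset.nonempty_range_add_one
    fun i => ∏ k ∈ Finset.Icc (i + 1) (i + e), β k

/-- The ratios `γ_j / γ_{j-1}` for `j ≥ 1`, with the convention `γ_0 = 1`. -/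
def ratios (γ : ℕ → ℝ) (j : ℕ) : ℝ := if j = 1 then γ 1 else γ j / γ (j - 1)

end RatApprox

end

/-!
Let `Y_0, …, Y_{d-1}` be the spanning vectors and `m = n - d`. The truncations `x_N` of `Y_0` are
rational vectors with denominator `θ ^ a_N`, where `a_N = ⌊α_N⌋`, at distance about
`θ ^ (-a_{N+1})` from `Y_0`. Two consecutive truncations differ by a multiple of a coordinate
vector, so `e ≤ m` consecutive ones `x_N, …, x_{N+e-1}` span a rational subspace whose height is
about `θ ^ a_N` (`pow_le_height_space`, `exists_height_space_le`) and whose distance to `Y_0` is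
about `θ ^ (-a_{N+e})` (`exists_le_norm_y_sub`). These subspaces yield the exponents
`α_{N+e} / α_N`, that is, the products of `e` consecutive multipliers. Since the multipliers beyond
`β_1, …, β_m` are minimal, the largest of these products is the maximum in the theorem
(`window_periodicExt_le`).

The point is that no other subspace does better, and this is proved by induction on `d`. The
vectors `Y_1, …, Y_{d-1}` span a subspace `A'` given by the same construction in dimension `d - 1`,
with all multipliers equal to `C_{d-1}`; by induction `A'` is badly approximable with an exponent
`K` that is small compared with `C_d` (`BadlyApprox`). Let `B` be rational of dimension `e` and
height `H`, close to a unit vector `X` of `A' + ℝ Y_0`. If `x_N` is not in `B`, the subspace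
`B + ℝ x_N` has height at most about `H θ ^ a_N` and is close to the component of `X` on `A'`, which
must therefore be tiny. So `x_N` itself is close to `B`; but an integer vector outside `B` has
distance at least about `1 / H` to `B` (`exists_height_sup_le`). Hence `x_N ∈ B` unless
`1 ≤ c (H θ ^ a_N) ^ (K + 1) (dist(X, B) + θ ^ (-a_{N+1}))` (`exists_one_le_of_not_mem`). When the
exponent of approximation exceeds all the `α_{N+e} / α_N`, the growth of the `α_N` makes this
inequality fail for `e` consecutive indices (`exists_index`), which forces `B` to be one of the
subspaces above, for which the exponent is too large (`exists_height_le_of_close`). There are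
finitely many rational subspaces of bounded height (`finite_height_le`), so the exponent is as
claimed.

Irrationality follows from algebraic independence: a rational subspace of dimension `n - d` meeting
`A` would make a determinant vanish, which is a nonzero polynomial in the `σ_{j,l}`
(`linearIndependent_append_genVec`). Suitable digits exist because the possible values of each
`σ_{j,l}` form an uncountable set (`exists_digits`).
-/

namespace RatApprox
open Module

/-! ### Minors of families of vectors -/

/-- The minor, with rows in `I`, of the matrix whose columns are the vectors `v j`, over any
commutative ring. -/
def minor {R : Type*} [CommRing R] {n e : ℕ} (v : Fin e → Fin n → R)
    (I : {I : Finset (Fin n) // I.card = e}) : R :=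
  Matrix.det (Matrix.of fun a b : Fin e => v b (I.1.orderEmbOfFin I.2 a))

theorem minor_ratVec {n e : ℕ} (v : Fin e → Fin n → ℚ) (I : {I : Finset (Fin n) // I.card = e}) :
    minor (fun j i => (ratVec (v j)) i) I = (grassmannCoord v I : ℝ) := by
  unfold minor grassmannCoord
  have := (Rat.castHom ℝ).map_det
    (Matrix.of fun a b : Fin e => v b (I.1.orderEmbOfFin I.2 a))
  simp only [Rat.coe_castHom] at this
  rw [this]
  rfl

/-- The set of rows `J` without its `i`-th element. -/
def eraseRow {n e : ℕ} (J : {I : Finset (Fin n) // I.card = e + 1}) (i : Fin (e + 1)) :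
    {I : Finset (Fin n) // I.card = e} :=
  ⟨J.1.erase (J.1.orderEmbOfFin J.2 i), by
    rw [Finset.card_erase_of_mem (Finset.orderEmbOfFin_mem _ _ _), J.2]; rfl⟩

/-- Laplace expansion along the last column. -/
theorem minor_snoc {R : Type*} [CommRing R] {n e : ℕ} (v : Fin e → Fin n → R) (x : Fin n → R)
    (J : {I : Finset (Fin n) // I.card = e + 1}) :
    minor (Fin.snoc (α := fun _ => Fin n → R) v x) J =
      ∑ i : Fin (e + 1), (-1) ^ ((i : ℕ) + e) * x (J.1.orderEmbOfFin J.2 i) *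
        minor v (eraseRow J i) := by
  unfold minor
  rw [Matrix.det_succ_column _ (Fin.last e)]
  refine Finset.sum_congr rfl fun i _ => ?_
  congr 1
  · simp
  · congr 1
    ext a b
    simp only [Matrix.submatrix_apply, Matrix.of_apply, Fin.succAbove_last, Fin.snoc_castSucc]
    congr 1
    have h := Finset.orderEmbOfFin_unique (s := J.1.erase (J.1.orderEmbOfFin J.2 i)) (k := e)
      (by rw [Finset.card_erase_of_mem (Finset.orderEmbOfFin_mem _ _ _), J.2]; rfl)
      (f := fun a => J.1.orderEmbOfFin J.2 (i.succAbove a))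
      (fun a => Finset.mem_erase.2 ⟨fun h => Fin.succAbove_ne i a
        ((J.1.orderEmbOfFin J.2).injective h), Finset.orderEmbOfFin_mem _ _ _⟩)
      ((J.1.orderEmbOfFin J.2).strictMono.comp (Fin.strictMono_succAbove i))
    exact congrFun h a

theorem minor_eq_zero_of_not_linearIndependent {n e : ℕ} (v : Fin e → Fin n → ℝ)
    (h : ¬ LinearIndependent ℝ v) (I : {I : Finset (Fin n) // I.card = e}) : minor v I = 0 := by
  obtain ⟨g, hg, i, hi⟩ := Fintype.not_linearIndependent_iff.1 h
  unfold minor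
  refine Matrix.exists_mulVec_eq_zero_iff.1 ⟨g, fun h0 => hi (by simp [h0]), ?_⟩
  ext a
  have := congrFun hg (I.1.orderEmbOfFin I.2 a)
  simp only [Finset.sum_apply, Pi.smul_apply, smul_eq_mul, Pi.zero_apply] at this
  simp only [Matrix.mulVec, dotProduct, Matrix.of_apply, Pi.zero_apply]
  rw [← this]
  exact Finset.sum_congr rfl fun b _ => mul_comm _ _

/-- Up to sign, the minor on a set of rows can be computed in any ordering of these rows. -/
theorem abs_det_eq_abs_minor {R : Type*} [CommRing R] [LinearOrder R] [IsStrictOrderedRing R]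
    {n e : ℕ} (v : Fin e → Fin n → R) (f : Fin e → Fin n) (hf : Function.Injective f)
    (I : {I : Finset (Fin n) // I.card = e}) (hI : ∀ a, f a ∈ I.1) :
    |Matrix.det (Matrix.of fun a b : Fin e => v b (f a))| = |minor v I| := by
  classical
  have hmem : ∀ a, ∃ a', I.1.orderEmbOfFin I.2 a' = f a := by
    intro a
    have : f a ∈ Set.range (I.1.orderEmbOfFin I.2) := by
      rw [Finset.range_orderEmbOfFin]; exact hI a
    exact this
  choose p hp using hmem
  have hpi : Function.Injective p := fun a b hab => hf (by rw [← hp a, ← hp b, hab])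
  let σ : Equiv.Perm (Fin e) := Equiv.ofBijective p (Finite.injective_iff_bijective.1 hpi)
  have h : (Matrix.of fun a b : Fin e => v b (f a)) =
      (Matrix.of fun a b : Fin e => v b (I.1.orderEmbOfFin I.2 a)).submatrix σ id := by
    ext a b
    simp [σ, hp]
  rw [h, Matrix.det_permute, abs_mul, minor]
  have : |((Equiv.Perm.sign σ : ℤ) : R)| = 1 := by
    rcases Int.units_eq_one_or (Equiv.Perm.sign σ) with h | h <;> simp [h]
  rw [this, one_mul]

theorem exists_minor_ne_zero {n e : ℕ} (v : Fin e → Fin n → ℝ) (h : LinearIndependent ℝ v) :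
    ∃ I, minor v I ≠ 0 := by
  classical
  -- the rows of the matrix span a space of dimension `e`, so `e` of them are independent
  let M : Matrix (Fin n) (Fin e) ℝ := Matrix.of fun i j => v j i
  have hr : M.rank = e := by
    have : LinearIndependent ℝ M.transpose.row := h
    have := this.rank_matrix
    rwa [Matrix.rank_transpose, Fintype.card_fin] at this
  rw [Matrix.rank_eq_finrank_span_row] at hr
  obtain ⟨f, hf, -, hfi⟩ := Submodule.exists_fun_fin_finrank_span_eq ℝ (Set.range M.row)
  have hfi' : LinearIndependent ℝ (fun i : Fin e => f (Fin.cast hr.symm i)) :=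
    hfi.comp _ (Fin.cast_injective _)
  choose r hr' using hf
  let g : Fin e → Fin n := fun i => r (Fin.cast hr.symm i)
  have hg : ∀ i, M.row (g i) = f (Fin.cast hr.symm i) := fun i => hr' _
  have hgi : Function.Injective g := by
    intro a b hab
    apply hfi'.injective
    simp only
    rw [← hg a, ← hg b, hab]
  refine ⟨⟨Finset.univ.image g, by rw [Finset.card_image_of_injective _ hgi]; simp⟩, ?_⟩
  rw [← abs_ne_zero, ← abs_det_eq_abs_minor v g hgi _ (by simp), abs_ne_zero]
  have hli : LinearIndependent ℝ (Matrix.of fun a b : Fin e => v b (g a)).row := by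
    have : (Matrix.of fun a b : Fin e => v b (g a)).row =
        fun i : Fin e => f (Fin.cast hr.symm i) := by
      funext i; rw [← hg]; rfl
    rw [this]; exact hfi'
  rw [Matrix.linearIndependent_rows_iff_isUnit, Matrix.isUnit_iff_isUnit_det] at hli
  exact hli.ne_zero

theorem linearIndependent_iff_exists_minor {n e : ℕ} (v : Fin e → Fin n → ℝ) :
    LinearIndependent ℝ v ↔ ∃ I, minor v I ≠ 0 := by
  refine ⟨exists_minor_ne_zero v, fun ⟨I, hI⟩ => ?_⟩
  by_contra h
  exact hI (minor_eq_zero_of_not_linearIndependent v h I)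

/-- Modifying the last vector by an element of the span of the others does not change minors. -/
theorem minor_snoc_sub {n e : ℕ} (v : Fin e → Fin n → ℝ) (x z : Fin n → ℝ)
    (hz : z ∈ Submodule.span ℝ (Set.range v)) (J : {I : Finset (Fin n) // I.card = e + 1}) :
    minor (Fin.snoc (α := fun _ => Fin n → ℝ) v (x - z)) J =
      minor (Fin.snoc (α := fun _ => Fin n → ℝ) v x) J := by
  have h0 : minor (Fin.snoc (α := fun _ => Fin n → ℝ) v z) J = 0 := by
    apply minor_eq_zero_of_not_linearIndependent
    intro h
    rw [linearIndependent_finSnoc] at h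
    exact h.2 hz
  rw [minor_snoc] at h0
  rw [minor_snoc, minor_snoc, ← sub_eq_zero, ← neg_eq_zero, ← h0, ← Finset.sum_sub_distrib,
    ← Finset.sum_neg_distrib]
  refine Finset.sum_congr rfl fun i _ => ?_
  simp only [Pi.sub_apply]
  ring

theorem mem_span_iff_minor {n e : ℕ} (v : Fin e → Fin n → ℝ) (hv : LinearIndependent ℝ v)
    (x : Fin n → ℝ) : x ∈ Submodule.span ℝ (Set.range v) ↔
      ∀ J, minor (Fin.snoc (α := fun _ => Fin n → ℝ) v x) J = 0 := by
  have := linearIndependent_iff_exists_minor (Fin.snoc (α := fun _ => Fin n → ℝ) v x)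
  rw [linearIndependent_finSnoc] at this
  constructor
  · intro h J
    by_contra hJ
    exact (this.2 ⟨J, hJ⟩).2 h
  · intro h
    by_contra hx
    obtain ⟨J, hJ⟩ := this.1 ⟨hv, hx⟩
    exact hJ (h J)

/-- The minors of `e` vectors of the span of `v_1, …, v_e` are proportional to those of `v`. -/
theorem exists_minor_eq_mul {n e : ℕ} (v w : Fin e → Fin n → ℝ)
    (h : Set.range w ⊆ Submodule.span ℝ (Set.range v)) :
    ∃ c : ℝ, ∀ I, minor w I = c * minor v I := by
  have : ∀ j, ∃ c : Fin e → ℝ, ∑ i, c i • v i = w j := fun j =>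
    (Submodule.mem_span_range_iff_exists_fun ℝ).1 (h ⟨j, rfl⟩)
  choose c hc using this
  refine ⟨Matrix.det (Matrix.of fun i j => c j i), fun I => ?_⟩
  unfold minor
  rw [mul_comm, ← Matrix.det_mul]
  congr 1
  ext a b
  rw [Matrix.mul_apply]
  simp only [Matrix.of_apply]
  rw [← hc b]
  simp [mul_comm]

/-- A nonzero finitely generated group of rational numbers is cyclic. -/
theorem exists_generator {ι : Type*} [Finite ι] (η : ι → ℚ) (h : ∃ i, η i ≠ 0) :
    ∃ q : ℚ, 0 < q ∧ AddSubgroup.closure (Set.range η) = AddSubgroup.zmultiples q := by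
  classical
  have := Fintype.ofFinite ι
  let D : ℕ := ∏ i, (η i).den
  have hD : (D : ℚ) ≠ 0 := by
    simp only [D, Nat.cast_prod]
    exact Finset.prod_ne_zero_iff.2 fun i _ => by exact_mod_cast (η i).den_nz
  have hle : AddSubgroup.closure (Set.range η) ≤ AddSubgroup.zmultiples ((D : ℚ)⁻¹) := by
    rw [AddSubgroup.closure_le]
    rintro _ ⟨i, rfl⟩
    obtain ⟨k, hk⟩ : (η i).den ∣ D := Finset.dvd_prod_of_mem _ (Finset.mem_univ i)
    refine AddSubgroup.mem_zmultiples_iff.2 ⟨(η i).num * k, ?_⟩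
    have hk0 : (k : ℚ) ≠ 0 := by rintro h; apply hD; rw [hk]; push_cast; rw [h, mul_zero]
    have hd0 : ((η i).den : ℚ) ≠ 0 := by exact_mod_cast (η i).den_nz
    rw [hk, zsmul_eq_mul]
    push_cast
    rw [mul_inv]
    conv_rhs => rw [← Rat.num_div_den (η i)]
    field_simp
  have hcyc : ∃ g, AddSubgroup.closure (Set.range η) = AddSubgroup.zmultiples g := by
    let f : ℤ →+ ℚ := (zmultiplesHom ℚ) ((D : ℚ)⁻¹)
    have hr : AddSubgroup.zmultiples ((D : ℚ)⁻¹) = f.range := by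
      ext x; simp [f, AddSubgroup.mem_zmultiples_iff]
    obtain ⟨a, ha⟩ := Int.subgroup_cyclic ((AddSubgroup.closure (Set.range η)).comap f)
    refine ⟨f a, ?_⟩
    rw [← AddMonoidHom.map_zmultiples, AddSubgroup.zmultiples_eq_closure, ← ha,
      AddSubgroup.map_comap_eq, ← hr, inf_eq_right.2 hle]
  obtain ⟨g, hg⟩ := hcyc
  have hg0 : g ≠ 0 := by
    rintro rfl
    obtain ⟨i, hi⟩ := h
    have : η i ∈ AddSubgroup.closure (Set.range η) := AddSubgroup.subset_closure ⟨i, rfl⟩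
    rw [hg] at this
    simp at this
    exact hi this
  refine ⟨|g|, abs_pos.2 hg0, ?_⟩
  rw [hg]
  rcases abs_choice g with h | h <;> rw [h]
  exact AddSubgroup.zmultiples_neg.symm

/-! ### Heights of rational subspaces -/

theorem linearIndependent_ofLp_iff {ι : Type*} {n : ℕ} (v : ι → E n) :
    LinearIndependent ℝ (fun j => (v j).ofLp) ↔ LinearIndependent ℝ v :=
  LinearMap.linearIndependent_iff (WithLp.linearEquiv 2 ℝ (Fin n → ℝ)).toLinearMap
    (LinearEquiv.ker _) (v := v)

theorem ofLp_mem_span_iff {ι : Type*} {n : ℕ} (v : ι → E n) (x : E n) :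
    x.ofLp ∈ Submodule.span ℝ (Set.range fun j => (v j).ofLp) ↔
      x ∈ Submodule.span ℝ (Set.range v) := by
  have h : (Set.range fun j => (v j).ofLp) =
      (WithLp.linearEquiv 2 ℝ (Fin n → ℝ)).toLinearMap '' Set.range v := by
    rw [← Set.range_comp]; rfl
  rw [h, Submodule.span_image]
  constructor
  · rintro ⟨y, hy, hyx⟩
    have : y = x := (WithLp.linearEquiv 2 ℝ (Fin n → ℝ)).injective hyx
    exact this ▸ hy
  · intro hx
    exact ⟨x, hx, rfl⟩

theorem ratVec_single {n : ℕ} (i : Fin n) :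
    ratVec (Pi.single i 1) = EuclideanSpace.single i (1 : ℝ) := by
  ext j
  simp only [ratVec, Pi.single_apply, PiLp.single_apply]
  split_ifs <;> simp

/-- The set of values whose infimum is the height. -/
def heightSet {n : ℕ} (B : Submodule ℝ (E n)) : Set ℝ :=
  {h | ∃ (e : ℕ) (v : Fin e → Fin n → ℚ) (q : ℚ), IsRatBasis v B ∧ 0 < q ∧
    AddSubgroup.closure (Set.range (grassmannCoord v)) = AddSubgroup.zmultiples q ∧
    h = √(∑ I, (grassmannCoord v I : ℝ) ^ 2) / (q : ℝ)}

theorem IsRatBasis.finrank_eq {n e : ℕ} {v : Fin e → Fin n → ℚ} {B : Submodule ℝ (E n)}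
    (h : IsRatBasis v B) : finrank ℝ B = e := by
  rw [← h.2, finrank_span_eq_card h.1, Fintype.card_fin]

theorem finrank_of_mem_ratSubspaces {n e : ℕ} {B : Submodule ℝ (E n)}
    (h : B ∈ ratSubspaces n e) : finrank ℝ B = e := by
  obtain ⟨v, hv⟩ := h
  exact hv.finrank_eq

theorem IsRatBasis.exists_coord_ne_zero {n e : ℕ} {v : Fin e → Fin n → ℚ}
    {B : Submodule ℝ (E n)} (h : IsRatBasis v B) : ∃ I, grassmannCoord v I ≠ 0 := by
  obtain ⟨I, hI⟩ := exists_minor_ne_zero _ ((linearIndependent_ofLp_iff _).2 h.1)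
  rw [minor_ratVec] at hI
  exact ⟨I, by exact_mod_cast hI⟩

theorem exists_mem_heightSet {n e : ℕ} {v : Fin e → Fin n → ℚ} {B : Submodule ℝ (E n)}
    (h : IsRatBasis v B) : ∃ q : ℚ, 0 < q ∧
      AddSubgroup.closure (Set.range (grassmannCoord v)) = AddSubgroup.zmultiples q ∧
      √(∑ I, (grassmannCoord v I : ℝ) ^ 2) / (q : ℝ) ∈ heightSet B := by
  obtain ⟨q, hq, hc⟩ := exists_generator _ h.exists_coord_ne_zero
  exact ⟨q, hq, hc, e, v, q, h, hq, hc, rfl⟩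

theorem exists_int_mul_of_closure {ι : Type*} {η : ι → ℚ} {q : ℚ}
    (hc : AddSubgroup.closure (Set.range η) = AddSubgroup.zmultiples q) (i : ι) :
    ∃ k : ℤ, η i = k * q := by
  have : η i ∈ AddSubgroup.closure (Set.range η) := AddSubgroup.subset_closure ⟨i, rfl⟩
  rw [hc, AddSubgroup.mem_zmultiples_iff] at this
  obtain ⟨k, hk⟩ := this
  exact ⟨k, by rw [← hk, zsmul_eq_mul]⟩

theorem abs_le_sqrt_sum_sq {ι : Type*} [Fintype ι] (f : ι → ℝ) (i : ι) :
    |f i| ≤ √(∑ i, f i ^ 2) := by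
  apply Real.abs_le_sqrt
  exact Finset.single_le_sum (f := fun i => f i ^ 2) (fun _ _ => sq_nonneg _) (Finset.mem_univ i)

theorem one_le_of_mem_heightSet {n : ℕ} {B : Submodule ℝ (E n)} {h : ℝ} (hh : h ∈ heightSet B) :
    1 ≤ h := by
  obtain ⟨e, v, q, hv, hq, hc, rfl⟩ := hh
  obtain ⟨I, hI⟩ := hv.exists_coord_ne_zero
  obtain ⟨k, hk⟩ := exists_int_mul_of_closure hc I
  have hq' : (0 : ℝ) < q := by exact_mod_cast hq
  rw [le_div_iff₀ hq', one_mul]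
  refine le_trans ?_ (abs_le_sqrt_sum_sq (fun I => (grassmannCoord v I : ℝ)) I)
  have hk0 : k ≠ 0 := by rintro rfl; apply hI; rw [hk]; simp
  have : (1 : ℝ) ≤ |(k : ℝ)| := by exact_mod_cast Int.one_le_abs hk0
  rw [hk]
  push_cast
  rw [abs_mul, abs_of_pos hq']
  nlinarith

theorem heightSet_nonempty {n e : ℕ} {B : Submodule ℝ (E n)} (hB : B ∈ ratSubspaces n e) :
    (heightSet B).Nonempty := by
  obtain ⟨v, hv⟩ := hB
  obtain ⟨q, -, -, h⟩ := exists_mem_heightSet hv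
  exact ⟨_, h⟩

theorem bddBelow_heightSet {n : ℕ} (B : Submodule ℝ (E n)) : BddBelow (heightSet B) :=
  ⟨1, fun _ h => one_le_of_mem_heightSet h⟩

theorem one_le_height {n e : ℕ} {B : Submodule ℝ (E n)} (hB : B ∈ ratSubspaces n e) :
    1 ≤ height B :=
  le_csInf (heightSet_nonempty hB) fun _ h => one_le_of_mem_heightSet h

theorem height_pos {n e : ℕ} {B : Submodule ℝ (E n)} (hB : B ∈ ratSubspaces n e) :
    0 < height B := zero_lt_one.trans_le (one_le_height hB)

/-- An integer basis bounds the height from above. -/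
theorem height_le_of_int {n e : ℕ} {v : Fin e → Fin n → ℤ} {B : Submodule ℝ (E n)}
    (h : IsRatBasis (fun j i => (v j i : ℚ)) B) :
    height B ≤ √(∑ I, ((minor v I : ℤ) : ℝ) ^ 2) := by
  obtain ⟨q, hq, hc, hm⟩ := exists_mem_heightSet h
  have hg : ∀ I, grassmannCoord (fun j i => (v j i : ℚ)) I = ((minor v I : ℤ) : ℚ) := by
    intro I
    exact ((Int.castRingHom ℚ).map_det _).symm
  refine (csInf_le (bddBelow_heightSet B) hm).trans ?_
  have hle : AddSubgroup.zmultiples q ≤ AddSubgroup.zmultiples (1 : ℚ) := by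
    rw [← hc, AddSubgroup.closure_le]
    rintro _ ⟨I, rfl⟩
    rw [hg]
    exact AddSubgroup.mem_zmultiples_iff.2 ⟨minor v I, by simp⟩
  obtain ⟨k, hk⟩ := AddSubgroup.mem_zmultiples_iff.1 (hle (AddSubgroup.mem_zmultiples q))
  have hk1 : (k : ℚ) = q := by simpa using hk
  have hq1 : (1 : ℝ) ≤ q := by
    rw [← hk1] at hq ⊢
    have : 0 < k := by exact_mod_cast hq
    exact_mod_cast this
  simp only [hg, Rat.cast_intCast]
  exact div_le_self (Real.sqrt_nonneg _) hq1

/-- Two coprime integral minors of a rational basis bound the height from below. -/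
theorem le_height_of_isCoprime {n e : ℕ} {v : Fin e → Fin n → ℚ} {B : Submodule ℝ (E n)}
    (h : IsRatBasis v B) {I J : {I : Finset (Fin n) // I.card = e}} {a b : ℤ}
    (hI : grassmannCoord v I = a) (hJ : grassmannCoord v J = b) (hab : IsCoprime a b) :
    |(a : ℝ)| ≤ height B := by
  refine le_csInf (heightSet_nonempty ⟨v, h⟩) ?_
  rintro _ ⟨e', w, q, hw, hq, hc, rfl⟩
  obtain rfl : e = e' := by rw [← h.finrank_eq, hw.finrank_eq]
  have hsub : (Set.range fun j => (ratVec (w j)).ofLp) ⊆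
      Submodule.span ℝ (Set.range fun j => (ratVec (v j)).ofLp) := by
    rintro _ ⟨j, rfl⟩
    refine (ofLp_mem_span_iff _ _).2 ?_
    rw [h.2, ← hw.2]
    exact Submodule.subset_span ⟨j, rfl⟩
  obtain ⟨c, hcm⟩ := exists_minor_eq_mul _ _ hsub
  simp only [minor_ratVec] at hcm
  obtain ⟨k, hk⟩ := exists_int_mul_of_closure hc I
  obtain ⟨l, hl⟩ := exists_int_mul_of_closure hc J
  obtain ⟨r, s, hrs⟩ := hab
  have hq' : (0 : ℝ) < q := by exact_mod_cast hq
  have h1 := hcm I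
  have h2 := hcm J
  rw [hI, hk] at h1
  rw [hJ, hl] at h2
  push_cast at h1 h2
  -- the proportionality factor is an integral multiple of `q`
  have hcq : c = ((r * k + s * l : ℤ) : ℝ) * q := by
    have hrs' : (r : ℝ) * a + s * b = 1 := by exact_mod_cast hrs
    push_cast
    linear_combination (-c) * hrs' - r * h1 - s * h2
  have hc0 : c ≠ 0 := by
    rintro rfl
    obtain ⟨I', hI'⟩ := hw.exists_coord_ne_zero
    apply hI'
    have := hcm I'
    rw [zero_mul] at this
    exact_mod_cast this
  have hz : r * k + s * l ≠ 0 := by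
    rintro h0
    rw [h0] at hcq
    simp at hcq
    exact hc0 hcq
  have hz1 : (1 : ℝ) ≤ |((r * k + s * l : ℤ) : ℝ)| := by exact_mod_cast Int.one_le_abs hz
  rw [le_div_iff₀ hq']
  refine le_trans ?_ (abs_le_sqrt_sum_sq (fun I => (grassmannCoord w I : ℝ)) I)
  have : (grassmannCoord w I : ℝ) = c * a := by rw [hcm I, hI]; simp
  simp only [this]
  rw [abs_mul, hcq, abs_mul, abs_of_pos hq', mul_comm]
  exact mul_le_mul_of_nonneg_right (le_mul_of_one_le_left hq'.le hz1) (abs_nonneg _)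

theorem IsRatBasis.snoc {n e : ℕ} {v : Fin e → Fin n → ℚ} {B : Submodule ℝ (E n)}
    (h : IsRatBasis v B) {x : Fin n → ℚ} (hx : ratVec x ∉ B) :
    IsRatBasis (Fin.snoc (α := fun _ => Fin n → ℚ) v x) (B ⊔ Submodule.span ℝ {ratVec x}) := by
  have hs : (fun j => ratVec (Fin.snoc (α := fun _ => Fin n → ℚ) v x j)) =
      Fin.snoc (α := fun _ => E n) (fun j => ratVec (v j)) (ratVec x) := by
    funext j
    refine Fin.lastCases ?_ (fun i => ?_) j <;> simp
  unfold IsRatBasis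
  rw [hs, linearIndependent_finSnoc]
  refine ⟨⟨h.1, by rwa [h.2]⟩, ?_⟩
  rw [Fin.range_snoc, Submodule.span_insert, h.2, sup_comm]

theorem norm_coord_le {n : ℕ} (x : E n) (i : Fin n) : |x i| ≤ ‖x‖ := by
  have := PiLp.norm_apply_le x i
  simpa using this

/-- The minors of a basis of `B` extended by `x` are controlled by those of the basis of `B` and
the distance from `x` to `B`. -/
theorem sqrt_sum_sq_snoc_le {n e : ℕ} {v : Fin e → Fin n → ℚ} {B : Submodule ℝ (E n)}
    (h : IsRatBasis v B) (x : Fin n → ℚ) {z : E n} (hz : z ∈ B) :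
    √(∑ J, (grassmannCoord (Fin.snoc (α := fun _ => Fin n → ℚ) v x) J : ℝ) ^ 2) ≤
      √(Fintype.card {I : Finset (Fin n) // I.card = e + 1} : ℝ) * (e + 1) * ‖ratVec x - z‖ *
        √(∑ I, (grassmannCoord v I : ℝ) ^ 2) := by
  set M := √(∑ I, (grassmannCoord v I : ℝ) ^ 2) with hM
  have hb : ∀ J, |(grassmannCoord (Fin.snoc (α := fun _ => Fin n → ℚ) v x) J : ℝ)| ≤
      (e + 1) * ‖ratVec x - z‖ * M := by
    intro J
    have hs : (fun (j : Fin (e + 1)) (i : Fin n) =>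
        (ratVec (Fin.snoc (α := fun _ => Fin n → ℚ) v x j)) i) =
        Fin.snoc (α := fun _ => Fin n → ℝ) (fun j => (ratVec (v j)).ofLp) (ratVec x).ofLp := by
      funext j
      refine Fin.lastCases ?_ (fun i => ?_) j <;> simp
    rw [← minor_ratVec, hs, ← minor_snoc_sub _ _ z.ofLp
      (by rw [ofLp_mem_span_iff, h.2]; exact hz), minor_snoc]
    refine (Finset.abs_sum_le_sum_abs _ _).trans ?_
    have : ∀ i ∈ (Finset.univ : Finset (Fin (e + 1))),
        |(-1) ^ ((i : ℕ) + e) * ((ratVec x).ofLp - z.ofLp) (J.1.orderEmbOfFin J.2 i) *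
          minor (fun j => (ratVec (v j)).ofLp) (eraseRow J i)| ≤
          ‖ratVec x - z‖ * M := by
      intro i _
      rw [abs_mul, abs_mul, abs_pow, abs_neg, abs_one, one_pow, one_mul]
      refine mul_le_mul (norm_coord_le (ratVec x - z) _) ?_ (abs_nonneg _) (norm_nonneg _)
      have := minor_ratVec v (eraseRow J i)
      rw [this]
      exact abs_le_sqrt_sum_sq (fun I => (grassmannCoord v I : ℝ)) _
    refine (Finset.sum_le_card_nsmul _ _ _ this).trans ?_
    simp [mul_assoc]
  have hnn : 0 ≤ (e + 1) * ‖ratVec x - z‖ * M := by positivity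
  refine Real.sqrt_le_iff.2 ⟨by positivity, ?_⟩
  calc _ ≤ ∑ J : {I : Finset (Fin n) // I.card = e + 1}, ((e + 1) * ‖ratVec x - z‖ * M) ^ 2 :=
        Finset.sum_le_sum fun J _ => by
          rw [← sq_abs]; exact pow_le_pow_left₀ (abs_nonneg _) (hb J) 2
    _ = _ := by
        rw [Finset.sum_const, nsmul_eq_mul, mul_assoc √_, mul_assoc √_, mul_pow √_,
          Real.sq_sqrt (by positivity)]
        simp

/-- Adding an integer vector `x` to a rational subspace `B` multiplies the height by at most a
constant times the distance from `x` to `B`. -/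
theorem exists_height_sup_le (n e : ℕ) : ∃ c : ℝ, 0 < c ∧ ∀ B ∈ ratSubspaces n e,
    ∀ x : Fin n → ℤ, ratVec (fun i => (x i : ℚ)) ∉ B →
      B ⊔ Submodule.span ℝ {ratVec (fun i => (x i : ℚ))} ∈ ratSubspaces n (e + 1) ∧
      ∀ z ∈ B, height (B ⊔ Submodule.span ℝ {ratVec (fun i => (x i : ℚ))}) ≤
        c * ‖ratVec (fun i => (x i : ℚ)) - z‖ * height B := by
  refine ⟨√(Fintype.card {I : Finset (Fin n) // I.card = e + 1} : ℝ) * (e + 1) + 1, by positivity,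
    fun B hB x hx => ⟨?_, fun z hz => ?_⟩⟩
  · obtain ⟨v, hv⟩ := hB
    exact ⟨_, hv.snoc hx⟩
  set X := ratVec (fun i => (x i : ℚ)) with hX
  set c := √(Fintype.card {I : Finset (Fin n) // I.card = e + 1} : ℝ) * (e + 1) with hc
  have hc0 : 0 ≤ c := by positivity
  have hd : 0 < ‖X - z‖ := norm_pos_iff.2 fun h => hx (by rw [sub_eq_zero] at h; rwa [h])
  have hcd : 0 < (c + 1) * ‖X - z‖ := by positivity
  rw [mul_comm, ← div_le_iff₀ hcd]
  refine le_csInf (heightSet_nonempty hB) ?_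
  rintro _ ⟨e', v, q, hv, hq, hcl, rfl⟩
  obtain rfl : e = e' := by rw [← finrank_of_mem_ratSubspaces hB, hv.finrank_eq]
  rw [div_le_iff₀ hcd]
  obtain ⟨q', hq0', hcl', hm⟩ := exists_mem_heightSet (hv.snoc hx)
  refine (csInf_le (bddBelow_heightSet _) hm).trans ?_
  have hle : AddSubgroup.zmultiples q' ≤ AddSubgroup.zmultiples q := by
    rw [← hcl', AddSubgroup.closure_le]
    rintro _ ⟨J, rfl⟩
    have hJ := minor_snoc v (fun i => (x i : ℚ)) J
    change grassmannCoord _ J = _ at hJ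
    rw [hJ]
    refine AddSubgroup.sum_mem _ fun i _ => ?_
    obtain ⟨k, hk⟩ := exists_int_mul_of_closure hcl (eraseRow J i)
    change minor v _ = _ at hk
    rw [hk]
    refine AddSubgroup.mem_zmultiples_iff.2
      ⟨(-1) ^ ((i : ℕ) + e) * x (J.1.orderEmbOfFin J.2 i) * k, ?_⟩
    rw [zsmul_eq_mul]
    push_cast
    ring
  obtain ⟨k, hk⟩ := AddSubgroup.mem_zmultiples_iff.1 (hle (AddSubgroup.mem_zmultiples q'))
  rw [zsmul_eq_mul] at hk
  have hqr : (0 : ℝ) < q := by exact_mod_cast hq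
  have hqq : (q : ℝ) ≤ q' := by
    have hk0 : 0 < k := by
      by_contra hneg
      have : (k : ℚ) ≤ 0 := by exact_mod_cast not_lt.1 hneg
      nlinarith
    have : (1 : ℚ) ≤ k := by exact_mod_cast hk0
    have : q ≤ q' := by nlinarith
    exact_mod_cast this
  have hb := sqrt_sum_sq_snoc_le hv (fun i => (x i : ℚ)) hz
  set M := √(∑ I, (grassmannCoord v I : ℝ) ^ 2)
  calc _ ≤ _ / (q : ℝ) := div_le_div_of_nonneg_left (Real.sqrt_nonneg _) hqr hqq
    _ ≤ ((c + 1) * ‖X - z‖ * M) / q := by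
        gcongr
        refine hb.trans ?_
        gcongr
        linarith
    _ = _ := by ring

/-- There are finitely many rational subspaces of bounded height. -/
theorem finite_height_le (n e : ℕ) (H : ℝ) :
    {B | B ∈ ratSubspaces n e ∧ height B ≤ H}.Finite := by
  have hex : ∀ B : Submodule ℝ (E n), ∃ g : {I : Finset (Fin n) // I.card = e} → ℤ,
      B ∈ ratSubspaces n e ∧ height B ≤ H →
      (∀ I, |g I| ≤ ⌈H + 1⌉) ∧ ∃ (v : Fin e → Fin n → ℚ) (q : ℚ), IsRatBasis v B ∧ q ≠ 0 ∧
        ∀ I, grassmannCoord v I = g I * q := by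
    intro B
    by_cases hB : B ∈ ratSubspaces n e ∧ height B ≤ H
    swap
    · exact ⟨0, fun h => absurd h hB⟩
    obtain ⟨_, ⟨e', v, q, hv, hq, hcl, rfl⟩, hlt⟩ := exists_lt_of_csInf_lt
      (heightSet_nonempty hB.1) (show height B < H + 1 by linarith [hB.2])
    obtain rfl : e = e' := by rw [← finrank_of_mem_ratSubspaces hB.1, hv.finrank_eq]
    choose g hg using exists_int_mul_of_closure hcl
    have hqr : (0 : ℝ) < q := by exact_mod_cast hq
    refine ⟨g, fun _ => ⟨fun I => ?_, v, q, hv, hq.ne', hg⟩⟩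
    have h1 := abs_le_sqrt_sum_sq (fun I => (grassmannCoord v I : ℝ)) I
    rw [div_lt_iff₀ hqr] at hlt
    have h2 : |(g I : ℝ)| * q < (H + 1) * q := by
      refine lt_of_le_of_lt ?_ hlt
      refine le_trans ?_ h1
      simp only [hg]
      push_cast
      rw [abs_mul, abs_of_pos hqr]
    have h3 : |(g I : ℝ)| < H + 1 := lt_of_mul_lt_mul_right h2 hqr.le
    have h4 : ((|g I| : ℤ) : ℝ) ≤ (⌈H + 1⌉ : ℤ) := by
      push_cast
      exact h3.le.trans (Int.le_ceil _)
    exact_mod_cast h4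
  choose g hg using hex
  refine Set.Finite.of_finite_image (f := g) ?_ ?_
  · refine (Set.finite_Icc (fun _ => -⌈H + 1⌉) (fun _ => ⌈H + 1⌉)).subset ?_
    rintro _ ⟨B, hB, rfl⟩
    exact ⟨fun I => (abs_le.1 ((hg B hB).1 I)).1, fun I => (abs_le.1 ((hg B hB).1 I)).2⟩
  · intro B hB B' hB' hgg
    obtain ⟨-, v, q, hv, hq, hvg⟩ := hg B hB
    obtain ⟨-, v', q', hv', hq', hvg'⟩ := hg B' hB'
    -- membership is a system of linear equations with the minors as coefficients
    have key : ∀ (B : Submodule ℝ (E n)) (v : Fin e → Fin n → ℚ) (q : ℚ), IsRatBasis v B → q ≠ 0 →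
        (∀ I, grassmannCoord v I = g B I * q) → ∀ x : E n, x ∈ B ↔
        ∀ J : {I : Finset (Fin n) // I.card = e + 1}, ∑ i : Fin (e + 1),
          (-1) ^ ((i : ℕ) + e) * x (J.1.orderEmbOfFin J.2 i) *
          (g B (eraseRow J i) : ℝ) = 0 := by
      intro B v q hv hq hvg x
      have hx : x ∈ B ↔ x ∈ Submodule.span ℝ (Set.range fun j => ratVec (v j)) := by rw [hv.2]
      rw [hx, ← ofLp_mem_span_iff, mem_span_iff_minor _ ((linearIndependent_ofLp_iff _).2 hv.1)]
      refine forall_congr' fun J => ?_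
      rw [minor_snoc]
      have hq' : (q : ℝ) ≠ 0 := by exact_mod_cast hq
      have hz : ∀ s t : ℝ, s = t * q → (s = 0 ↔ t = 0) := fun s t h => by
        rw [h, mul_eq_zero, or_iff_left hq']
      refine hz _ _ ?_
      rw [Finset.sum_mul]
      refine Finset.sum_congr rfl fun i _ => ?_
      have := minor_ratVec v (eraseRow J i)
      rw [this, hvg]
      push_cast
      ring
    ext x
    rw [key B v q hv hq hvg, key B' v' q' hv' hq' hvg', hgg]

/-! ### Angles and distances -/

theorem wedgeNorm_sq {n : ℕ} (X Y : E n) :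
    wedgeNorm X Y ^ 2 = ‖X‖ ^ 2 * ‖Y‖ ^ 2 - inner ℝ X Y ^ 2 := by
  unfold wedgeNorm
  rw [Real.sq_sqrt (Finset.sum_nonneg fun _ _ => sq_nonneg _), EuclideanSpace.real_norm_sq_eq,
    EuclideanSpace.real_norm_sq_eq]
  have hin : inner ℝ X Y = ∑ i, X i * Y i := by
    rw [PiLp.inner_apply]
    exact Finset.sum_congr rfl fun i _ => by simp [mul_comm]
  rw [hin]
  set f : Fin n × Fin n → ℝ := fun p => (X p.1 * Y p.2 - X p.2 * Y p.1) ^ 2 with hf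
  have hall : ∑ p, f p = 2 * ((∑ i, X i ^ 2) * (∑ i, Y i ^ 2) - (∑ i, X i * Y i) ^ 2) := by
    have h1 : (∑ i, X i ^ 2) * (∑ i, Y i ^ 2) = ∑ p : Fin n × Fin n, X p.1 ^ 2 * Y p.2 ^ 2 := by
      rw [Finset.sum_mul_sum, Fintype.sum_prod_type]
    have h2 : (∑ i, Y i ^ 2) * (∑ i, X i ^ 2) = ∑ p : Fin n × Fin n, Y p.1 ^ 2 * X p.2 ^ 2 := by
      rw [Finset.sum_mul_sum, Fintype.sum_prod_type]
    have h3 : (∑ i, X i * Y i) ^ 2 = ∑ p : Fin n × Fin n, X p.1 * Y p.1 * (X p.2 * Y p.2) := by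
      rw [sq, Finset.sum_mul_sum, Fintype.sum_prod_type]
    rw [show ∀ a b : ℝ, 2 * (a - b) = a + a - 2 * b by intros; ring]
    nth_rewrite 2 [mul_comm]
    rw [h1, h2, h3, Finset.mul_sum, ← Finset.sum_add_distrib, ← Finset.sum_sub_distrib]
    exact Finset.sum_congr rfl fun p _ => by simp only [hf]; ring
  have hsplit := Finset.sum_filter_add_sum_filter_not Finset.univ
    (fun p : Fin n × Fin n => p.1 < p.2) f
  have hsym : ∑ p with ¬ p.1 < p.2, f p = ∑ p : Fin n × Fin n with p.1 < p.2, f p := by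
    symm
    refine Finset.sum_of_injOn Prod.swap Prod.swap_injective.injOn ?_ ?_ ?_
    · intro p hp
      simp only [Finset.coe_filter, Finset.mem_univ, true_and, Set.mem_ofPred_eq, Prod.fst_swap,
        Prod.snd_swap, not_lt] at hp ⊢
      exact hp.le
    · intro p hp hp'
      simp only [Finset.mem_filter, Finset.mem_univ, true_and, not_lt] at hp
      rcases hp.eq_or_lt with h | h
      · simp [hf, h]
      · exact absurd ⟨p.swap, by simpa using h, by simp⟩ hp'
    · intro p _
      simp only [hf, Prod.fst_swap, Prod.snd_swap]
      ring
  rw [hsym, hall] at hsplit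
  linarith

theorem wedgeNorm_nonneg {n : ℕ} (X Y : E n) : 0 ≤ wedgeNorm X Y := Real.sqrt_nonneg _

theorem wedgeNorm_eq_norm_sub {n : ℕ} (X : E n) {Y : E n} (hY : Y ≠ 0) :
    wedgeNorm X Y / ‖Y‖ = ‖X - (inner ℝ X Y / ‖Y‖ ^ 2) • Y‖ := by
  have hY' : 0 < ‖Y‖ := norm_pos_iff.2 hY
  rw [← sq_eq_sq₀ (div_nonneg (wedgeNorm_nonneg _ _) hY'.le) (norm_nonneg _), div_pow, wedgeNorm_sq,
    norm_sub_sq_real, inner_smul_right, norm_smul, Real.norm_eq_abs, mul_pow, sq_abs]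
  field_simp
  ring

theorem wedgeNorm_le {n : ℕ} (X Y : E n) : wedgeNorm X Y ≤ ‖X - Y‖ * ‖Y‖ := by
  have h : wedgeNorm X Y = wedgeNorm (X - Y) Y := by
    unfold wedgeNorm
    congr 1
    refine Finset.sum_congr rfl fun p _ => ?_
    simp only [PiLp.sub_apply]
    ring
  rw [h, ← sq_le_sq₀ (wedgeNorm_nonneg _ _) (by positivity), wedgeNorm_sq, mul_pow]
  nlinarith [sq_nonneg (inner ℝ (X - Y) Y)]

theorem sinAngle_nonneg {n : ℕ} (X Y : E n) : 0 ≤ sinAngle X Y :=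
  div_nonneg (wedgeNorm_nonneg _ _) (by positivity)

theorem firstAngle_le {n : ℕ} {A B : Submodule ℝ (E n)} {X Y : E n} (hX : X ∈ A) (hY : Y ∈ B)
    (hX0 : X ≠ 0) (hY0 : Y ≠ 0) : firstAngle A B ≤ ‖X - Y‖ / ‖X‖ := by
  have hX' : 0 < ‖X‖ := norm_pos_iff.2 hX0
  have hY' : 0 < ‖Y‖ := norm_pos_iff.2 hY0
  have h : firstAngle A B ≤ sinAngle X Y := by
    refine csInf_le ⟨0, ?_⟩ ⟨X, hX, Y, hY, hX0, hY0, rfl⟩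
    rintro _ ⟨X, -, Y, -, -, -, rfl⟩
    exact sinAngle_nonneg _ _
  refine h.trans ?_
  unfold sinAngle
  rw [div_le_div_iff₀ (by positivity) hX']
  have := wedgeNorm_le X Y
  nlinarith

theorem exists_norm_sub_lt_of_firstAngle_lt {n : ℕ} {A B : Submodule ℝ (E n)} (hA : A ≠ ⊥)
    (hB : B ≠ ⊥) {t : ℝ} (h : firstAngle A B < t) :
    ∃ X ∈ A, ‖X‖ = 1 ∧ ∃ Z ∈ B, ‖X - Z‖ < t := by
  obtain ⟨X₀, hX₀, hX₀'⟩ := Submodule.exists_mem_ne_zero_of_ne_bot hA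
  obtain ⟨Y₀, hY₀, hY₀'⟩ := Submodule.exists_mem_ne_zero_of_ne_bot hB
  obtain ⟨_, ⟨X, hX, Y, hY, hX0, hY0, rfl⟩, hlt⟩ := exists_lt_of_csInf_lt
    (s := {r | ∃ X ∈ A, ∃ Y ∈ B, X ≠ 0 ∧ Y ≠ 0 ∧ r = sinAngle X Y})
    ⟨_, X₀, hX₀, Y₀, hY₀, hX₀', hY₀', rfl⟩ h
  have hX' : 0 < ‖X‖ := norm_pos_iff.2 hX0
  refine ⟨‖X‖⁻¹ • X, A.smul_mem _ hX, ?_, ‖X‖⁻¹ • (inner ℝ X Y / ‖Y‖ ^ 2) • Y,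
    B.smul_mem _ (B.smul_mem _ hY), ?_⟩
  · rw [norm_smul, norm_inv, norm_norm, inv_mul_cancel₀ hX'.ne']
  · rw [← smul_sub, norm_smul, ← wedgeNorm_eq_norm_sub X hY0, norm_inv, norm_norm]
    have h' : ‖X‖⁻¹ * (wedgeNorm X Y / ‖Y‖) = sinAngle X Y := by
      unfold sinAngle
      rw [mul_comm ‖X‖, ← div_div, div_eq_inv_mul _ ‖X‖]
    rwa [h']

/-- Two subspaces with trivial intersection make a positive angle. -/
theorem exists_le_norm_sub_of_inf_eq_bot {n : ℕ} {A B : Submodule ℝ (E n)} (h : A ⊓ B = ⊥) :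
    ∃ c : ℝ, 0 < c ∧ ∀ X ∈ A, ∀ Z ∈ B, c * ‖X‖ ≤ ‖X - Z‖ := by
  let f : A × B →ₗ[ℝ] E n := A.subtype.coprod (-B.subtype)
  have hf : LinearMap.ker f = ⊥ := by
    rw [LinearMap.ker_eq_bot']
    rintro ⟨x, z⟩ hxz
    simp only [f, LinearMap.coprod_apply, Submodule.subtype_apply, LinearMap.neg_apply] at hxz
    have hxz' : (x : E n) = z := by rw [← sub_eq_zero, sub_eq_add_neg]; exact hxz
    have hm : (x : E n) ∈ A ⊓ B := ⟨x.2, hxz' ▸ z.2⟩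
    rw [h, Submodule.mem_bot] at hm
    ext1
    · exact Subtype.ext hm
    · exact Subtype.ext (hxz' ▸ hm)
  obtain ⟨K, hK, hK'⟩ := f.exists_antilipschitzWith hf
  have hK0 : (0 : ℝ) < K := by exact_mod_cast hK
  refine ⟨(K : ℝ)⁻¹, by positivity, fun X hX Z hZ => ?_⟩
  have := hK'.le_mul_dist (⟨X, hX⟩, ⟨Z, hZ⟩) 0
  rw [map_zero, dist_zero_right, dist_zero_right] at this
  rw [inv_mul_le_iff₀ hK0]
  refine le_trans ?_ (this.trans_eq ?_)
  · exact le_max_left ‖(⟨X, hX⟩ : A)‖ ‖(⟨Z, hZ⟩ : B)‖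
  · simp [f, sub_eq_add_neg]

/-- `A` is not approximated by rational subspaces of dimension `e` better than with exponent `K`,
up to a constant. -/
def BadlyApprox {n : ℕ} (A : Submodule ℝ (E n)) (e : ℕ) (K : ℝ) : Prop :=
  ∃ c : ℝ, 0 < c ∧ ∀ B ∈ ratSubspaces n e, ∀ X ∈ A, ∀ Z ∈ B,
    c * ‖X‖ ≤ height B ^ K * ‖X - Z‖

/-- A bound for the approximations by subspaces of large height extends to all the subspaces when
`A` meets none of them. -/
theorem badlyApprox_of_large {n e : ℕ} {A : Submodule ℝ (E n)} {K H₀ : ℝ} (hK : 0 ≤ K)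
    (hA : ∀ B ∈ ratSubspaces n e, A ⊓ B = ⊥)
    (h : ∀ B ∈ ratSubspaces n e, ∀ X ∈ A, ‖X‖ = 1 → ∀ Z ∈ B, ‖X - Z‖ ≤ 2 / height B ^ K →
      height B ≤ H₀) : BadlyApprox A e K := by
  have hex : ∀ B : Submodule ℝ (E n), ∃ c : ℝ, 0 < c ∧ (B ∈ ratSubspaces n e →
      ∀ X ∈ A, ∀ Z ∈ B, c * ‖X‖ ≤ ‖X - Z‖) := by
    intro B
    by_cases hB : B ∈ ratSubspaces n e
    · obtain ⟨c, hc, h⟩ := exists_le_norm_sub_of_inf_eq_bot (hA B hB)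
      exact ⟨c, hc, fun _ => h⟩
    · exact ⟨1, one_pos, fun h => absurd h hB⟩
  choose c hc hcb using hex
  obtain ⟨M, hM⟩ := ((finite_height_le n e H₀).image fun B => (c B)⁻¹).bddAbove
  have hM1 : 0 < max M 1 := lt_max_of_lt_right one_pos
  refine ⟨min 2 (max M 1)⁻¹, by positivity, fun B hB X hX Z hZ => ?_⟩
  have hH := one_le_height hB
  have hHK : 1 ≤ height B ^ K := Real.one_le_rpow hH hK
  by_cases hBH : height B ≤ H₀
  · have h1 : (c B)⁻¹ ≤ max M 1 := (hM ⟨B, ⟨hB, hBH⟩, rfl⟩).trans (le_max_left _ _)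
    have h2 : (max M 1)⁻¹ ≤ c B := inv_le_of_inv_le₀ (hc B) h1
    calc min 2 (max M 1)⁻¹ * ‖X‖ ≤ c B * ‖X‖ := by
          gcongr; exact (min_le_right _ _).trans h2
      _ ≤ ‖X - Z‖ := hcb B hB X hX Z hZ
      _ ≤ _ := le_mul_of_one_le_left (norm_nonneg _) hHK
  · by_cases hX0 : X = 0
    · subst hX0
      rw [norm_zero, mul_zero]
      positivity
    have hXp : 0 < ‖X‖ := norm_pos_iff.2 hX0
    have h1 : ¬ ‖‖X‖⁻¹ • X - ‖X‖⁻¹ • Z‖ ≤ 2 / height B ^ K := fun h' => hBH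
      (h B hB _ (A.smul_mem _ hX) (by rw [norm_smul, norm_inv, norm_norm,
        inv_mul_cancel₀ hXp.ne']) _ (B.smul_mem _ hZ) h')
    rw [← smul_sub, norm_smul, norm_inv, norm_norm, not_le, inv_mul_eq_div,
      div_lt_div_iff₀ (by positivity) hXp] at h1
    calc min 2 (max M 1)⁻¹ * ‖X‖ ≤ 2 * ‖X‖ := by gcongr; exact min_le_left _ _
      _ ≤ ‖X - Z‖ * height B ^ K := h1.le
      _ = _ := mul_comm _ _

/-! ### Growth of the exponents -/

/-- The product `α_k = b_1 ⋯ b_k`. -/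
noncomputable def growth (b : ℕ → ℝ) (k : ℕ) : ℝ := ∏ i ∈ Finset.Icc 1 k, b i

/-- The exponent `⌊α_k⌋`. -/
noncomputable def expo (b : ℕ → ℝ) (k : ℕ) : ℕ := ⌊growth b k⌋₊

@[simp] theorem growth_zero (b : ℕ → ℝ) : growth b 0 = 1 := by simp [growth]

theorem growth_succ (b : ℕ → ℝ) (k : ℕ) : growth b (k + 1) = growth b k * b (k + 1) := by
  unfold growth
  rw [Finset.prod_Icc_succ_top (by omega)]

theorem growth_add (b : ℕ → ℝ) (N e : ℕ) :
    growth b (N + e) = growth b N * ∏ i ∈ Finset.Icc (N + 1) (N + e), b i := by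
  induction e with
  | zero => simp
  | succ e ih =>
    rw [← add_assoc, growth_succ, ih, Finset.prod_Icc_succ_top (by omega), mul_assoc]

section
variable {b : ℕ → ℝ} {C : ℝ} (hb : ∀ i, 1 ≤ i → C ≤ b i) (hC : 2 ≤ C)
include hb hC

theorem growth_pos (k : ℕ) : 0 < growth b k :=
  Finset.prod_pos fun i hi => by linarith [hb i (Finset.mem_Icc.1 hi).1]

theorem mul_growth_le (k : ℕ) : C * growth b k ≤ growth b (k + 1) := by
  rw [growth_succ, mul_comm]
  exact mul_le_mul_of_nonneg_left (hb _ (by omega)) (growth_pos hb hC k).le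

theorem natCast_add_one_le_growth (k : ℕ) : (k : ℝ) + 1 ≤ growth b k := by
  induction k with
  | zero => simp
  | succ k ih =>
    have := mul_growth_le hb hC k
    push_cast
    nlinarith [(Nat.cast_nonneg k : (0 : ℝ) ≤ k)]

theorem growth_mono : Monotone (growth b) :=
  monotone_nat_of_le_succ fun k => by
    have := mul_growth_le hb hC k
    nlinarith [growth_pos hb hC k]

theorem expo_le (k : ℕ) : (expo b k : ℝ) ≤ growth b k := Nat.floor_le (growth_pos hb hC k).le

omit hb hC in
theorem lt_expo (k : ℕ) : growth b k - 1 < expo b k := by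
  have := Nat.lt_floor_add_one (growth b k)
  unfold expo
  linarith

theorem expo_lt_succ (k : ℕ) : expo b k < expo b (k + 1) := by
  have h1 := mul_growth_le hb hC k
  have h2 := natCast_add_one_le_growth hb hC k
  have h3 := expo_le hb hC k
  have h4 := lt_expo (b := b) (k + 1)
  have : (expo b k : ℝ) < expo b (k + 1) := by
    nlinarith [(Nat.cast_nonneg k : (0 : ℝ) ≤ k)]
  exact_mod_cast this

theorem expo_strictMono : StrictMono (expo b) := strictMono_nat_of_lt_succ (expo_lt_succ hb hC)

end

/-- For every large `h` there are `e` consecutive indices whose truncations are, on a logarithmic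
scale, neither too large with respect to `h` nor too poorly approximating. -/
theorem exists_index {b : ℕ → ℝ} {C κ μ ε D : ℝ} {e : ℕ} (hb : ∀ i, 1 ≤ i → C ≤ b i)
    (he : 1 ≤ e) (hκ : 1 ≤ κ) (hC : κ + 1 ≤ C) (hCκ : κ + 2 ≤ C / κ + κ / C) (hε : 0 < ε)
    (hμ : ∀ N, growth b (N + e) + ε * growth b N ≤ μ * growth b N) (hD : 0 ≤ D) (N₀ : ℕ) :
    ∃ h₀ : ℝ, ∀ h ≥ h₀, ∃ N ≥ N₀, ∀ M, N ≤ M → M < N + e →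
      κ * (h + growth b M) + D < μ * h ∧ κ * (h + growth b M) + D < growth b (M + 1) := by
  have hC2 : 2 ≤ C := by linarith
  have hpos := growth_pos hb hC2
  have hmono := growth_mono hb hC2
  set s := 1 / κ - 1 / C with hs
  have hs0 : 0 < s := by
    rw [hs, sub_pos]
    exact one_div_lt_one_div_of_lt (by linarith) (by linarith)
  obtain ⟨N₁, hN₁⟩ := exists_nat_gt (|μ| * D / κ / (ε * s))
  set N₂ := max N₀ N₁ + 1 with hN₂
  refine ⟨growth b N₂, fun h hh => ?_⟩
  have hh0 : 0 < h := (hpos N₂).trans_le hh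
  -- `N` is the least index at which the second inequality holds
  have hex : ∃ N, κ * (h + growth b N) + D < growth b (N + 1) := by
    obtain ⟨N, hN⟩ := exists_nat_gt (κ * h + D)
    refine ⟨N, ?_⟩
    have h1 := mul_growth_le hb hC2 N
    have h2 := natCast_add_one_le_growth hb hC2 N
    nlinarith [hpos N]
  classical
  set N := Nat.find hex with hN
  have hNs : κ * (h + growth b N) + D < growth b (N + 1) := Nat.find_spec hex
  have hNN : N₂ ≤ N := by
    by_contra hlt
    have h1 : growth b (N + 1) ≤ growth b N₂ := hmono (by omega)
    nlinarith [hpos N]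
  obtain ⟨N', hN'⟩ : ∃ N', N = N' + 1 := ⟨N - 1, by omega⟩
  have hprev : growth b (N' + 1) ≤ κ * (h + growth b N') + D :=
    not_lt.1 (Nat.find_min hex (m := N') (by omega))
  refine ⟨N, by omega, fun M hNM hMe => ⟨?_, ?_⟩⟩
  · have hA' : growth b M ≤ growth b (N + (e - 1)) := hmono (by omega)
    have hAA : growth b N ≤ growth b (N + (e - 1)) := hmono (by omega)
    have hCA : C * growth b (N + (e - 1)) ≤ growth b (N + e) := by
      have := mul_growth_le hb hC2 (N + (e - 1))
      rwa [show N + (e - 1) + 1 = N + e by omega] at this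
    have hμN := hμ N
    have hCN : C * growth b N' ≤ growth b N := by rw [hN']; exact mul_growth_le hb hC2 N'
    rw [← hN'] at hprev
    have hlarge : |μ| * D / κ < ε * s * growth b N := by
      have h2 := natCast_add_one_le_growth hb hC2 N
      have h3 : (N₁ : ℝ) ≤ N := by exact_mod_cast (by omega : N₁ ≤ N)
      rw [div_lt_iff₀ (by positivity)] at hN₁
      have h4 : (N₁ : ℝ) * (ε * s) ≤ growth b N * (ε * s) := by gcongr; linarith
      linarith
    generalize growth b N = A at *
    generalize growth b (N + (e - 1)) = A' at *
    have hCp : 0 < C := by linarith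
    have hκp : 0 < κ := by linarith
    have hh1 : s * A - D / κ ≤ h := by
      have h1 : growth b N' ≤ A / C := by rw [le_div_iff₀ hCp]; linarith
      have h2 : A ≤ κ * (h + A / C) + D := hprev.trans (by gcongr)
      have h3 : A / κ ≤ h + A / C + D / κ := by
        rw [div_le_iff₀ hκp]
        calc A ≤ _ := h2
          _ = _ := by field_simp
      rw [hs, sub_mul, one_div_mul_eq_div, one_div_mul_eq_div]
      linarith
    have hAp : 0 < A := by
      have := hpos N'
      nlinarith
    have hμκ : κ ≤ μ := by
      by_contra hlt
      nlinarith
    have hμ0 : 0 ≤ μ := by linarith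
    rw [abs_of_nonneg hμ0] at hlarge
    have hsC : s * C = C / κ - 1 := by rw [hs]; field_simp
    have hsκ : s * κ = 1 - κ / C := by rw [hs]; field_simp
    have hκC : κ / C ≤ 1 := by rw [div_le_one hCp]; linarith
    have h5 : (μ - κ) * (s * A - D / κ) ≤ (μ - κ) * h :=
      mul_le_mul_of_nonneg_left hh1 (by linarith)
    have h6 : s * (C * A' + ε * A) ≤ s * (μ * A) :=
      mul_le_mul_of_nonneg_left (by linarith) hs0.le
    have h7 : (C / κ - 1 - κ) * A ≤ (C / κ - 1 - κ) * A' :=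
      mul_le_mul_of_nonneg_left hAA (by linarith)
    have h8 : 0 ≤ (C / κ + κ / C - κ - 2) * A := mul_nonneg (by linarith) hAp.le
    have h9 : κ * growth b M ≤ κ * A' := mul_le_mul_of_nonneg_left hA' hκp.le
    have h10 : (μ - κ) * (s * A - D / κ) = s * (μ * A) - (s * κ) * A - μ * D / κ + D := by
      field_simp
      ring
    rw [hsκ] at h10
    have h11 : s * (C * A' + ε * A) = (s * C) * A' + ε * s * A := by ring
    rw [hsC] at h11
    nlinarith
  · rcases hNM.eq_or_lt with h1 | h1
    · rw [← h1]; exact hNs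
    · have h2 := mul_growth_le hb hC2 M
      have h3 : growth b (N + 1) ≤ growth b M := hmono h1
      nlinarith [hpos N, hpos M]

theorem pow_rpow_eq {T : ℝ} (hT : 0 < T) (k : ℕ) (μ : ℝ) : (T ^ k) ^ μ = T ^ (k * μ) := by
  rw [← Real.rpow_natCast, ← Real.rpow_mul hT.le]

theorem exists_index_pow {b : ℕ → ℝ} {C κ μ ε c T : ℝ} {e : ℕ} (hb : ∀ i, 1 ≤ i → C ≤ b i)
    (he : 1 ≤ e) (hκ : 1 ≤ κ) (hC : κ + 1 ≤ C) (hCκ : κ + 2 ≤ C / κ + κ / C) (hε : 0 < ε)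
    (hμ : ∀ N, growth b (N + e) + ε * growth b N ≤ μ * growth b N) (hT : 1 < T) (hc : 0 < c)
    (N₀ : ℕ) : ∃ H₀ : ℝ, ∀ H, 1 ≤ H → H₀ ≤ H → ∃ N ≥ N₀, ∀ M, N ≤ M → M < N + e →
      c * (H * T ^ expo b M) ^ κ * (2 / H ^ μ + 1 / T ^ expo b (M + 1)) < 1 := by
  have hC2 : 2 ≤ C := by linarith
  have hT0 : 0 < T := by linarith
  -- `T ^ D` absorbs the constant `c`, and a factor `T` the rounding of the exponents
  obtain ⟨D, hD⟩ : ∃ D : ℝ, T ^ D = 4 * c * T + 1 :=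
    ⟨Real.logb T (4 * c * T + 1), Real.rpow_logb hT0 hT.ne' (by positivity)⟩
  have hD0 : 0 ≤ D := by
    by_contra hneg
    have := Real.rpow_lt_one_of_one_lt_of_neg hT (not_le.1 hneg)
    rw [hD] at this
    nlinarith [mul_pos hc hT0]
  obtain ⟨h₀, hh⟩ := exists_index hb he hκ hC hCκ hε hμ hD0 N₀
  refine ⟨T ^ h₀, fun H hH1 hH => ?_⟩
  obtain ⟨h, rfl⟩ : ∃ h : ℝ, T ^ h = H :=
    ⟨Real.logb T H, Real.rpow_logb hT0 hT.ne' (by linarith)⟩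
  obtain ⟨N, hN, hM⟩ := hh h ((Real.rpow_le_rpow_left_iff hT).1 hH)
  refine ⟨N, hN, fun M h1 h2 => ?_⟩
  obtain ⟨hM1, hM2⟩ := hM M h1 h2
  have hle := expo_le hb hC2 M
  have hlt := lt_expo (b := b) (M + 1)
  have e1 : (T ^ h * T ^ expo b M) ^ κ = T ^ (κ * (h + expo b M)) := by
    rw [← Real.rpow_natCast, ← Real.rpow_add hT0, ← Real.rpow_mul hT0.le, mul_comm]
  have e2 : 2 / (T ^ h) ^ μ = 2 * T ^ (-(μ * h)) := by
    rw [← Real.rpow_mul hT0.le, Real.rpow_neg hT0.le, mul_comm h, div_eq_mul_inv]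
  have e3 : 1 / T ^ expo b (M + 1) = T ^ (-(expo b (M + 1) : ℝ)) := by
    rw [Real.rpow_neg hT0.le, Real.rpow_natCast, one_div]
  rw [e1, e2, e3]
  have hw : κ * (h + expo b M) ≤ κ * (h + growth b M) := by gcongr
  have k1 : T ^ (κ * (h + expo b M)) * T ^ (-(μ * h)) ≤ T ^ (-D) := by
    rw [← Real.rpow_add hT0]
    exact Real.rpow_le_rpow_of_exponent_le hT.le (by linarith)
  have k2 : T ^ (κ * (h + expo b M)) * T ^ (-(expo b (M + 1) : ℝ)) ≤ T ^ (-D) * T := by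
    rw [← Real.rpow_add hT0, ← Real.rpow_add_one hT0.ne']
    exact Real.rpow_le_rpow_of_exponent_le hT.le (by linarith)
  rw [Real.rpow_neg hT0.le D, hD] at k1 k2
  calc c * T ^ (κ * (h + expo b M)) * (2 * T ^ (-(μ * h)) + T ^ (-(expo b (M + 1) : ℝ)))
      = 2 * c * (T ^ (κ * (h + expo b M)) * T ^ (-(μ * h))) +
        c * (T ^ (κ * (h + expo b M)) * T ^ (-(expo b (M + 1) : ℝ))) := by ring
    _ ≤ 2 * c * (4 * c * T + 1)⁻¹ + c * ((4 * c * T + 1)⁻¹ * T) := by gcongr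
    _ = (2 * c + c * T) / (4 * c * T + 1) := by field_simp
    _ < 1 := by
      rw [div_lt_one (by positivity)]
      nlinarith

/-- An exponent larger than all the ratios `α_{N+e} / α_N` is not reached for large `N`. -/
theorem exists_forall_lt_of_large {b : ℕ → ℝ} {C μ ε c T : ℝ} {e : ℕ} (hb : ∀ i, 1 ≤ i → C ≤ b i)
    (hC : 2 ≤ C) (hε : 0 < ε) (hμ : ∀ N, growth b (N + e) + ε * growth b N ≤ μ * growth b N)
    (hT : 1 < T) (hc : 0 < c) :
    ∃ N₀, ∀ N ≥ N₀, 2 / (T ^ expo b N) ^ μ < c / T ^ expo b (N + e) := by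
  have hT0 : 0 < T := by linarith
  have hμ0 : 0 ≤ μ := by
    have h := hμ 0
    simp only [growth_zero, zero_add, mul_one] at h
    linarith [growth_pos hb hC e]
  obtain ⟨D, hD⟩ : ∃ D : ℝ, T ^ D = c / 2 :=
    ⟨Real.logb T (c / 2), Real.rpow_logb hT0 hT.ne' (by positivity)⟩
  obtain ⟨N₀, hN₀⟩ := exists_nat_gt ((μ - D) / ε)
  refine ⟨N₀, fun N hN => ?_⟩
  rw [pow_rpow_eq hT0, div_lt_div_iff₀ (by positivity) (by positivity), ← Real.rpow_natCast]
  have h1 := natCast_add_one_le_growth hb hC N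
  have h2 : (N₀ : ℝ) ≤ N := by exact_mod_cast hN
  rw [div_lt_iff₀ hε] at hN₀
  have h3 := expo_le hb hC (N + e)
  have h4 := lt_expo (b := b) N
  have h5 : T ^ (expo b (N + e) : ℝ) < T ^ (D + expo b N * μ) := by
    refine (Real.rpow_lt_rpow_left_iff hT).2 ?_
    nlinarith [hμ N]
  rw [Real.rpow_add hT0, hD] at h5
  linarith

/-- An exponent smaller than the ratio `α_{N+e} / α_N` is reached if `N` is large. -/
theorem exists_forall_le_of_large {b : ℕ → ℝ} {C μ ε c T : ℝ} {e : ℕ} (hb : ∀ i, 1 ≤ i → C ≤ b i)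
    (hC : 2 ≤ C) (hε : 0 < ε) (hμ0 : 0 ≤ μ) (hT : 1 < T) (hc : 0 < c) :
    ∃ N₀, ∀ N ≥ N₀, μ * growth b N + ε * growth b N ≤ growth b (N + e) →
      c * (T ^ expo b N) ^ μ ≤ T ^ expo b (N + e) := by
  have hT0 : 0 < T := by linarith
  obtain ⟨D, hD⟩ : ∃ D : ℝ, T ^ D = c := ⟨Real.logb T c, Real.rpow_logb hT0 hT.ne' hc⟩
  obtain ⟨N₀, hN₀⟩ := exists_nat_gt ((D + 1) / ε)
  refine ⟨N₀, fun N hN hμ => ?_⟩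
  rw [pow_rpow_eq hT0, ← Real.rpow_natCast T (expo b (N + e))]
  have h1 := natCast_add_one_le_growth hb hC N
  have h2 : (N₀ : ℝ) ≤ N := by exact_mod_cast hN
  rw [div_lt_iff₀ hε] at hN₀
  have h3 := expo_le hb hC N
  have h4 := lt_expo (b := b) (N + e)
  rw [← hD, ← Real.rpow_add hT0]
  refine Real.rpow_le_rpow_of_exponent_le hT.le ?_
  nlinarith

/-! ### The lacunary line and its best approximating subspaces -/

/-- The data defining the first spanning vector `(1, 0, …, 0, σ_0, …, σ_{n-d-1})`: a base `θ`,
multipliers `b` (growing the exponents) and digits `u`. -/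
structure LacunaryLine (n d : ℕ) where
  /-- the base -/
  θ : ℕ
  /-- the multipliers, whose products are the exponents before rounding -/
  b : ℕ → ℝ
  /-- the digits -/
  u : ℕ → ℕ
  one_le_d : 1 ≤ d
  d_lt : d < n
  prime : θ.Prime
  five_le : 5 ≤ θ
  digit : ∀ k, u k = 1 ∨ u k = 2
  two_le : ∀ i, 1 ≤ i → 2 ≤ b i

namespace LacunaryLine
variable {n d : ℕ} (S : LacunaryLine n d)

theorem one_lt_θ : (1 : ℝ) < S.θ := by exact_mod_cast (by have := S.five_le; omega : 1 < S.θ)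

theorem five_le_θ : (5 : ℝ) ≤ S.θ := by exact_mod_cast S.five_le

theorem θ_pos : (0 : ℝ) < S.θ := zero_lt_one.trans S.one_lt_θ

/-- The exponents `⌊α_k⌋`. -/
noncomputable def a (k : ℕ) : ℕ := expo S.b k

theorem a_strictMono : StrictMono S.a := expo_strictMono S.two_le le_rfl

/-- The `k`-th term of the lacunary series. -/
noncomputable def term (k : ℕ) : ℝ := (S.u k : ℝ) / (S.θ : ℝ) ^ S.a k

theorem term_pos (k : ℕ) : 0 < S.term k := by
  have : 0 < S.u k := by rcases S.digit k with h | h <;> omega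
  have := S.θ_pos
  unfold term
  positivity

theorem one_div_le_term (k : ℕ) : 1 / (S.θ : ℝ) ^ S.a k ≤ S.term k := by
  have h : (1 : ℝ) ≤ S.u k := by
    rcases S.digit k with h | h <;> rw [h] <;> norm_num
  have := S.θ_pos
  unfold term
  gcongr

theorem term_add_le (N k : ℕ) :
    S.term (k + N) ≤ 2 / (S.θ : ℝ) ^ S.a N * ((S.θ : ℝ)⁻¹) ^ k := by
  have h : (S.u (k + N) : ℝ) ≤ 2 := by
    rcases S.digit (k + N) with h | h <;> rw [h] <;> norm_num
  have h0 := S.θ_pos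
  have ha : S.a N + k ≤ S.a (k + N) := by rw [add_comm]; exact S.a_strictMono.add_le_nat k N
  have : (S.θ : ℝ) ^ (S.a N + k) ≤ (S.θ : ℝ) ^ S.a (k + N) :=
    pow_le_pow_right₀ S.one_lt_θ.le ha
  unfold term
  calc _ ≤ 2 / (S.θ : ℝ) ^ (S.a N + k) := by gcongr
    _ = _ := by rw [pow_add, inv_pow]; field_simp

theorem summable_geo : Summable fun k : ℕ => ((S.θ : ℝ)⁻¹) ^ k :=
  summable_geometric_of_lt_one (by have := S.θ_pos; positivity) (inv_lt_one_of_one_lt₀ S.one_lt_θ)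

theorem summable_term : Summable S.term :=
  Summable.of_nonneg_of_le (fun k => (S.term_pos k).le)
    (fun k => by simpa using S.term_add_le 0 k) (S.summable_geo.mul_left _)

/-- The terms with index congruent to `l` modulo `n - d`, extended by zero. -/
noncomputable def resTerm (l k : ℕ) : ℝ := if k % (n - d) = l then S.term k else 0

theorem resTerm_nonneg (l k : ℕ) : 0 ≤ S.resTerm l k := by
  unfold resTerm
  split_ifs
  · exact (S.term_pos k).le
  · exact le_rfl

theorem resTerm_le (l k : ℕ) : S.resTerm l k ≤ S.term k := by
  unfold resTerm
  split_ifs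
  · exact le_rfl
  · exact (S.term_pos k).le

theorem summable_resTerm (l : ℕ) : Summable (S.resTerm l) :=
  Summable.of_nonneg_of_le (S.resTerm_nonneg l) (S.resTerm_le l) S.summable_term

theorem lacunary_eq_tsum {l : ℕ} (hl : l < n - d) :
    lacunary S.θ (n - d) S.b S.u l = ∑' k, S.resTerm l k := by
  have hinj : Function.Injective fun k => (n - d) * k + l := fun a b hab => by
    have : (n - d) * a = (n - d) * b := by simpa using hab
    exact Nat.eq_of_mul_eq_mul_left (by omega) this
  rw [← hinj.tsum_eq (f := S.resTerm l)]
  · unfold lacunary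
    refine tsum_congr fun k => ?_
    unfold resTerm
    rw [if_pos (by rw [Nat.mul_add_mod, Nat.mod_eq_of_lt hl])]
    rfl
  · intro k hk
    have : k % (n - d) = l := by
      by_contra h
      exact hk (by unfold resTerm; rw [if_neg h])
    exact ⟨k / (n - d), by simp only; rw [← this]; exact Nat.div_add_mod k (n - d)⟩

/-- The truncation of the `l`-th lacunary series after the index `N`. -/
noncomputable def trunc (N l : ℕ) : ℚ :=
  ∑ k ∈ Finset.range (N + 1), if k % (n - d) = l then (S.u k : ℚ) / (S.θ : ℚ) ^ S.a k else 0

theorem trunc_cast (N l : ℕ) :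
    (S.trunc N l : ℝ) = ∑ k ∈ Finset.range (N + 1), S.resTerm l k := by
  unfold trunc resTerm term
  push_cast
  exact Finset.sum_congr rfl fun k _ => by split_ifs <;> simp

theorem lacunary_sub_trunc {l : ℕ} (hl : l < n - d) (N : ℕ) :
    lacunary S.θ (n - d) S.b S.u l - (S.trunc N l : ℝ) =
      ∑' k, S.resTerm l (k + (N + 1)) := by
  rw [S.lacunary_eq_tsum hl, trunc_cast, ← (S.summable_resTerm l).sum_add_tsum_nat_add (N + 1),
    add_sub_cancel_left]

theorem lacunary_sub_trunc_le {l : ℕ} (hl : l < n - d) (N : ℕ) :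
    lacunary S.θ (n - d) S.b S.u l - (S.trunc N l : ℝ) ≤ 3 / (S.θ : ℝ) ^ S.a (N + 1) := by
  rw [S.lacunary_sub_trunc hl]
  have h5 := S.five_le_θ
  have h0 := S.θ_pos
  calc _ ≤ ∑' k : ℕ, 2 / (S.θ : ℝ) ^ S.a (N + 1) * ((S.θ : ℝ)⁻¹) ^ k :=
        Summable.tsum_le_tsum (fun k => (S.resTerm_le l _).trans (S.term_add_le (N + 1) k))
          ((summable_nat_add_iff (N + 1)).2 (S.summable_resTerm l)) (S.summable_geo.mul_left _)
    _ = 2 / (S.θ : ℝ) ^ S.a (N + 1) * (1 - (S.θ : ℝ)⁻¹)⁻¹ := by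
        rw [tsum_mul_left, tsum_geometric_of_lt_one (by positivity)
          (inv_lt_one_of_one_lt₀ S.one_lt_θ)]
    _ ≤ 2 / (S.θ : ℝ) ^ S.a (N + 1) * (3 / 2) := by
        gcongr
        have : (S.θ : ℝ)⁻¹ ≤ 1 / 5 := by
          rw [inv_eq_one_div]; exact one_div_le_one_div_of_le (by norm_num) h5
        rw [inv_le_comm₀ (by linarith) (by norm_num)]
        linarith
    _ = _ := by ring

theorem term_le_lacunary_sub_trunc {N k : ℕ} (hk : N < k) :
    S.term k ≤ lacunary S.θ (n - d) S.b S.u (k % (n - d)) - (S.trunc N (k % (n - d)) : ℝ) := by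
  have hm : 0 < n - d := by have := S.d_lt; omega
  rw [S.lacunary_sub_trunc (Nat.mod_lt _ hm)]
  have hs := (summable_nat_add_iff (N + 1)).2 (S.summable_resTerm (k % (n - d)))
  refine le_trans (le_of_eq ?_) (hs.le_tsum (k - (N + 1)) fun _ _ => S.resTerm_nonneg _ _)
  rw [show k - (N + 1) + (N + 1) = k by omega]
  unfold resTerm
  rw [if_pos rfl]

theorem lacunary_sub_trunc_nonneg {l : ℕ} (hl : l < n - d) (N : ℕ) :
    0 ≤ lacunary S.θ (n - d) S.b S.u l - (S.trunc N l : ℝ) := by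
  rw [S.lacunary_sub_trunc hl]
  exact tsum_nonneg fun _ => S.resTerm_nonneg _ _

/-- The vector `(1, 0, …, 0, σ_0, …, σ_{n-d-1})`. -/
noncomputable def y : E n := WithLp.toLp 2 fun i : Fin n =>
  if (i : ℕ) = 0 then 1 else if (i : ℕ) < d then 0 else lacunary S.θ (n - d) S.b S.u (i - d)

/-- The truncation of `y` after the index `N`. -/
noncomputable def x (N : ℕ) : Fin n → ℚ := fun i =>
  if (i : ℕ) = 0 then 1 else if (i : ℕ) < d then 0 else S.trunc N (i - d)

/-- The integer vector `θ ^ a_N x_N`. -/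
noncomputable def X (N : ℕ) : Fin n → ℤ := fun i =>
  if (i : ℕ) = 0 then (S.θ : ℤ) ^ S.a N else if (i : ℕ) < d then 0 else
    ∑ k ∈ Finset.range (N + 1),
      if k % (n - d) = i - d then (S.u k : ℤ) * (S.θ : ℤ) ^ (S.a N - S.a k) else 0

/-- The coordinate of `y` in which the `k`-th term of the series appears. -/
def idx (k : ℕ) : Fin n := ⟨d + k % (n - d), by
  have := S.d_lt
  have := Nat.mod_lt k (show 0 < n - d by omega)
  omega⟩

theorem idx_ne_zero (k : ℕ) : ((S.idx k : Fin n) : ℕ) ≠ 0 := by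
  have := S.one_le_d
  simp only [idx]
  omega

theorem idx_not_lt (k : ℕ) : ¬ ((S.idx k : Fin n) : ℕ) < d := by simp [idx]

theorem idx_sub (k : ℕ) : ((S.idx k : Fin n) : ℕ) - d = k % (n - d) := by simp [idx]

theorem X_eq (N : ℕ) (i : Fin n) : (S.X N i : ℚ) = (S.θ : ℚ) ^ S.a N * S.x N i := by
  unfold X x trunc
  split_ifs
  · simp
  · simp
  · rw [Finset.mul_sum]
    push_cast
    refine Finset.sum_congr rfl fun k hk => ?_
    split_ifs
    · have hθ : (S.θ : ℚ) ≠ 0 := by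
        have := S.five_le
        exact_mod_cast (by omega : S.θ ≠ 0)
      have hle : S.a k ≤ S.a N :=
        S.a_strictMono.monotone (by have := Finset.mem_range.1 hk; omega)
      rw [pow_sub₀ _ hθ hle]
      field_simp
    · simp

theorem ratVec_X (N : ℕ) : ratVec (fun i => (S.X N i : ℚ)) =
    ((S.θ : ℝ) ^ S.a N) • ratVec (S.x N) := by
  ext i
  simp only [ratVec, X_eq, PiLp.smul_apply, smul_eq_mul]
  push_cast
  rfl

theorem ratVec_X_mem_iff (N : ℕ) (B : Submodule ℝ (E n)) :
    ratVec (fun i => (S.X N i : ℚ)) ∈ B ↔ ratVec (S.x N) ∈ B := by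
  rw [ratVec_X]
  exact B.smul_mem_iff (pow_ne_zero _ S.θ_pos.ne')

theorem x_succ (N : ℕ) : ratVec (S.x (N + 1)) =
    ratVec (S.x N) + S.term (N + 1) • EuclideanSpace.single (S.idx (N + 1)) (1 : ℝ) := by
  have hd := S.one_le_d
  have hn := S.d_lt
  ext i
  simp only [ratVec, PiLp.add_apply, PiLp.smul_apply, smul_eq_mul, PiLp.single_apply]
  by_cases h0 : (i : ℕ) = 0
  · have : i ≠ S.idx (N + 1) := fun h => S.idx_ne_zero (N + 1) (h ▸ h0)
    simp [x, h0, this]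
  by_cases h1 : (i : ℕ) < d
  · have : i ≠ S.idx (N + 1) := fun h => by
      have := congrArg Fin.val h
      simp only [idx] at this
      omega
    simp [x, h0, h1, this]
  have hi : i = S.idx (N + 1) ↔ (N + 1) % (n - d) = i - d := by
    rw [Fin.ext_iff]
    simp only [idx]
    omega
  simp only [x, h0, h1, if_false, hi]
  rw [trunc_cast, trunc_cast, Finset.sum_range_succ _ (N + 1)]
  congr 1
  unfold resTerm
  split_ifs <;> simp

theorem ratVec_intCast_single (i : Fin n) :
    ratVec (fun j => ((Pi.single i 1 : Fin n → ℤ) j : ℚ)) = EuclideanSpace.single i (1 : ℝ) := by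
  rw [← ratVec_single]
  congr 1
  ext j
  simp [Pi.single_apply]

theorem y_apply_zero {i : Fin n} (hi : (i : ℕ) = 0) : S.y i = 1 := by simp [y, hi]

theorem x_apply_zero (N : ℕ) {i : Fin n} (hi : (i : ℕ) = 0) : S.x N i = 1 := by simp [x, hi]

theorem x_apply_idx (N k : ℕ) : S.x N (S.idx k) = S.trunc N (k % (n - d)) := by
  simp only [x, if_neg (S.idx_ne_zero k), if_neg (S.idx_not_lt k), S.idx_sub k]

theorem y_apply_idx (k : ℕ) :
    S.y (S.idx k) = lacunary S.θ (n - d) S.b S.u (k % (n - d)) := by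
  simp only [y, if_neg (S.idx_ne_zero k), if_neg (S.idx_not_lt k), S.idx_sub k]

theorem norm_y_pos : 0 < ‖S.y‖ := by
  rw [norm_pos_iff]
  intro h
  have := S.y_apply_zero (i := ⟨0, by have := S.d_lt; omega⟩) rfl
  rw [h] at this
  simp at this

theorem norm_le_of_coord_le {c : ℝ} {v : E n} (hc : 0 ≤ c) (h : ∀ i, |v i| ≤ c) :
    ‖v‖ ≤ √n * c := by
  rw [EuclideanSpace.norm_eq]
  refine Real.sqrt_le_iff.2 ⟨by positivity, ?_⟩
  calc ∑ i, ‖v i‖ ^ 2 ≤ ∑ _i : Fin n, c ^ 2 :=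
        Finset.sum_le_sum fun i _ => pow_le_pow_left₀ (norm_nonneg _) (h i) 2
    _ = _ := by
        rw [mul_pow, Real.sq_sqrt (Nat.cast_nonneg n)]; simp

theorem norm_y_sub_x_le (N : ℕ) :
    ‖S.y - ratVec (S.x N)‖ ≤ (√n * 3) / (S.θ : ℝ) ^ S.a (N + 1) := by
  have h0 := S.θ_pos
  rw [mul_div_assoc]
  refine norm_le_of_coord_le (by positivity) fun i => ?_
  simp only [PiLp.sub_apply, y, ratVec, x]
  split_ifs with h1 h2
  · simp; positivity
  · simp; positivity
  · have hl : (i : ℕ) - d < n - d := by have := i.2; omega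
    rw [abs_of_nonneg (S.lacunary_sub_trunc_nonneg hl N)]
    exact S.lacunary_sub_trunc_le hl N

theorem exists_norm_x_le : ∃ c : ℝ, 0 < c ∧ ∀ N, ‖ratVec (S.x N)‖ ≤ c := by
  refine ⟨‖S.y‖ + √n * 3, by have := S.norm_y_pos; positivity, fun N => ?_⟩
  have h1 := S.norm_y_sub_x_le N
  have h2 : (√n * 3) / (S.θ : ℝ) ^ S.a (N + 1) ≤ √n * 3 :=
    div_le_self (by positivity) (one_le_pow₀ S.one_lt_θ.le)
  have h3 := norm_sub_le S.y (S.y - ratVec (S.x N))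
  rw [sub_sub_cancel] at h3
  linarith

/-- An integer basis of the best approximating subspaces: the vector `X_N` and the coordinate
vectors `e_{idx (N+1)}, …, e_{idx (N+e-1)}`. -/
noncomputable def basisInt (N e : ℕ) : Fin e → Fin n → ℤ := fun j =>
  if (j : ℕ) = 0 then S.X N else Pi.single (S.idx (N + j)) 1

/-- The span of `basisInt`. Consecutive truncations differ by multiples of coordinate vectors, so
this is also the span of `X_N, …, X_{N+e-1}`. -/
noncomputable def space (N e : ℕ) : Submodule ℝ (E n) :=
  Submodule.span ℝ (Set.range fun j => ratVec fun i => (S.basisInt N e j i : ℚ))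

theorem idx_add_inj {N i j : ℕ} (hi : i < n - d) (hj : j < n - d)
    (h : S.idx (N + i) = S.idx (N + j)) : i = j := by
  have h1 := congrArg Fin.val h
  simp only [idx] at h1
  have h2 : N + i ≡ N + j [MOD (n - d)] := by unfold Nat.ModEq; omega
  exact (Nat.ModEq.add_left_cancel' N h2).eq_of_lt_of_lt hi hj

/-- On rows containing `idx (N+1), …, idx (N+e-1)` and one more row `r`, the minor of the basis is
the coordinate of `X_N` on the row `r`. -/
theorem exists_abs_minor {N e : ℕ} (he : 1 ≤ e) (hem : e ≤ n - d) (r : Fin n)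
    (hr : ∀ j, 1 ≤ j → j < e → r ≠ S.idx (N + j)) :
    ∃ I, |minor (S.basisInt N e) I| = |S.X N r| := by
  let f : Fin e → Fin n := fun j => if (j : ℕ) = 0 then r else S.idx (N + j)
  have hf : Function.Injective f := by
    intro i j hij
    simp only [f] at hij
    split_ifs at hij with h1 h2 h2
    · exact Fin.ext (h1.trans h2.symm)
    · exact absurd hij (hr j (by omega) j.2)
    · exact absurd hij.symm (hr i (by omega) i.2)
    · exact Fin.ext (S.idx_add_inj (by omega) (by omega) hij)
  refine ⟨⟨Finset.univ.image f, by rw [Finset.card_image_of_injective _ hf]; simp⟩, ?_⟩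
  rw [← abs_det_eq_abs_minor _ f hf _ (by simp)]
  congr 1
  have hent : ∀ a b : Fin e, (b : ℕ) ≠ 0 →
      S.basisInt N e b (f a) = if a = b then 1 else 0 := by
    intro a b hb
    have hfb : f b = S.idx (N + b) := by simp [f, hb]
    simp only [basisInt, hb, if_false, ← hfb, Pi.single_apply, hf.eq_iff]
  rw [Matrix.det_of_isLowerTriangular]
  · rw [Finset.prod_eq_single (⟨0, by omega⟩ : Fin e)]
    · simp [basisInt, f]
    · intro j _ hj
      rw [Matrix.of_apply, hent j j (fun h => hj (Fin.ext h)), if_pos rfl]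
    · simp
  · intro i j hij
    have hij' : i < j := hij
    have : (j : ℕ) ≠ 0 := by have : (i : ℕ) < j := hij'; omega
    rw [Matrix.of_apply, hent i j this, if_neg hij'.ne]

theorem X_apply_zero (N : ℕ) {i : Fin n} (hi : (i : ℕ) = 0) : S.X N i = (S.θ : ℤ) ^ S.a N := by
  simp [X, hi]

theorem exists_abs_minor_eq_pow {N e : ℕ} (he : 1 ≤ e) (hem : e ≤ n - d) :
    ∃ I, |minor (S.basisInt N e) I| = (S.θ : ℤ) ^ S.a N := by
  obtain ⟨I, hI⟩ := S.exists_abs_minor (N := N) he hem ⟨0, by have := S.d_lt; omega⟩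
    fun j _ _ h => S.idx_ne_zero (N + j) (by rw [← h])
  refine ⟨I, hI.trans ?_⟩
  rw [X_apply_zero _ _ rfl, abs_of_nonneg (by positivity)]

theorem isCoprime_X_idx (N : ℕ) : IsCoprime ((S.θ : ℤ) ^ S.a N) (S.X N (S.idx N)) := by
  apply IsCoprime.pow_left
  have hp : Prime (S.θ : ℤ) := Nat.prime_iff_prime_int.1 S.prime
  rw [hp.irreducible.coprime_iff_not_dvd]
  intro hdvd
  simp only [X, if_neg (S.idx_ne_zero N), if_neg (S.idx_not_lt N), S.idx_sub N] at hdvd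
  rw [Finset.sum_range_succ, if_pos rfl, Nat.sub_self, pow_zero, mul_one] at hdvd
  -- all the terms but the last are divisible by `θ`
  have h1 : (S.θ : ℤ) ∣ ∑ k ∈ Finset.range N,
      if k % (n - d) = N % (n - d) then (S.u k : ℤ) * (S.θ : ℤ) ^ (S.a N - S.a k) else 0 := by
    refine Finset.dvd_sum fun k hk => ?_
    split_ifs
    · have : S.a k < S.a N := S.a_strictMono (Finset.mem_range.1 hk)
      exact Dvd.dvd.mul_left (dvd_pow_self _ (by omega)) _
    · exact dvd_zero _
  have h2 := (dvd_add_right h1).1 hdvd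
  have h3 : S.θ ∣ S.u N := by exact_mod_cast h2
  have := S.five_le
  rcases S.digit N with h | h <;> rw [h] at h3
  · have := Nat.le_of_dvd (by norm_num) h3; omega
  · have := Nat.le_of_dvd (by norm_num) h3; omega

theorem isRatBasis_space {N e : ℕ} (he : 1 ≤ e) (hem : e ≤ n - d) :
    IsRatBasis (fun j i => (S.basisInt N e j i : ℚ)) (S.space N e) := by
  refine ⟨?_, rfl⟩
  rw [← linearIndependent_ofLp_iff, linearIndependent_iff_exists_minor]
  obtain ⟨I, hI⟩ := S.exists_abs_minor_eq_pow (N := N) he hem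
  refine ⟨I, ?_⟩
  rw [minor_ratVec]
  have hg : grassmannCoord (fun j i => (S.basisInt N e j i : ℚ)) I =
      ((minor (S.basisInt N e) I : ℤ) : ℚ) := ((Int.castRingHom ℚ).map_det _).symm
  rw [hg]
  have hθ : (S.θ : ℤ) ≠ 0 := by exact_mod_cast S.prime.ne_zero
  have : minor (S.basisInt N e) I ≠ 0 := by
    rw [← abs_ne_zero, hI]
    exact pow_ne_zero _ hθ
  exact_mod_cast this

theorem space_mem {N e : ℕ} (he : 1 ≤ e) (hem : e ≤ n - d) : S.space N e ∈ ratSubspaces n e :=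
  ⟨_, S.isRatBasis_space he hem⟩

theorem pow_le_height_space {N e : ℕ} (he : 1 ≤ e) (hem : e ≤ n - d) :
    (S.θ : ℝ) ^ S.a N ≤ height (S.space N e) := by
  obtain ⟨I, hI⟩ := S.exists_abs_minor_eq_pow (N := N) he hem
  obtain ⟨J, hJ⟩ := S.exists_abs_minor (N := N) he hem (S.idx N) fun j h1 h2 h => by
    have := S.idx_add_inj (N := N) (i := 0) (j := j) (by omega) (by omega) (by simpa using h)
    omega
  have hco : IsCoprime (minor (S.basisInt N e) I) (minor (S.basisInt N e) J) := by
    have := S.isCoprime_X_idx N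
    rwa [← hI, ← IsCoprime.abs_abs_iff, abs_abs, ← hJ, IsCoprime.abs_abs_iff] at this
  have := le_height_of_isCoprime (S.isRatBasis_space (N := N) he hem)
    ((Int.castRingHom ℚ).map_det _).symm ((Int.castRingHom ℚ).map_det _).symm hco
  refine le_trans (le_of_eq ?_) this
  have h2 : ((|minor (S.basisInt N e) I| : ℤ) : ℝ) = ((S.θ : ℤ) ^ S.a N : ℤ) := by rw [hI]
  push_cast at h2
  exact h2.symm

theorem exists_height_space_le {e : ℕ} (he : 1 ≤ e) (hem : e ≤ n - d) :
    ∃ c : ℝ, 0 < c ∧ ∀ N, height (S.space N e) ≤ c * (S.θ : ℝ) ^ S.a N := by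
  obtain ⟨c, hc, hx⟩ := S.exists_norm_x_le
  set K : ℝ := Nat.factorial e * (c + 1) ^ e with hK
  refine ⟨√(Fintype.card {I : Finset (Fin n) // I.card = e} : ℝ) * K + 1, by positivity,
    fun N => ?_⟩
  have h0 := S.θ_pos
  refine (height_le_of_int (S.isRatBasis_space (N := N) he hem)).trans ?_
  -- factor `θ ^ a_N` out of the first column; the remaining matrix has bounded entries
  have hb : ∀ I, |((minor (S.basisInt N e) I : ℤ) : ℝ)| ≤ K * (S.θ : ℝ) ^ S.a N := by
    intro I
    let D : Fin e → ℝ := fun j => if (j : ℕ) = 0 then (S.θ : ℝ) ^ S.a N else 1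
    let M : Matrix (Fin e) (Fin e) ℝ := Matrix.of fun i j =>
      if (j : ℕ) = 0 then (S.x N (I.1.orderEmbOfFin I.2 i) : ℝ)
      else (Pi.single (S.idx (N + j)) 1 : Fin n → ℝ) (I.1.orderEmbOfFin I.2 i)
    have h1 : ((minor (S.basisInt N e) I : ℤ) : ℝ) =
        Matrix.det (Matrix.of fun i j => D j * M i j) := by
      unfold minor
      have h := (Int.castRingHom ℝ).map_det
        (Matrix.of fun i j : Fin e => S.basisInt N e j (I.1.orderEmbOfFin I.2 i))
      refine (show _ = _ from h).trans ?_
      congr 1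
      ext i j
      simp only [RingHom.mapMatrix_apply, Matrix.map_apply, Matrix.of_apply, D, M, basisInt,
        Int.coe_castRingHom]
      split_ifs
      · have := S.X_eq N (I.1.orderEmbOfFin I.2 i)
        exact_mod_cast this
      · simp [Pi.single_apply]
    have hMb : ∀ i j, |M i j| ≤ c + 1 := by
      intro i j
      simp only [M, Matrix.of_apply]
      split_ifs
      · have := norm_coord_le (ratVec (S.x N)) (I.1.orderEmbOfFin I.2 i)
        refine this.trans ((hx N).trans (by linarith))
      · rw [Pi.single_apply]
        split_ifs
        · rw [abs_one]; linarith
        · rw [abs_zero]; linarith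
    have hM := Matrix.det_le (abv := AbsoluteValue.abs) (A := M) (x := c + 1) hMb
    have hDp : ∏ j, D j = (S.θ : ℝ) ^ S.a N := by
      rw [Finset.prod_eq_single (⟨0, by omega⟩ : Fin e)]
      · simp [D]
      · intro j _ hj
        simp only [D]
        rw [if_neg fun h => hj (Fin.ext h)]
      · simp
    rw [h1, Matrix.det_mul_row, hDp, abs_mul, abs_of_pos (by positivity), mul_comm]
    gcongr
    simpa [hK, nsmul_eq_mul] using hM
  refine Real.sqrt_le_iff.2 ⟨by positivity, ?_⟩
  set q := √(Fintype.card {I : Finset (Fin n) // I.card = e} : ℝ) with hq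
  calc _ ≤ ∑ _I : {I : Finset (Fin n) // I.card = e}, (K * (S.θ : ℝ) ^ S.a N) ^ 2 :=
        Finset.sum_le_sum fun I _ => by
          rw [← sq_abs]; exact pow_le_pow_left₀ (abs_nonneg _) (hb I) 2
    _ = (q * K * (S.θ : ℝ) ^ S.a N) ^ 2 := by
        rw [Finset.sum_const, nsmul_eq_mul, mul_assoc q, mul_pow q, hq,
          Real.sq_sqrt (Nat.cast_nonneg _)]
        simp
    _ ≤ _ := by
        gcongr
        linarith

theorem x_mem_space_zero {N e : ℕ} (he : 1 ≤ e) : ratVec (S.x N) ∈ S.space N e := by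
  rw [← ratVec_X_mem_iff]
  exact Submodule.subset_span ⟨⟨0, by omega⟩, by simp [basisInt]⟩

theorem single_mem_space {N e j : ℕ} (hj : 1 ≤ j) (hje : j < e) :
    EuclideanSpace.single (S.idx (N + j)) (1 : ℝ) ∈ S.space N e := by
  rw [← ratVec_intCast_single]
  refine Submodule.subset_span ⟨⟨j, hje⟩, ?_⟩
  simp [basisInt, show j ≠ 0 by omega]

theorem x_mem_space {N e j : ℕ} (hje : j < e) : ratVec (S.x (N + j)) ∈ S.space N e := by
  induction j with
  | zero => exact S.x_mem_space_zero (by omega)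
  | succ j ih =>
    rw [← add_assoc, x_succ]
    exact Submodule.add_mem _ (ih (by omega))
      (Submodule.smul_mem _ _ (S.single_mem_space (N := N) (j := j + 1) (by omega) hje))

/-- A subspace of dimension `e` containing `X_N, …, X_{N+e-1}` is spanned by them. -/
theorem eq_space {N e : ℕ} (he : 1 ≤ e) (hem : e ≤ n - d) {B : Submodule ℝ (E n)}
    (hB : B ∈ ratSubspaces n e) (h : ∀ M, N ≤ M → M < N + e → ratVec (S.x M) ∈ B) :
    B = S.space N e := by
  symm
  refine Submodule.eq_of_le_of_finrank_eq ?_ ?_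
  · refine Submodule.span_le.2 ?_
    rintro _ ⟨j, rfl⟩
    by_cases hj : (j : ℕ) = 0
    · simp only [basisInt, hj, if_true, SetLike.mem_coe, ratVec_X_mem_iff]
      exact h N le_rfl (by omega)
    · simp only [basisInt, hj, if_false, SetLike.mem_coe, ratVec_intCast_single]
      obtain ⟨i, hi⟩ : ∃ i, (j : ℕ) = i + 1 := ⟨j - 1, by omega⟩
      have hj2 := j.2
      have h1 := B.sub_mem (h (N + i + 1) (by omega) (by omega)) (h (N + i) (by omega) (by omega))
      rw [x_succ, add_sub_cancel_left] at h1
      rw [hi, ← add_assoc]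
      exact (B.smul_mem_iff (S.term_pos _).ne').1 h1
  · rw [finrank_of_mem_ratSubspaces hB, finrank_of_mem_ratSubspaces (S.space_mem he hem)]

/-- The approximation of `y` by the subspace spanned by `X_N, …, X_{N+e-1}` is not better than
`θ ^ (-a_{N+e})`, up to a constant. -/
theorem exists_le_norm_y_sub {e : ℕ} (hem : e ≤ n - d) :
    ∃ c : ℝ, 0 < c ∧ ∀ N, ∀ z ∈ S.space N e, c / (S.θ : ℝ) ^ S.a (N + e) ≤ ‖S.y - z‖ := by
  obtain ⟨c, hc, hx⟩ := S.exists_norm_x_le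
  refine ⟨(1 + c)⁻¹, by positivity, fun N z hz => ?_⟩
  have hd := S.one_le_d
  have hn := S.d_lt
  have h0 := S.θ_pos
  set i₀ : Fin n := ⟨0, by omega⟩ with hi₀
  set i₁ : Fin n := S.idx (N + e) with hi₁
  by_cases he : e = 0
  · subst he
    have hz0 : z = 0 := by
      have : S.space N 0 = ⊥ := by
        unfold space
        rw [Set.range_eq_empty, Submodule.span_empty]
      rwa [this, Submodule.mem_bot] at hz
    have h1 := norm_coord_le S.y i₀
    rw [y_apply_zero _ rfl, abs_one] at h1
    rw [hz0, sub_zero]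
    refine le_trans ?_ h1
    exact (div_le_self (by positivity) (one_le_pow₀ S.one_lt_θ.le)).trans
      (inv_le_one_of_one_le₀ (by linarith))
  -- in the subspace, the coordinate `i₁` is proportional to the coordinate `0`
  have hprop : z i₁ = z i₀ * S.x N i₁ := by
    have hle : S.space N e ≤ LinearMap.ker
        ((PiLp.projₗ 2 (fun _ : Fin n => ℝ) i₁ : E n →ₗ[ℝ] ℝ) -
          (S.x N i₁ : ℝ) • (PiLp.projₗ 2 (fun _ : Fin n => ℝ) i₀ : E n →ₗ[ℝ] ℝ)) := by
      refine Submodule.span_le.2 ?_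
      rintro _ ⟨j, rfl⟩
      rw [SetLike.mem_coe, LinearMap.mem_ker]
      by_cases hj : (j : ℕ) = 0
      · simp only [basisInt, hj, if_true, ratVec_X]
        simp [PiLp.projₗ_apply, ratVec, S.x_apply_zero N (i := i₀) rfl]
      · simp only [basisInt, hj, if_false, ratVec_intCast_single]
        have h1 : i₁ ≠ S.idx (N + j) := fun h => by
          have hj2 := j.2
          have h1 := congrArg Fin.val h
          simp only [hi₁, idx] at h1
          have h2 : N + e ≡ N + j [MOD (n - d)] := by unfold Nat.ModEq; omega
          have h3 := Nat.ModEq.add_left_cancel' N h2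
          have h4 := (Nat.modEq_iff_dvd' hj2.le).1 h3.symm
          have := Nat.le_of_dvd (by omega) h4
          omega
        have h2 : i₀ ≠ S.idx (N + j) := fun h => S.idx_ne_zero (N + j) (by rw [← h])
        simp [PiLp.projₗ_apply, h1, h2]
    have := hle hz
    rw [LinearMap.mem_ker] at this
    simp [PiLp.projₗ_apply] at this
    linarith
  have h1 := norm_coord_le (S.y - z) i₀
  have h2 := norm_coord_le (S.y - z) i₁
  have h3 := (norm_coord_le (ratVec (S.x N)) i₁).trans (hx N)
  have h4 := S.term_le_lacunary_sub_trunc (N := N) (k := N + e) (by omega)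
  rw [← y_apply_idx, ← x_apply_idx, ← hi₁] at h4
  have h5 := S.one_div_le_term (N + e)
  simp only [PiLp.sub_apply] at h1 h2
  rw [y_apply_zero _ rfl] at h1
  change |(S.x N i₁ : ℝ)| ≤ c at h3
  have h6 : S.y i₁ - S.x N i₁ = (S.y i₁ - z i₁) - (1 - z i₀) * S.x N i₁ := by rw [hprop]; ring
  have h7 : S.y i₁ - S.x N i₁ ≤ ‖S.y - z‖ + ‖S.y - z‖ * c := by
    rw [h6]
    refine (le_abs_self _).trans ((abs_sub _ _).trans ?_)
    rw [abs_mul]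
    gcongr
  rw [div_eq_mul_one_div, inv_mul_le_iff₀ (by positivity)]
  linarith

/-- The coordinate subspace of the vectors whose coordinates `1, …, d - 1` vanish. -/
def coordSpace (n d : ℕ) : Submodule ℝ (E n) where
  carrier := {v | ∀ i : Fin n, 1 ≤ (i : ℕ) → (i : ℕ) < d → v i = 0}
  add_mem' := fun hv hw i h1 h2 => by simp [hv i h1 h2, hw i h1 h2]
  zero_mem' := fun i _ _ => by simp
  smul_mem' := fun c v hv i h1 h2 => by simp [hv i h1 h2]

theorem coordSpace_mem (hd : 1 ≤ d) (hn : d < n) : coordSpace n d ∈ ratSubspaces n (n - d + 1) := by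
  let f : Fin (n - d + 1) → Fin n := fun j =>
    if (j : ℕ) = 0 then ⟨0, by omega⟩ else ⟨d + j - 1, by omega⟩
  have hf : Function.Injective f := by
    intro i j h
    simp only [f] at h
    ext
    split_ifs at h <;> simp only [Fin.mk.injEq] at h <;> omega
  have hs : (fun j => ratVec ((Pi.single (f j) 1 : Fin n → ℚ))) =
      fun j => (EuclideanSpace.basisFun (Fin n) ℝ).toBasis (f j) := by
    funext j
    rw [ratVec_single, OrthonormalBasis.coe_toBasis, EuclideanSpace.basisFun_apply]
  refine ⟨fun j => Pi.single (f j) 1, ?_, ?_⟩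
  · rw [hs]
    exact (Basis.linearIndependent _).comp f hf
  · rw [hs]
    apply le_antisymm
    · refine Submodule.span_le.2 ?_
      rintro _ ⟨j, rfl⟩ i h1 h2
      have hne : i ≠ f j := by
        rintro rfl
        simp only [f] at h1 h2
        split_ifs at h1 h2 <;> simp only at h1 h2 <;> omega
      simp [hne]
    · intro v hv
      rw [← (EuclideanSpace.basisFun (Fin n) ℝ).toBasis.sum_repr v]
      refine Submodule.sum_mem _ fun i _ => ?_
      by_cases h : 1 ≤ (i : ℕ) ∧ (i : ℕ) < d
      · have := hv i h.1 h.2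
        simp [this]
      · refine Submodule.smul_mem _ _ (Submodule.subset_span ?_)
        by_cases h0 : (i : ℕ) = 0
        · exact ⟨⟨0, by omega⟩, by simp only; congr 1; ext; simp [f, h0]⟩
        · refine ⟨⟨i - d + 1, by omega⟩, ?_⟩
          simp only
          congr 1
          ext
          simp only [f, Nat.add_eq_zero_iff, one_ne_zero, and_false, if_false]
          omega

theorem y_mem_coordSpace : S.y ∈ coordSpace n d := fun i h1 h2 => by
  simp [y, h2, show (i : ℕ) ≠ 0 by omega]

theorem space_le_coordSpace (N e : ℕ) : S.space N e ≤ coordSpace n d := by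
  refine Submodule.span_le.2 ?_
  rintro _ ⟨j, rfl⟩ i h1 h2
  by_cases hj : (j : ℕ) = 0
  · simp [basisInt, hj, ratVec, X, h2, show (i : ℕ) ≠ 0 by omega]
  · simp only [basisInt, hj, if_false, ratVec_intCast_single]
    have : i ≠ S.idx (N + j) := fun h => by
      have := congrArg Fin.val h
      simp only [idx] at this
      omega
    simp [this]

end LacunaryLine

/-! ### Adding a lacunary line to a badly approximable subspace -/

namespace LacunaryLine
variable {n d : ℕ} (S : LacunaryLine n d)

/-- Since `A'` meets the coordinate space containing `y` trivially, the components on `A'` and on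
`y` are controlled by the norm of the sum. -/
theorem exists_component_le {A' : Submodule ℝ (E n)} {K : ℝ}
    (hA' : BadlyApprox A' (n - d + 1) K) :
    ∃ c : ℝ, 0 < c ∧ (∀ Y ∈ A', ∀ V ∈ coordSpace n d, ‖Y‖ ≤ c * ‖Y - V‖) ∧
      ∀ Y ∈ A', ∀ t : ℝ, |t| ≤ c * ‖Y + t • S.y‖ := by
  obtain ⟨c, hc, h⟩ := hA'
  have hV := coordSpace_mem S.one_le_d S.d_lt
  have hH : 0 < height (coordSpace n d) ^ K := Real.rpow_pos_of_pos (height_pos hV) _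
  have hy := S.norm_y_pos
  set q := height (coordSpace n d) ^ K / c with hq
  have hq0 : 0 < q := by positivity
  have h1 : ∀ Y ∈ A', ∀ V ∈ coordSpace n d, ‖Y‖ ≤ q * ‖Y - V‖ := fun Y hY V hV' => by
    rw [hq, div_mul_eq_mul_div, le_div_iff₀ hc, mul_comm]
    exact h _ hV Y hY V hV'
  refine ⟨q + (1 + q) / ‖S.y‖, by positivity, fun Y hY V hV' => (h1 Y hY V hV').trans ?_,
    fun Y hY t => ?_⟩
  · gcongr
    have : 0 < (1 + q) / ‖S.y‖ := by positivity
    linarith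
  · have h2 := h1 Y hY (-(t • S.y)) (Submodule.neg_mem _ (Submodule.smul_mem _ _
      S.y_mem_coordSpace))
    rw [sub_neg_eq_add] at h2
    have h3 : ‖t • S.y‖ ≤ ‖Y + t • S.y‖ + ‖Y‖ := by
      have := norm_sub_le (Y + t • S.y) Y
      rwa [add_sub_cancel_left] at this
    rw [norm_smul, Real.norm_eq_abs] at h3
    have h4 : |t| ≤ (1 + q) / ‖S.y‖ * ‖Y + t • S.y‖ := by
      rw [div_mul_eq_mul_div, le_div_iff₀ hy]
      linarith
    have h5 : 0 ≤ q * ‖Y + t • S.y‖ := by positivity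
    linarith

/-- If the truncation `x_N` does not lie in `B`, then `B` cannot approximate `A' + ℝ y` too well:
apply the hypothesis on `A'` to the space `B + ℝ x_N`, which is close to `B + ℝ y`, to see that a
vector of `A' + ℝ y` close to `B` is almost proportional to `y`; then `x_N` itself is too close to
`B` with respect to its denominator. -/
theorem exists_one_le_of_not_mem {A' : Submodule ℝ (E n)} {K : ℝ} {e : ℕ} (hK : 0 ≤ K)
    (hA : BadlyApprox A' (n - d + 1) K) (hA' : BadlyApprox A' (e + 1) K) :
    ∃ c : ℝ, 0 < c ∧ ∀ B ∈ ratSubspaces n e, ∀ N, ratVec (S.x N) ∉ B → ∀ Y ∈ A', ∀ t : ℝ,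
      ‖Y + t • S.y‖ = 1 → ∀ Z ∈ B,
      1 ≤ c * (height B * (S.θ : ℝ) ^ S.a N) ^ (K + 1) *
        (‖Y + t • S.y - Z‖ + 1 / (S.θ : ℝ) ^ S.a (N + 1)) := by
  obtain ⟨c₁, hc₁, -, h₁⟩ := S.exists_component_le hA
  obtain ⟨cx, hcx, hx⟩ := S.exists_norm_x_le
  obtain ⟨ch, hch, hheight⟩ := exists_height_sup_le n e
  obtain ⟨cb, hcb, hbad⟩ := hA'
  set c₀ : ℝ := √n * 3 with hc₀
  have hc₀' : 0 ≤ c₀ := by positivity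
  have hy := S.norm_y_pos
  have h0 := S.θ_pos
  set c₂ := (ch * cx) ^ K * (1 + c₁ * c₀) / cb with hc₂
  have hc₂' : 0 < c₂ := by positivity
  refine ⟨c₂ + ch * (1 + c₁ * c₀ + c₂) * ‖S.y‖, by positivity, fun B hB N hN Y hY t h1 Z hZ => ?_⟩
  have hN' : ratVec (fun i => (S.X N i : ℚ)) ∉ B := by rwa [S.ratVec_X_mem_iff]
  obtain ⟨hB', hle⟩ := hheight B hB (S.X N) hN'
  set B' := B ⊔ Submodule.span ℝ {ratVec (fun i => (S.X N i : ℚ))} with hB'def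
  have hH1 := one_le_height hB
  have hθ1 : 1 ≤ (S.θ : ℝ) ^ S.a N := one_le_pow₀ S.one_lt_θ.le
  set G := height B * (S.θ : ℝ) ^ S.a N with hG
  have hG1 : 1 ≤ G := by nlinarith
  have hG0 : 0 < G := by linarith
  have hGK : 1 ≤ G ^ K := Real.one_le_rpow hG1 hK
  set δ := ‖Y + t • S.y - Z‖ with hδ
  have hδ0 : 0 ≤ δ := norm_nonneg _
  set s := 1 / (S.θ : ℝ) ^ S.a (N + 1) with hs
  have hs0 : 0 < s := by positivity
  have ht : |t| ≤ c₁ := by simpa [h1] using h₁ Y hY t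
  have hxy : ‖t • (S.y - ratVec (S.x N))‖ ≤ c₁ * c₀ * s := by
    rw [norm_smul, Real.norm_eq_abs, mul_assoc]
    refine mul_le_mul ht ?_ (norm_nonneg _) hc₁.le
    refine (S.norm_y_sub_x_le N).trans_eq ?_
    rw [hs, mul_one_div]
  have hxB' : ratVec (S.x N) ∈ B' := by
    rw [← S.ratVec_X_mem_iff]
    exact Submodule.mem_sup_right (Submodule.mem_span_singleton_self _)
  have hHB' : height B' ≤ ch * cx * G := by
    refine (hle 0 B.zero_mem).trans ?_
    rw [sub_zero, S.ratVec_X, norm_smul, Real.norm_of_nonneg (by positivity)]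
    calc ch * ((S.θ : ℝ) ^ S.a N * ‖ratVec (S.x N)‖) * height B
        ≤ ch * ((S.θ : ℝ) ^ S.a N * cx) * height B := by gcongr; exact hx N
      _ = _ := by rw [hG]; ring
  have hYle : ‖Y‖ ≤ c₂ * G ^ K * (δ + s) := by
    have h2 := hbad B' hB' Y hY (Z - t • ratVec (S.x N)) (B'.sub_mem
      (Submodule.mem_sup_left hZ) (B'.smul_mem _ hxB'))
    have h3 : ‖Y - (Z - t • ratVec (S.x N))‖ ≤ (1 + c₁ * c₀) * (δ + s) := by
      rw [show Y - (Z - t • ratVec (S.x N)) =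
        (Y + t • S.y - Z) - t • (S.y - ratVec (S.x N)) by rw [smul_sub]; abel]
      refine (norm_sub_le _ _).trans ?_
      have : 0 ≤ c₁ * c₀ * δ := by positivity
      linarith
    have h4 : height B' ^ K ≤ (ch * cx) ^ K * G ^ K := by
      rw [← Real.mul_rpow (by positivity) hG0.le]
      exact Real.rpow_le_rpow (height_pos hB').le hHB' hK
    have h5 : cb * ‖Y‖ ≤ ((ch * cx) ^ K * G ^ K) * ((1 + c₁ * c₀) * (δ + s)) :=
      h2.trans (mul_le_mul h4 h3 (norm_nonneg _) (by positivity))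
    rw [hc₂, div_mul_eq_mul_div, div_mul_eq_mul_div, le_div_iff₀ hcb]
    linarith
  have hxZ : ‖t • ratVec (S.x N) - Z‖ ≤ (1 + c₁ * c₀ + c₂) * G ^ K * (δ + s) := by
    rw [show t • ratVec (S.x N) - Z =
      (Y + t • S.y - Z) - t • (S.y - ratVec (S.x N)) - Y by rw [smul_sub]; abel]
    refine (norm_sub_le _ _).trans ((add_le_add_left (norm_sub_le _ _) _).trans ?_)
    have h2 : 0 ≤ (G ^ K - 1) * (δ + s) := mul_nonneg (by linarith) (by linarith)
    have h3 : 0 ≤ c₁ * c₀ * ((G ^ K - 1) * (δ + s)) := by positivity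
    have h4 : 0 ≤ c₁ * c₀ * δ := by positivity
    nlinarith
  have htle : |t| ≤ ch * G * ‖t • ratVec (S.x N) - Z‖ := by
    by_cases ht0 : t = 0
    · subst ht0
      rw [abs_zero]
      positivity
    have htp : 0 < |t| := abs_pos.2 ht0
    have h2 := (one_le_height hB').trans
      (hle (((S.θ : ℝ) ^ S.a N / t) • Z) (B.smul_mem _ hZ))
    rw [S.ratVec_X, show (S.θ : ℝ) ^ S.a N • ratVec (S.x N) - ((S.θ : ℝ) ^ S.a N / t) • Z =
      ((S.θ : ℝ) ^ S.a N / t) • (t • ratVec (S.x N) - Z) by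
        rw [smul_sub, smul_smul, div_mul_cancel₀ _ ht0], norm_smul, norm_div,
      Real.norm_of_nonneg (by positivity : (0 : ℝ) ≤ (S.θ : ℝ) ^ S.a N), Real.norm_eq_abs] at h2
    have h3 : ch * ((S.θ : ℝ) ^ S.a N / |t| * ‖t • ratVec (S.x N) - Z‖) * height B =
        (ch * G * ‖t • ratVec (S.x N) - Z‖) / |t| := by rw [hG]; ring
    rw [h3, le_div_iff₀ htp, one_mul] at h2
    exact h2
  have hfin : 1 ≤ ‖Y‖ + |t| * ‖S.y‖ := by
    rw [← h1, ← Real.norm_eq_abs, ← norm_smul]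
    exact norm_add_le _ _
  have hGK1 : G ^ (K + 1) = G ^ K * G := Real.rpow_add_one hG0.ne' _
  have h6 : |t| ≤ ch * (1 + c₁ * c₀ + c₂) * G ^ (K + 1) * (δ + s) := by
    calc |t| ≤ ch * G * ((1 + c₁ * c₀ + c₂) * G ^ K * (δ + s)) := htle.trans (by gcongr)
      _ = _ := by rw [hGK1]; ring
  have h7 : ‖Y‖ ≤ c₂ * G ^ (K + 1) * (δ + s) := by
    refine hYle.trans ?_
    gcongr
    linarith
  have h8 := mul_le_mul_of_nonneg_right h6 hy.le
  calc (1 : ℝ) ≤ _ := hfin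
    _ ≤ _ := add_le_add h7 h8
    _ = _ := by ring

/-- The rational subspaces approximating `A' + ℝ y` with an exponent larger than all the ratios
`α_{N+e} / α_N` have bounded height. -/
theorem exists_height_le_of_close {A' : Submodule ℝ (E n)} {K C μ ε : ℝ} {e : ℕ} (he : 1 ≤ e)
    (hem : e ≤ n - d) (hK : 0 ≤ K) (hA : BadlyApprox A' (n - d + 1) K)
    (hA' : BadlyApprox A' (e + 1) K) (hb : ∀ i, 1 ≤ i → C ≤ S.b i) (hC : K + 1 + 1 ≤ C)
    (hCK : K + 1 + 2 ≤ C / (K + 1) + (K + 1) / C) (hε : 0 < ε)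
    (hμ : ∀ N, growth S.b (N + e) + ε * growth S.b N ≤ μ * growth S.b N) :
    ∃ H₀ : ℝ, ∀ B ∈ ratSubspaces n e, ∀ X ∈ A' ⊔ Submodule.span ℝ {S.y}, ‖X‖ = 1 → ∀ Z ∈ B,
      ‖X - Z‖ ≤ 2 / height B ^ μ → height B ≤ H₀ := by
  obtain ⟨c, hc, hstep⟩ := S.exists_one_le_of_not_mem hK hA hA'
  obtain ⟨c₁, hc₁, h₁, -⟩ := S.exists_component_le hA
  obtain ⟨c₃, hc₃, h₃⟩ := S.exists_le_norm_y_sub hem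
  have hy := S.norm_y_pos
  have h0 := S.θ_pos
  have hC2 : 2 ≤ C := by linarith
  have hμ0 : 0 ≤ μ := by
    have h := hμ 0
    simp only [growth_zero, zero_add, mul_one] at h
    linarith [growth_pos S.two_le le_rfl e]
  set c₄ := c₁ * c₃ + ‖S.y‖ * (1 + c₁) with hc₄
  have hc₄' : 0 < c₄ := by positivity
  obtain ⟨N₀, hN₀⟩ := exists_forall_lt_of_large (c := c₃ / c₄) hb hC2 hε hμ S.one_lt_θ
    (by positivity)
  obtain ⟨H₀, hH₀⟩ := exists_index_pow hb he (by linarith) hC hCK hε hμ S.one_lt_θ hc N₀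
  refine ⟨H₀, fun B hB X hX hX1 Z hZ hXZ => ?_⟩
  by_contra hH
  obtain ⟨N, hN, hM⟩ := hH₀ (height B) (one_le_height hB) (not_le.1 hH).le
  obtain ⟨Y, hY, w, hw, rfl⟩ := Submodule.mem_sup.1 hX
  obtain ⟨t, rfl⟩ := Submodule.mem_span_singleton.1 hw
  have hBs : B = S.space N e := by
    refine S.eq_space he hem hB fun M h1 h2 => ?_
    by_contra hn
    have h3 := hstep B hB M hn Y hY t hX1 Z hZ
    have h4 := hM M h1 h2
    have hHB := height_pos hB
    have h5 : c * (height B * (S.θ : ℝ) ^ S.a M) ^ (K + 1) *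
        (‖Y + t • S.y - Z‖ + 1 / (S.θ : ℝ) ^ S.a (M + 1)) ≤
        c * (height B * (S.θ : ℝ) ^ expo S.b M) ^ (K + 1) *
        (2 / height B ^ μ + 1 / (S.θ : ℝ) ^ expo S.b (M + 1)) := by
      unfold a
      gcongr
    linarith
  have hZV : Z ∈ coordSpace n d := S.space_le_coordSpace N e (hBs ▸ hZ)
  set δ := ‖Y + t • S.y - Z‖ with hδ
  have hδ0 : 0 ≤ δ := norm_nonneg _
  set s := c₃ / (S.θ : ℝ) ^ S.a (N + e) with hs
  have hs0 : 0 < s := by positivity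
  have hs1 : s ≤ c₃ := div_le_self hc₃.le (one_le_pow₀ S.one_lt_θ.le)
  have hYδ : ‖Y‖ ≤ c₁ * δ := by
    have := h₁ Y hY (Z - t • S.y)
      (Submodule.sub_mem _ hZV (Submodule.smul_mem _ _ S.y_mem_coordSpace))
    rwa [show Y - (Z - t • S.y) = Y + t • S.y - Z by abel] at this
  have htZ : ‖t • S.y - Z‖ ≤ (1 + c₁) * δ := by
    rw [show t • S.y - Z = (Y + t • S.y - Z) - Y by abel]
    refine (norm_sub_le _ _).trans ?_
    linarith
  have hts : |t| * s ≤ ‖t • S.y - Z‖ := by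
    by_cases ht0 : t = 0
    · subst ht0
      rw [abs_zero, zero_mul]
      exact norm_nonneg _
    have h5 := h₃ N (t⁻¹ • Z) (Submodule.smul_mem _ _ (hBs ▸ hZ))
    rw [show t • S.y - Z = t • (S.y - t⁻¹ • Z) by rw [smul_sub, smul_smul, mul_inv_cancel₀ ht0,
      one_smul], norm_smul, Real.norm_eq_abs]
    gcongr
  have hfin : 1 ≤ ‖Y‖ + |t| * ‖S.y‖ := by
    rw [← hX1, ← Real.norm_eq_abs, ← norm_smul]
    exact norm_add_le _ _
  have h6 : s ≤ c₄ * δ := by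
    calc s = 1 * s := (one_mul s).symm
      _ ≤ (‖Y‖ + |t| * ‖S.y‖) * s := by gcongr
      _ = ‖Y‖ * s + ‖S.y‖ * (|t| * s) := by ring
      _ ≤ (c₁ * δ) * c₃ + ‖S.y‖ * ((1 + c₁) * δ) := by
          exact add_le_add (mul_le_mul hYδ hs1 hs0.le (by positivity))
            (mul_le_mul_of_nonneg_left (hts.trans htZ) hy.le)
      _ = _ := by rw [hc₄]; ring
  have h7 : δ ≤ 2 / ((S.θ : ℝ) ^ S.a N) ^ μ := by
    refine hXZ.trans ?_
    have := S.pow_le_height_space (N := N) he hem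
    rw [← hBs] at this
    gcongr
  have h8 := hN₀ N hN
  have h9 : s / c₄ ≤ δ := by rwa [div_le_iff₀ hc₄', mul_comm]
  have h10 : s / c₄ = c₃ / c₄ / (S.θ : ℝ) ^ expo S.b (N + e) := by
    rw [hs, div_right_comm]; rfl
  have h11 : δ ≤ 2 / ((S.θ : ℝ) ^ expo S.b N) ^ μ := h7
  linarith

/-- The subspaces spanned by `X_N, …, X_{N+e-1}` approximate every subspace containing `y` with any
exponent smaller than infinitely many ratios `α_{N+e} / α_N`. -/
theorem infinite_of_frequently {A : Submodule ℝ (E n)} (hy : S.y ∈ A) {μ ε : ℝ} {e : ℕ}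
    (he : 1 ≤ e) (hem : e ≤ n - d) (hε : 0 < ε) (hμ : 0 ≤ μ)
    (h : ∀ N₀, ∃ N ≥ N₀, μ * growth S.b N + ε * growth S.b N ≤ growth S.b (N + e)) :
    {B | B ∈ ratSubspaces n e ∧ firstAngle A B ≤ 1 / height B ^ μ}.Infinite := by
  obtain ⟨ch, hch, hh⟩ := S.exists_height_space_le he hem
  have hyp := S.norm_y_pos
  have h0 := S.θ_pos
  obtain ⟨N₀, hN₀⟩ := exists_forall_le_of_large (c := (√n * 3 + 1) / ‖S.y‖ * ch ^ μ) (e := e)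
    S.two_le le_rfl hε hμ S.one_lt_θ (by positivity)
  intro hfin
  -- the heights of these subspaces are unbounded
  obtain ⟨M, hM⟩ := (hfin.image height).bddAbove
  obtain ⟨N₁, hN₁⟩ := exists_nat_gt M
  obtain ⟨N, hN, hNμ⟩ := h (max N₀ N₁)
  have hNN := hN₀ N (le_trans (le_max_left _ _) hN) hNμ
  have hmem : S.space N e ∈ ratSubspaces n e ∧
      firstAngle A (S.space N e) ≤ 1 / height (S.space N e) ^ μ := by
    refine ⟨S.space_mem he hem, ?_⟩
    have hH := height_pos (S.space_mem (N := N) he hem)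
    have hx0 : ratVec (S.x (N + (e - 1))) ≠ 0 := by
      intro h
      have h1 := congrArg (fun v : E n => v ⟨0, by have := S.d_lt; omega⟩) h
      simp [ratVec, S.x_apply_zero (N + (e - 1)) (i := ⟨0, by have := S.d_lt; omega⟩) rfl] at h1
    refine (firstAngle_le hy (S.x_mem_space (N := N) (show e - 1 < e by omega))
      (norm_pos_iff.1 hyp) hx0).trans ?_
    have h1 := S.norm_y_sub_x_le (N + (e - 1))
    rw [show N + (e - 1) + 1 = N + e by omega] at h1
    have h2 : height (S.space N e) ^ μ ≤ ch ^ μ * ((S.θ : ℝ) ^ S.a N) ^ μ := by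
      rw [← Real.mul_rpow hch.le (by positivity)]
      exact Real.rpow_le_rpow hH.le (hh N) hμ
    rw [div_le_div_iff₀ hyp (by positivity), one_mul]
    have h3 : (√n * 3 + 1) / ‖S.y‖ * ch ^ μ * ((S.θ : ℝ) ^ S.a N) ^ μ ≤
      (S.θ : ℝ) ^ S.a (N + e) := hNN
    calc _ ≤ (√n * 3 + 1) / (S.θ : ℝ) ^ S.a (N + e) * (ch ^ μ * ((S.θ : ℝ) ^ S.a N) ^ μ) := by
          refine mul_le_mul (h1.trans ?_) h2 (by positivity) (by positivity)
          gcongr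
          linarith
      _ = ((√n * 3 + 1) / ‖S.y‖ * ch ^ μ * ((S.θ : ℝ) ^ S.a N) ^ μ) / (S.θ : ℝ) ^ S.a (N + e) *
          ‖S.y‖ := by field_simp
      _ ≤ 1 * ‖S.y‖ := by
          gcongr
          rw [div_le_one (by positivity)]
          exact h3
      _ = _ := one_mul _
  have h1 : height (S.space N e) ≤ M := hM ⟨_, hmem, rfl⟩
  have h2 := S.pow_le_height_space (N := N) he hem
  have h3 : N < S.θ ^ S.a N :=
    (S.a_strictMono.id_le N).trans_lt (Nat.lt_pow_self S.prime.one_lt)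
  have h4 : (N : ℝ) < (S.θ : ℝ) ^ S.a N := by exact_mod_cast h3
  have h5 : (N₁ : ℝ) ≤ N := by exact_mod_cast (le_trans (le_max_right _ _) hN)
  linarith

end LacunaryLine

/-! ### Algebraic independence and irrationality -/

/-- From finitely many uncountable sets of real numbers, algebraically independent elements can be
chosen. -/
theorem exists_algebraicIndependent {ι : Type} [Finite ι] (s : ι → Set ℝ)
    (hs : ∀ i, ¬ (s i).Countable) : ∃ x : ι → ℝ, (∀ i, x i ∈ s i) ∧ AlgebraicIndependent ℚ x := by
  induction ι using Finite.induction_empty_option with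
  | of_equiv e h =>
    obtain ⟨x, hx, hi⟩ := h (fun i => s (e i)) fun i => hs _
    refine ⟨x ∘ e.symm, fun i => by simpa using hx (e.symm i), ?_⟩
    rw [← algebraicIndependent_equiv e]
    have : (x ∘ e.symm) ∘ e = x := by ext; simp
    rwa [this]
  | h_empty =>
    exact ⟨fun i => i.elim, fun i => i.elim, algebraicIndependent_empty_type⟩
  | h_option h =>
    rename_i α _
    obtain ⟨x, hx, hi⟩ := h (fun i => s (some i)) fun i => hs _
    have hc : Countable (Algebra.adjoin ℚ (Set.range x)) := by
      rw [Algebra.adjoin_range_eq_range_aeval]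
      have hcp : Countable (MvPolynomial α ℚ) := by
        exact (MvPolynomial.basisMonomials α ℚ).repr.toEquiv.injective.countable
      exact (Set.countable_range (MvPolynomial.aeval x : MvPolynomial α ℚ →ₐ[ℚ] ℝ)).to_subtype
    have hcount := Algebraic.countable (Algebra.adjoin ℚ (Set.range x)) ℝ
    obtain ⟨a, ha, hat⟩ : ∃ a ∈ s none,
        Transcendental (Algebra.adjoin ℚ (Set.range x)) a := by
      by_contra hcon
      push Not at hcon
      refine hs none (hcount.mono fun a ha => ?_)
      have := hcon a ha
      unfold Transcendental at this
      exact not_not.1 this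
    refine ⟨fun o => o.elim a x, fun i => ?_, (hi.option_iff_transcendental a).2 hat⟩
    cases i with
    | none => exact ha
    | some i => exact hx i

/-- A lacunary series with digits `1` and `2` in a base at least `5` determines its digits. -/
theorem digits_injective {θ : ℝ} (hθ : 5 ≤ θ) {a : ℕ → ℕ} (ha : StrictMono a) {c c' : ℕ → ℝ}
    (hc : ∀ k, c k = 1 ∨ c k = 2) (hc' : ∀ k, c' k = 1 ∨ c' k = 2)
    (h : ∑' k, c k / θ ^ a k = ∑' k, c' k / θ ^ a k) : c = c' := by
  have h0 : 0 < θ := by linarith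
  have hi1 : θ⁻¹ < 1 := inv_lt_one_of_one_lt₀ (by linarith)
  have hgeo : Summable fun k : ℕ => (θ⁻¹) ^ k := summable_geometric_of_lt_one (by positivity) hi1
  have hle : ∀ (f : ℕ → ℝ) (M : ℝ), (∀ k, |f k| ≤ M) → ∀ N k,
      |f (k + N) / θ ^ a (k + N)| ≤ M / θ ^ a N * (θ⁻¹) ^ k := by
    intro f M hf N k
    have hM : 0 ≤ M := (abs_nonneg _).trans (hf 0)
    have h1 : θ ^ (a N + k) ≤ θ ^ a (k + N) :=
      pow_le_pow_right₀ (by linarith) (by rw [add_comm k]; simpa [add_comm] using ha.add_le_nat k N)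
    rw [abs_div, abs_of_pos (pow_pos h0 _)]
    calc _ ≤ M / θ ^ (a N + k) := by
          have := hf (k + N)
          gcongr
      _ = _ := by rw [pow_add, inv_pow]; field_simp
  have hsum : ∀ (f : ℕ → ℝ) (M : ℝ), (∀ k, |f k| ≤ M) → Summable fun k => f k / θ ^ a k :=
    fun f M hf => Summable.of_norm_bounded (hgeo.mul_left (M / θ ^ a 0)) fun k => hle f M hf 0 k
  have hb : ∀ c : ℕ → ℝ, (∀ k, c k = 1 ∨ c k = 2) → ∀ k, |c k| ≤ 2 := fun c hc k => by
    rcases hc k with h | h <;> rw [h] <;> norm_num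
  set D : ℕ → ℝ := fun k => c k - c' k with hD
  have hDb : ∀ k, |D k| ≤ 1 := fun k => by
    simp only [hD]
    rcases hc k with h | h <;> rcases hc' k with h' | h' <;> rw [h, h'] <;> norm_num
  have hD0 : ∑' k, D k / θ ^ a k = 0 := by
    simp only [hD, sub_div]
    rw [(hsum c 2 (hb c hc)).tsum_sub (hsum c' 2 (hb c' hc')), h, sub_self]
  by_contra hne
  have hex : ∃ k, D k ≠ 0 := by
    by_contra hcon
    push Not at hcon
    exact hne (funext fun k => sub_eq_zero.1 (hcon k))
  classical
  -- at the first index where the digits differ, the term exceeds the sum of the following ones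
  set k₀ := Nat.find hex
  have hk₀ : D k₀ ≠ 0 := Nat.find_spec hex
  have hlt : ∀ k < k₀, D k = 0 := fun k hk => not_not.1 (Nat.find_min hex hk)
  have hsD := hsum D 1 hDb
  rw [← hsD.sum_add_tsum_nat_add (k₀ + 1), Finset.sum_range_succ,
    Finset.sum_eq_zero fun k hk => by rw [hlt k (Finset.mem_range.1 hk), zero_div], zero_add] at hD0
  have hD1 : |D k₀| = 1 := by
    simp only [hD] at hk₀ ⊢
    rcases hc k₀ with h | h <;> rcases hc' k₀ with h' | h' <;> rw [h, h'] at hk₀ ⊢ <;>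
      revert hk₀ <;> norm_num
  have htail : |∑' k, D (k + (k₀ + 1)) / θ ^ a (k + (k₀ + 1))| ≤
      1 / θ ^ a (k₀ + 1) * (1 - θ⁻¹)⁻¹ := by
    have h1 : HasSum (fun k : ℕ => 1 / θ ^ a (k₀ + 1) * (θ⁻¹) ^ k)
        (1 / θ ^ a (k₀ + 1) * (1 - θ⁻¹)⁻¹) :=
      (hasSum_geometric_of_lt_one (by positivity) hi1).mul_left _
    exact tsum_of_norm_bounded (f := fun k => D (k + (k₀ + 1)) / θ ^ a (k + (k₀ + 1))) h1
      fun k => hle D 1 hDb (k₀ + 1) k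
  have h2 : |D k₀ / θ ^ a k₀| = 1 / θ ^ a k₀ := by
    rw [abs_div, hD1, abs_of_pos (pow_pos h0 _)]
  rw [← neg_eq_iff_add_eq_zero] at hD0
  rw [← hD0, abs_neg, h2] at htail
  have h3 : θ ^ a k₀ * θ ≤ θ ^ a (k₀ + 1) := by
    rw [← pow_succ]
    exact pow_le_pow_right₀ (by linarith) (ha (Nat.lt_succ_self _))
  have h4 : 1 / θ ^ a (k₀ + 1) * (1 - θ⁻¹)⁻¹ ≤ 1 / (θ ^ a k₀ * θ) * 2 := by
    gcongr
    rw [inv_le_comm₀ (by linarith) (by norm_num)]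
    have : θ⁻¹ ≤ 5⁻¹ := inv_anti₀ (by norm_num) hθ
    linarith
  have h5 : 1 / (θ ^ a k₀ * θ) * 2 < 1 / θ ^ a k₀ := by
    rw [div_mul_eq_mul_div, div_lt_div_iff₀ (by positivity) (by positivity)]
    have := pow_pos h0 (a k₀)
    nlinarith
  linarith

/-- The digit attached to a boolean. -/
def boolDigit (t : Bool) : ℕ := if t then 1 else 2

theorem boolDigit_mem (t : Bool) : boolDigit t = 1 ∨ boolDigit t = 2 := by
  cases t <;> simp [boolDigit]

theorem not_countable_range_lacunary {θ m l : ℕ} (hθ : 5 ≤ θ) (hm : 0 < m) {b : ℕ → ℝ}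
    (hb : ∀ i, 1 ≤ i → 2 ≤ b i) (hl : l < m) :
    ¬ (Set.range fun t : ℕ → Bool =>
      lacunary θ m b (fun k => boolDigit (t (k / m))) l).Countable := by
  intro hcount
  have hinj : Function.Injective fun t : ℕ → Bool =>
      lacunary θ m b (fun k => boolDigit (t (k / m))) l := by
    intro t t' h
    have hdiv : ∀ k, (m * k + l) / m = k := fun k => by
      rw [Nat.mul_add_div hm, Nat.div_eq_of_lt hl, add_zero]
    simp only [lacunary, hdiv] at h
    have hd : ∀ (t : ℕ → Bool) (k : ℕ),
        (boolDigit (t k) : ℝ) = 1 ∨ (boolDigit (t k) : ℝ) = 2 := fun t k => by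
      rcases boolDigit_mem (t k) with h | h <;> rw [h] <;> norm_num
    have hmono : StrictMono fun k => expo b (m * k + l) :=
      (expo_strictMono hb le_rfl).comp fun i j hij => by
        have := Nat.mul_lt_mul_of_pos_left hij hm
        exact Nat.add_lt_add_right this l
    have := digits_injective (θ := θ) (by exact_mod_cast hθ) hmono (hd t) (hd t') h
    funext k
    have hk := congrFun this k
    have hk' : boolDigit (t k) = boolDigit (t' k) := by exact_mod_cast hk
    revert hk'
    cases t k <;> cases t' k <;> simp [boolDigit]
  have hc := Set.countable_of_injective_of_countable_image (s := Set.univ) hinj.injOn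
    (by rwa [Set.image_univ])
  have hc' : Countable (ℕ → Bool) := Set.countable_univ_iff.1 hc
  obtain ⟨f, hf⟩ := exists_surjective_nat (ℕ → Bool)
  obtain ⟨k, hk⟩ := hf fun k => !(f k k)
  simpa using congrFun hk k

/-- Digits can be chosen so that all the numbers `σ_{j,l}` are algebraically independent. -/
theorem exists_digits {n d θ : ℕ} (hdn : d < n) (hθ : 5 ≤ θ) {β : ℕ → ℝ}
    (hb : ∀ j, j < d → ∀ i, 1 ≤ i → 2 ≤ multipliers n d β j i) :
    ∃ u : ℕ → ℕ → ℕ, (∀ j k, u j k = 1 ∨ u j k = 2) ∧ AlgebraicIndependent ℚ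
      (fun p : (j : Fin d) × Fin (n - d + (j : ℕ)) => sigma n d θ β u p.1 p.2) := by
  obtain ⟨x, hx, hi⟩ := exists_algebraicIndependent
    (fun p : (j : Fin d) × Fin (n - d + (j : ℕ)) => Set.range fun t : ℕ → Bool =>
      lacunary θ (n - d + p.1) (multipliers n d β p.1)
        (fun k => boolDigit (t (k / (n - d + p.1)))) p.2)
    fun p => not_countable_range_lacunary hθ (by omega) (hb p.1 p.1.2) p.2.2
  choose t ht using hx
  let u : ℕ → ℕ → ℕ := fun j k => if h : j < d then
    boolDigit (t ⟨⟨j, h⟩, ⟨k % (n - d + j), Nat.mod_lt _ (by omega)⟩⟩ (k / (n - d + j))) else 1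
  refine ⟨u, fun j k => ?_, ?_⟩
  · simp only [u]
    split_ifs
    · exact boolDigit_mem _
    · exact Or.inl rfl
  · convert hi using 1
    funext p
    rw [← ht p]
    simp only [sigma, lacunary]
    refine tsum_congr fun k => ?_
    have hmod : ((n - d + (p.1 : ℕ)) * k + p.2) % (n - d + p.1) = p.2 := by
      rw [Nat.mul_add_mod, Nat.mod_eq_of_lt p.2.2]
    simp only [u, p.1.2, dif_pos, Fin.eta, hmod]

/-- The spanning vectors with the numbers `σ_{j,l}` replaced by elements of a commutative ring. -/
def genVec {R : Type*} [CommRing R] {n d : ℕ} (hdn : d < n)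
    (p : ((j : Fin d) × Fin (n - d + (j : ℕ))) → R) (j : Fin d) (i : Fin n) : R :=
  if (i : ℕ) = 0 then 1 else if (i : ℕ) < d - j then 0
    else p ⟨j, ⟨i - (d - j), by have := i.2; have := j.2; omega⟩⟩

/-- The vectors with first coordinate `1` followed by `d - k - 1` zeros span a space of dimension
`n - d + k + 1`, so they do not all lie in a subspace of smaller dimension. -/
theorem exists_vec_notMem {n d k : ℕ} (hdn : d < n) (hk : k < d) {W : Submodule ℚ (Fin n → ℚ)}
    (hW : finrank ℚ W ≤ n - d + k) :
    ∃ v : Fin n → ℚ, (∀ i : Fin n, (i : ℕ) = 0 → v i = 1) ∧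
      (∀ i : Fin n, (i : ℕ) ≠ 0 → (i : ℕ) < d - k → v i = 0) ∧ v ∉ W := by
  by_contra hcon
  push Not at hcon
  let e₀ : Fin n := ⟨0, by omega⟩
  have h0 : (Pi.single e₀ 1 : Fin n → ℚ) ∈ W := by
    refine hcon _ (fun i hi => ?_) (fun i hi _ => ?_)
    · rw [show i = e₀ from Fin.ext hi, Pi.single_eq_same]
    · rw [Pi.single_eq_of_ne (fun h => hi (by rw [h]))]
  have h1 : ∀ i : Fin n, d - k ≤ (i : ℕ) → (Pi.single i 1 : Fin n → ℚ) ∈ W := by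
    intro i hi
    have hne : e₀ ≠ i := fun h => by
      have := congrArg Fin.val h
      simp only [e₀] at this
      omega
    have h2 := hcon (Pi.single e₀ 1 + Pi.single i 1) (fun j hj => ?_) (fun j hj hj' => ?_)
    · have := W.sub_mem h2 h0
      rwa [add_sub_cancel_left] at this
    · rw [show j = e₀ from Fin.ext hj]
      simp [hne]
    · have h3 : j ≠ e₀ := fun h => hj (by rw [h])
      have h4 : j ≠ i := fun h => by rw [h] at hj'; omega
      simp [h3, h4]
  let f : Fin (n - d + k + 1) → Fin n := fun j =>
    if (j : ℕ) = 0 then e₀ else ⟨d - k + j - 1, by omega⟩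
  have hf : Function.Injective f := by
    intro i j h
    simp only [f, e₀] at h
    ext
    split_ifs at h <;> simp only [Fin.mk.injEq] at h <;> omega
  have hli : LinearIndependent ℚ fun j => (Pi.basisFun ℚ (Fin n)) (f j) :=
    (Pi.basisFun ℚ (Fin n)).linearIndependent.comp f hf
  have hle : Submodule.span ℚ (Set.range fun j => (Pi.basisFun ℚ (Fin n)) (f j)) ≤ W := by
    refine Submodule.span_le.2 ?_
    rintro _ ⟨j, rfl⟩
    simp only [Pi.basisFun_apply, SetLike.mem_coe]
    by_cases hj : (j : ℕ) = 0
    · rw [show f j = e₀ from if_pos hj]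
      exact h0
    · simp only [f, hj, if_false]
      exact h1 _ (by simp only; omega)
  have := Submodule.finrank_mono hle
  rw [finrank_span_eq_card hli, Fintype.card_fin] at this
  omega

/-- Rational parameters for which the spanning vectors are in general position with respect to
given rational vectors. -/
theorem exists_genVec_linearIndependent {n d : ℕ} (hdn : d < n) {w : Fin (n - d) → Fin n → ℚ}
    (hw : LinearIndependent ℚ w) : ∃ p : ((j : Fin d) × Fin (n - d + (j : ℕ))) → ℚ,
      LinearIndependent ℚ (Fin.append w (genVec hdn p)) := by
  have key : ∀ k ≤ d, ∃ v : Fin (n - d + k) → Fin n → ℚ, LinearIndependent ℚ v ∧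
      (∀ i, v (Fin.castAdd k i) = w i) ∧ ∀ j : Fin k,
        (∀ i : Fin n, (i : ℕ) = 0 → v (Fin.natAdd (n - d) j) i = 1) ∧
        (∀ i : Fin n, (i : ℕ) ≠ 0 → (i : ℕ) < d - j → v (Fin.natAdd (n - d) j) i = 0) := by
    intro k
    induction k with
    | zero => exact fun _ => ⟨w, hw, fun i => rfl, fun j => j.elim0⟩
    | succ k ih =>
      intro hk
      obtain ⟨v, hv, hvw, hvj⟩ := ih (by omega)
      obtain ⟨y, hy0, hy1, hy⟩ := exists_vec_notMem hdn (show k < d by omega)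
        (W := Submodule.span ℚ (Set.range v))
        (by rw [finrank_span_eq_card hv, Fintype.card_fin])
      refine ⟨Fin.snoc (α := fun _ => Fin n → ℚ) v y, linearIndependent_finSnoc.2 ⟨hv, hy⟩,
        fun i => ?_, fun j => ?_⟩
      · rw [← hvw i]
        exact Fin.snoc_castSucc (α := fun _ => Fin n → ℚ) _ _ (Fin.castAdd k i)
      · refine Fin.lastCases ?_ (fun j => ?_) j
        · have : (Fin.snoc (α := fun _ => Fin n → ℚ) v y) (Fin.natAdd (n - d) (Fin.last k)) = y :=
            Fin.snoc_last (α := fun _ => Fin n → ℚ) _ _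
          rw [this]
          exact ⟨hy0, fun i hi hi' => hy1 i hi (by simpa using hi')⟩
        · have : (Fin.snoc (α := fun _ => Fin n → ℚ) v y) (Fin.natAdd (n - d) j.castSucc) =
              v (Fin.natAdd (n - d) j) :=
            Fin.snoc_castSucc (α := fun _ => Fin n → ℚ) _ _ (Fin.natAdd (n - d) j)
          rw [this]
          exact hvj j
  obtain ⟨v, hv, hvw, hvj⟩ := key d le_rfl
  refine ⟨fun q => v (Fin.natAdd (n - d) q.1) ⟨q.2 + (d - q.1), by
    have := q.2.2; have := q.1.2; omega⟩, ?_⟩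
  convert hv using 1
  funext a
  refine Fin.addCases (fun i => ?_) (fun j => ?_) a
  · rw [Fin.append_left, hvw]
  · rw [Fin.append_right]
    funext i
    unfold genVec
    split_ifs with h1 h2
    · exact ((hvj j).1 i h1).symm
    · exact ((hvj j).2 i h1 h2).symm
    · simp only
      congr 1
      ext
      simp only
      omega

/-- The square matrix of the vectors `w` and `genVec p`. -/
def genMat {R : Type*} [CommRing R] {n d : ℕ} (hdn : d < n) (w : Fin (n - d) → Fin n → R)
    (p : ((j : Fin d) × Fin (n - d + (j : ℕ))) → R) :
    Matrix (Fin (n - d + d)) (Fin (n - d + d)) R :=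
  Matrix.of fun a b => Fin.append w (genVec hdn p) a (Fin.cast (by omega) b)

theorem map_genMat {R R' : Type*} [CommRing R] [CommRing R'] (f : R →+* R') {n d : ℕ} (hdn : d < n)
    (w : Fin (n - d) → Fin n → R) (p : ((j : Fin d) × Fin (n - d + (j : ℕ))) → R) :
    f (genMat hdn w p).det = (genMat hdn (fun i j => f (w i j)) fun q => f (p q)).det := by
  rw [RingHom.map_det]
  congr 1
  ext a b
  simp only [RingHom.mapMatrix_apply, Matrix.map_apply, genMat, Matrix.of_apply]
  refine Fin.addCases (fun i => ?_) (fun j => ?_) a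
  · rw [Fin.append_left, Fin.append_left]
  · rw [Fin.append_right, Fin.append_right]
    unfold genVec
    split_ifs <;> simp

theorem linearIndependent_iff_genMat {F : Type*} [Field F] {n d : ℕ} (hdn : d < n)
    (w : Fin (n - d) → Fin n → F) (p : ((j : Fin d) × Fin (n - d + (j : ℕ))) → F) :
    LinearIndependent F (Fin.append w (genVec hdn p)) ↔ (genMat hdn w p).det ≠ 0 := by
  rw [← isUnit_iff_ne_zero, ← Matrix.isUnit_iff_isUnit_det,
    ← Matrix.linearIndependent_rows_iff_isUnit]
  have hc : Function.Bijective (Fin.cast (show n - d + d = n by omega)) :=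
    (finCongr (show n - d + d = n by omega)).bijective
  exact (LinearMap.linearIndependent_iff (LinearMap.funLeft F F (Fin.cast (by omega)))
    (LinearMap.ker_eq_bot.2 (LinearMap.funLeft_injective_of_surjective F F _ hc.2))).symm

/-- For algebraically independent parameters, the spanning vectors are in general position with
respect to all rational vectors: otherwise a polynomial would vanish identically. -/
theorem linearIndependent_append_genVec {n d : ℕ} (hdn : d < n)
    {σ : ((j : Fin d) × Fin (n - d + (j : ℕ))) → ℝ} (hσ : AlgebraicIndependent ℚ σ)
    {w : Fin (n - d) → Fin n → ℚ} (hw : LinearIndependent ℚ w) :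
    LinearIndependent ℝ (Fin.append (fun i j => (w i j : ℝ)) (genVec hdn σ)) := by
  rw [linearIndependent_iff_genMat]
  intro h
  let M := genMat hdn (fun i j => (MvPolynomial.C (w i j) :
    MvPolynomial ((j : Fin d) × Fin (n - d + (j : ℕ))) ℚ)) MvPolynomial.X
  have h1 : MvPolynomial.aeval σ M.det = 0 := by
    have := map_genMat (MvPolynomial.aeval (R := ℚ) σ).toRingHom hdn
      (fun i j => MvPolynomial.C (w i j)) MvPolynomial.X
    refine Eq.trans this (Eq.trans ?_ h)
    simp
  have h2 : M.det = 0 := (algebraicIndependent_iff.1 hσ) _ h1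
  obtain ⟨p, hp⟩ := exists_genVec_linearIndependent hdn hw
  rw [linearIndependent_iff_genMat] at hp
  apply hp
  have := map_genMat (MvPolynomial.eval p) hdn (fun i j => MvPolynomial.C (w i j)) MvPolynomial.X
  simp only [MvPolynomial.eval_C, MvPolynomial.eval_X] at this
  rw [← this]
  change MvPolynomial.eval p M.det = 0
  rw [h2, map_zero]

theorem IsRatBasis.linearIndependent_rat {n e : ℕ} {v : Fin e → Fin n → ℚ}
    {B : Submodule ℝ (E n)} (h : IsRatBasis v B) : LinearIndependent ℚ v := by
  rw [Fintype.linearIndependent_iff]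
  intro g hg i
  have h1 := Fintype.linearIndependent_iff.1 h.1 (fun i => (g i : ℝ)) (by
    ext k
    have := congrFun hg k
    simp only [Finset.sum_apply, Pi.smul_apply, smul_eq_mul, Pi.zero_apply] at this
    simp only [WithLp.ofLp_sum, WithLp.ofLp_smul, Finset.sum_apply, Pi.smul_apply, ratVec,
      smul_eq_mul, PiLp.zero_apply]
    exact_mod_cast this) i
  exact_mod_cast h1

section
variable {n d θ : ℕ} {β : ℕ → ℝ} {u : ℕ → ℕ → ℕ}

theorem linearIndependent_spanVec_and_inf (hdn : d < n) (hσ : AlgebraicIndependent ℚ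
      (fun p : (j : Fin d) × Fin (n - d + (j : ℕ)) => sigma n d θ β u p.1 p.2))
    {B : Submodule ℝ (E n)} (hB : B ∈ ratSubspaces n (n - d)) :
    LinearIndependent ℝ (fun j : Fin d => spanVec n d θ β u j) ∧
      Submodule.span ℝ (Set.range fun j : Fin d => spanVec n d θ β u j) ⊓ B = ⊥ := by
  obtain ⟨w, hw⟩ := hB
  have h1 := linearIndependent_append_genVec hdn hσ hw.linearIndependent_rat
  have h2 : LinearIndependent ℝ (Fin.append (fun i => ratVec (w i))
      (fun j : Fin d => spanVec n d θ β u j)) := by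
    rw [← linearIndependent_ofLp_iff]
    convert h1 using 1
    funext a
    refine Fin.addCases (fun i => ?_) (fun j => ?_) a
    · rw [Fin.append_left, Fin.append_left]; rfl
    · rw [Fin.append_right, Fin.append_right]; rfl
  rw [← linearIndependent_equiv finSumFinEquiv] at h2
  have h3 := linearIndependent_sum.1 h2
  simp only [Function.comp_def, finSumFinEquiv_apply_left, finSumFinEquiv_apply_right,
    Fin.append_left, Fin.append_right] at h3
  refine ⟨h3.2.1, ?_⟩
  rw [inf_comm, ← disjoint_iff, ← hw.2]
  exact h3.2.2

/-- A rational subspace extends to a rational subspace of any larger dimension. -/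
theorem exists_ratSubspaces_ge {n e f : ℕ} (hef : e ≤ f) (hf : f ≤ n) {B : Submodule ℝ (E n)}
    (hB : B ∈ ratSubspaces n e) : ∃ B' ∈ ratSubspaces n f, B ≤ B' := by
  induction f, hef using Nat.le_induction with
  | base => exact ⟨B, hB, le_rfl⟩
  | succ f hef ih =>
    obtain ⟨B', ⟨v, hv⟩, hle⟩ := ih (by omega)
    have : ∃ i : Fin n, ratVec (Pi.single i 1) ∉ B' := by
      by_contra hcon
      push Not at hcon
      have htop : B' = ⊤ := by
        rw [eq_top_iff, ← (EuclideanSpace.basisFun (Fin n) ℝ).toBasis.span_eq]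
        refine Submodule.span_le.2 ?_
        rintro _ ⟨i, rfl⟩
        have h := hcon i
        rwa [ratVec_single, ← EuclideanSpace.basisFun_apply, ← OrthonormalBasis.coe_toBasis] at h
      have := hv.finrank_eq
      rw [htop, finrank_top, finrank_euclideanSpace_fin] at this
      omega
    obtain ⟨i, hi⟩ := this
    exact ⟨_, ⟨_, hv.snoc hi⟩, hle.trans le_sup_left⟩

theorem inf_eq_bot_of_algebraicIndependent (hdn : d < n) (hσ : AlgebraicIndependent ℚ
      (fun p : (j : Fin d) × Fin (n - d + (j : ℕ)) => sigma n d θ β u p.1 p.2)) {e : ℕ}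
    (he : e ≤ n - d) {B : Submodule ℝ (E n)} (hB : B ∈ ratSubspaces n e) :
    Submodule.span ℝ (Set.range fun j : Fin d => spanVec n d θ β u j) ⊓ B = ⊥ := by
  obtain ⟨B', hB', hle⟩ := exists_ratSubspaces_ge he (by omega) hB
  rw [eq_bot_iff, ← (linearIndependent_spanVec_and_inf hdn hσ hB').2]
  exact inf_le_inf_left _ hle

theorem ratSubspaces_zero_bot (n : ℕ) : (⊥ : Submodule ℝ (E n)) ∈ ratSubspaces n 0 :=
  ⟨Fin.elim0, linearIndependent_empty_type, by
    rw [Set.range_eq_empty, Submodule.span_empty]⟩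

theorem span_mem_irrationalSubspaces (hdn : d < n) (hσ : AlgebraicIndependent ℚ
      (fun p : (j : Fin d) × Fin (n - d + (j : ℕ)) => sigma n d θ β u p.1 p.2)) :
    Submodule.span ℝ (Set.range fun j : Fin d => spanVec n d θ β u j) ∈
      irrationalSubspaces n d (n - d) 1 := by
  refine ⟨?_, fun B hB => ?_⟩
  · obtain ⟨B, hB, -⟩ := exists_ratSubspaces_ge (Nat.zero_le (n - d)) (by omega)
      (ratSubspaces_zero_bot n)
    rw [finrank_span_eq_card (linearIndependent_spanVec_and_inf hdn hσ hB).1, Fintype.card_fin]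
  · rw [inf_eq_bot_of_algebraicIndependent hdn hσ le_rfl hB, finrank_bot]
    omega

end

/-! ### Products of consecutive multipliers and the exponents of the construction -/

theorem two_le_constC {n d : ℕ} (hn : 2 ≤ n) (hd : 1 ≤ d) : 2 ≤ constC n d := by
  induction d, hd using Nat.le_induction with
  | base =>
    have : (1 : ℝ) ≤ √5 := Real.one_le_sqrt.2 (by norm_num)
    simp only [constC]
    linarith
  | succ d hd ih =>
    obtain ⟨k, rfl⟩ : ∃ k, d = k + 1 := ⟨d - 1, by omega⟩
    have h1 : (1 : ℝ) ≤ constC n (k + 1) ^ (2 * n) := one_le_pow₀ (by linarith)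
    have h2 : (2 : ℝ) ≤ n := by exact_mod_cast hn
    simp only [constC]
    nlinarith

theorem le_periodicExt {m : ℕ} {c : ℝ} {β : ℕ → ℝ} (h : ∀ i ∈ Finset.Icc 1 m, c ≤ β i) (k : ℕ) :
    c ≤ periodicExt m c β k := by
  unfold periodicExt
  split_ifs with hk
  · exact h _ (Finset.mem_Icc.2 ⟨by omega, by omega⟩)
  · exact le_rfl

theorem periodicExt_const (m : ℕ) (c : ℝ) (k : ℕ) : periodicExt m c (fun _ => c) k = c := by
  unfold periodicExt
  split_ifs <;> rfl

/-- The product of `e` consecutive terms of `b`, starting after the index `N`. -/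
noncomputable def window (b : ℕ → ℝ) (e N : ℕ) : ℝ := ∏ t ∈ Finset.range e, b (N + t + 1)

theorem window_eq (b : ℕ → ℝ) (e N : ℕ) :
    window b e N = ∏ i ∈ Finset.Icc (N + 1) (N + e), b i := by
  unfold window
  induction e with
  | zero => simp
  | succ e ih =>
    rw [Finset.prod_range_succ, ih, ← add_assoc, Finset.prod_Icc_succ_top (by omega)]

theorem growth_add_eq_window (b : ℕ → ℝ) (e N : ℕ) :
    growth b (N + e) = growth b N * window b e N := by
  rw [growth_add, window_eq]

theorem window_succ_mul (b : ℕ → ℝ) (e N : ℕ) :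
    window b e (N + 1) * b (N + 1) = window b e N * b (N + e + 1) := by
  unfold window
  rw [← Finset.prod_range_succ (fun t => b (N + t + 1)), Finset.prod_range_succ']
  congr 1
  refine Finset.prod_congr rfl fun t _ => ?_
  congr 1
  omega

theorem window_periodicExt_add (m : ℕ) (c : ℝ) (β : ℕ → ℝ) (e N q : ℕ) :
    window (periodicExt m c β) e (2 * m * q + N) = window (periodicExt m c β) e N := by
  unfold window periodicExt
  refine Finset.prod_congr rfl fun t _ => ?_
  simp only [Nat.add_sub_cancel]
  rw [add_assoc, Nat.mul_add_mod]

theorem window_periodicExt_of_le {m : ℕ} (c : ℝ) (β : ℕ → ℝ) {e i : ℕ} (hi : i + e ≤ m) :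
    window (periodicExt m c β) e i = ∏ k ∈ Finset.Icc (i + 1) (i + e), β k := by
  rw [← window_eq]
  unfold window periodicExt
  refine Finset.prod_congr rfl fun t ht => ?_
  have := Finset.mem_range.1 ht
  simp only [Nat.add_sub_cancel]
  rw [Nat.mod_eq_of_lt (by omega), if_pos (by omega)]

/-- All the products of `e` consecutive terms of the periodic extension are bounded by those of
`β_1, …, β_m`: sliding a window over a block of minimal terms cannot increase the product. -/
theorem window_periodicExt_le {m e : ℕ} (hem : e ≤ m) (hm : 0 < m) {c : ℝ} (hc : 0 < c)
    {β : ℕ → ℝ} (h : ∀ i ∈ Finset.Icc 1 m, c ≤ β i) (N : ℕ) :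
    window (periodicExt m c β) e N ≤ maxWindow m β e := by
  set b := periodicExt m c β with hb
  have hcb : ∀ k, c ≤ b k := le_periodicExt h
  have hpos : ∀ k, 0 < b k := fun k => hc.trans_le (hcb k)
  have hwpos : ∀ N, 0 < window b e N := fun N => Finset.prod_pos fun _ _ => hpos _
  have hmin : ∀ r, m ≤ r → r < 2 * m → b (r + 1) = c := fun r h1 h2 => by
    rw [hb]
    unfold periodicExt
    rw [Nat.add_sub_cancel, Nat.mod_eq_of_lt h2, if_neg (by omega)]
  have hin : ∀ r, r + e ≤ m → window b e r ≤ maxWindow m β e := fun r hr => by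
    rw [hb, window_periodicExt_of_le c β hr]
    exact Finset.le_sup' (fun i => ∏ k ∈ Finset.Icc (i + 1) (i + e), β k)
      (Finset.mem_range.2 (by omega))
  have hdown : ∀ k, k ≤ e → window b e (m - e + k) ≤ maxWindow m β e := by
    intro k
    induction k with
    | zero => exact fun _ => hin _ (by omega)
    | succ k ih =>
      intro hk
      refine le_trans ?_ (ih (by omega))
      have h1 := window_succ_mul b e (m - e + k)
      rw [hmin (m - e + k + e) (by omega) (by omega)] at h1
      rw [← add_assoc]
      refine le_of_mul_le_mul_right (h1.trans_le ?_) (hpos (m - e + k + 1))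
      exact mul_le_mul_of_nonneg_left (hcb _) (hwpos _).le
  have hup : ∀ k, k ≤ m → window b e (2 * m - k) ≤ maxWindow m β e := by
    intro k
    induction k with
    | zero =>
      intro _
      have := window_periodicExt_add m c β e 0 1
      rw [mul_one, add_zero] at this
      rw [Nat.sub_zero, hb, this]
      exact hin 0 (by omega)
    | succ k ih =>
      intro hk
      refine le_trans ?_ (ih (by omega))
      have h1 := window_succ_mul b e (2 * m - (k + 1))
      rw [hmin (2 * m - (k + 1)) (by omega) (by omega),
        show 2 * m - (k + 1) + 1 = 2 * m - k by omega] at h1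
      refine le_of_mul_le_mul_right (le_trans ?_ h1.ge) hc
      exact mul_le_mul_of_nonneg_left (hcb _) (hwpos _).le
  have hN : window b e N = window b e (N % (2 * m)) := by
    conv_lhs => rw [← Nat.div_add_mod N (2 * m)]
    exact window_periodicExt_add m c β e _ _
  have hlt : N % (2 * m) < 2 * m := Nat.mod_lt _ (by omega)
  rw [hN]
  generalize N % (2 * m) = r at *
  by_cases h1 : r + e ≤ m
  · exact hin r h1
  by_cases h2 : r ≤ m
  · have := hdown (r - (m - e)) (by omega)
    rwa [show m - e + (r - (m - e)) = r by omega] at this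
  · have := hup (2 * m - r) (by omega)
    rwa [show 2 * m - (2 * m - r) = r by omega] at this

section
variable {n d θ : ℕ} {β : ℕ → ℝ} {u : ℕ → ℕ → ℕ}

theorem constC_le_multipliers (hβ : ∀ i ∈ Finset.Icc 1 (n - d), constC n d ≤ β i) (j i : ℕ) :
    constC n (d - j) ≤ multipliers n d β j i := by
  unfold multipliers
  split_ifs with h
  · subst h
    exact le_periodicExt hβ i
  · exact le_rfl

/-- The data defining the first spanning vector. -/
noncomputable def firstLine (hn : 2 ≤ n) (hd : 1 ≤ d) (hdn : d < n) (hp : θ.Prime) (hθ : 5 ≤ θ)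
    (hβ : ∀ i ∈ Finset.Icc 1 (n - d), constC n d ≤ β i) (hu : ∀ j k, u j k = 1 ∨ u j k = 2) :
    LacunaryLine n d where
  θ := θ
  b := multipliers n d β 0
  u := u 0
  one_le_d := hd
  d_lt := hdn
  prime := hp
  five_le := hθ
  digit := hu 0
  two_le i _ := (two_le_constC hn hd).trans (constC_le_multipliers hβ 0 i)

theorem firstLine_y (hn : 2 ≤ n) (hd : 1 ≤ d) (hdn : d < n) (hp : θ.Prime) (hθ : 5 ≤ θ)
    (hβ : ∀ i ∈ Finset.Icc 1 (n - d), constC n d ≤ β i) (hu : ∀ j k, u j k = 1 ∨ u j k = 2) :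
    (firstLine hn hd hdn hp hθ hβ hu).y = spanVec n d θ β u 0 := rfl

theorem firstLine_growth (hn : 2 ≤ n) (hd : 1 ≤ d) (hdn : d < n) (hp : θ.Prime) (hθ : 5 ≤ θ)
    (hβ : ∀ i ∈ Finset.Icc 1 (n - d), constC n d ≤ β i) (hu : ∀ j k, u j k = 1 ∨ u j k = 2)
    (e N : ℕ) : growth (firstLine hn hd hdn hp hθ hβ hu).b (N + e) =
      growth (firstLine hn hd hdn hp hθ hβ hu).b N *
        window (periodicExt (n - d) (constC n d) β) e N := by
  rw [growth_add_eq_window]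
  rfl

theorem firstLine_window_le (hn : 2 ≤ n) (hd : 1 ≤ d) (hdn : d < n) (hp : θ.Prime) (hθ : 5 ≤ θ)
    (hβ : ∀ i ∈ Finset.Icc 1 (n - d), constC n d ≤ β i) (hu : ∀ j k, u j k = 1 ∨ u j k = 2)
    {e : ℕ} (he : e ≤ n - d) (μ : ℝ) (N : ℕ) :
    growth (firstLine hn hd hdn hp hθ hβ hu).b (N + e) +
      (μ - maxWindow (n - d) β e) * growth (firstLine hn hd hdn hp hθ hβ hu).b N ≤
      μ * growth (firstLine hn hd hdn hp hθ hβ hu).b N := by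
  rw [firstLine_growth]
  have h1 := window_periodicExt_le he (by omega)
    (lt_of_lt_of_le two_pos (two_le_constC hn hd)) hβ N
  have h2 := mul_le_mul_of_nonneg_left h1
    (growth_pos (firstLine hn hd hdn hp hθ hβ hu).two_le le_rfl N).le
  linarith

theorem multipliers_succ (n d : ℕ) (β : ℕ → ℝ) (j : ℕ) :
    multipliers n (d + 1) β (j + 1) = multipliers n d (fun _ => constC n d) j := by
  funext k
  unfold multipliers
  rw [if_neg (Nat.succ_ne_zero j), Nat.add_sub_add_right]
  split_ifs with h
  · rw [periodicExt_const, h, Nat.sub_zero]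
  · rfl

/-- Removing the first spanning vector leaves the vectors of the construction in dimension `d`,
with all multipliers equal to `C_d`. -/
theorem spanVec_succ (hdn : d + 1 < n) (j : ℕ) :
    spanVec n (d + 1) θ β u (j + 1) =
      spanVec n d θ (fun _ => constC n d) (fun j => u (j + 1)) j := by
  have hm : n - (d + 1) + (j + 1) = n - d + j := by omega
  unfold spanVec sigma
  simp only [multipliers_succ, hm, Nat.add_sub_add_right]

theorem span_spanVec_succ (n d θ : ℕ) (β : ℕ → ℝ) (u : ℕ → ℕ → ℕ) :
    Submodule.span ℝ (Set.range fun j : Fin (d + 1) => spanVec n (d + 1) θ β u j) =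
      Submodule.span ℝ (Set.range fun j : Fin d => spanVec n (d + 1) θ β u (j + 1)) ⊔
        Submodule.span ℝ {spanVec n (d + 1) θ β u 0} := by
  rw [Fin.range_fin_succ, Submodule.span_insert, sup_comm]
  rfl

theorem algebraicIndependent_succ (hdn : d + 1 < n) (h : AlgebraicIndependent ℚ
      (fun p : (j : Fin (d + 1)) × Fin (n - (d + 1) + (j : ℕ)) =>
        sigma n (d + 1) θ β u p.1 p.2)) :
    AlgebraicIndependent ℚ (fun p : (j : Fin d) × Fin (n - d + (j : ℕ)) =>
      sigma n d θ (fun _ => constC n d) (fun j => u (j + 1)) p.1 p.2) := by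
  let f : ((j : Fin d) × Fin (n - d + (j : ℕ))) →
      ((j : Fin (d + 1)) × Fin (n - (d + 1) + (j : ℕ))) := fun p =>
    ⟨p.1.succ, ⟨p.2, by have := p.2.2; rw [Fin.val_succ]; omega⟩⟩
  have hf : Function.Injective f := by
    rintro ⟨j, l⟩ ⟨j', l'⟩ h
    simp only [f, Sigma.mk.injEq] at h
    obtain ⟨h1, h2⟩ := h
    obtain rfl := Fin.succ_injective _ h1
    have := congrArg Fin.val (eq_of_heq h2)
    simp only at this
    rw [Fin.ext this]
  convert h.comp f hf using 1
  funext p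
  have hm : n - (d + 1) + ((p.1 : ℕ) + 1) = n - d + p.1 := by omega
  simp only [Function.comp_apply, f, sigma, Fin.val_succ, multipliers_succ, hm]

theorem badlyApprox_bot (n e : ℕ) : BadlyApprox (⊥ : Submodule ℝ (E n)) e 0 :=
  ⟨1, one_pos, fun B _ X hX Z _ => by
    rw [(Submodule.mem_bot ℝ).1 hX]
    simp⟩

theorem maxWindow_const_le {m e : ℕ} {c : ℝ} : maxWindow m (fun _ => c) e ≤ c ^ e := by
  unfold maxWindow
  refine Finset.sup'_le _ _ fun i _ => ?_
  simp

/-- Rational subspaces approximating the subspace `A` of the construction with an exponent larger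
than the expected one have bounded height. -/
theorem exists_height_le_of_maxWindow_lt (hn : 2 ≤ n) (d : ℕ) (hdn : d + 1 < n)
    (hp : θ.Prime) (hθ : 5 ≤ θ) (β : ℕ → ℝ) (u : ℕ → ℕ → ℕ)
    (hβ : ∀ i ∈ Finset.Icc 1 (n - (d + 1)), constC n (d + 1) ≤ β i)
    (hu : ∀ j k, u j k = 1 ∨ u j k = 2)
    (hσ : AlgebraicIndependent ℚ (fun p : (j : Fin (d + 1)) × Fin (n - (d + 1) + (j : ℕ)) =>
      sigma n (d + 1) θ β u p.1 p.2)) {e : ℕ} (he : 1 ≤ e) (hem : e ≤ n - (d + 1)) {μ : ℝ}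
    (hμ : maxWindow (n - (d + 1)) β e < μ) :
    ∃ H₀ : ℝ, ∀ B ∈ ratSubspaces n e,
      ∀ X ∈ Submodule.span ℝ (Set.range fun j : Fin (d + 1) => spanVec n (d + 1) θ β u j),
      ‖X‖ = 1 → ∀ Z ∈ B, ‖X - Z‖ ≤ 2 / height B ^ μ → height B ≤ H₀ := by
  induction d generalizing β u e μ with
  | zero =>
    let S := firstLine hn le_rfl hdn hp hθ hβ hu
    have h5 : √5 ^ 2 = (5 : ℝ) := Real.sq_sqrt (by norm_num)
    have h5' := Real.sqrt_nonneg 5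
    have hC2 := two_le_constC hn le_rfl
    have key := S.exists_height_le_of_close (A' := ⊥) (K := 0) (C := constC n 1) he hem le_rfl
      (badlyApprox_bot _ _) (badlyApprox_bot _ _)
      (fun i _ => constC_le_multipliers hβ 0 i) (by linarith)
      (by
        -- `C₁` is the root of `C + 1 / C = 3`
        rw [zero_add, div_one]
        have : 1 / constC n 1 = (3 - √5) / 2 := by
          rw [div_eq_iff (by linarith)]
          simp only [constC]
          nlinarith
        rw [this]
        simp only [constC]
        linarith)
      (sub_pos.2 hμ) (firstLine_window_le hn le_rfl hdn hp hθ hβ hu hem μ)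
    rw [firstLine_y] at key
    rw [span_spanVec_succ, Set.range_eq_empty, Submodule.span_empty]
    exact key
  | succ d ih =>
    have hd1 : 1 ≤ d + 1 := by omega
    let S := firstLine hn (show 1 ≤ d + 1 + 1 by omega) hdn hp hθ hβ hu
    have hσ' := algebraicIndependent_succ hdn hσ
    set C := constC n (d + 1) with hC
    have hC2 : 2 ≤ C := two_le_constC hn hd1
    have hP1 : 1 ≤ C ^ n := one_le_pow₀ (by linarith)
    -- by induction the span of the last `d + 1` vectors has exponents at most `C ^ n`
    have hbad : ∀ e', 1 ≤ e' → e' ≤ n - (d + 1) → BadlyApprox (Submodule.span ℝ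
        (Set.range fun j : Fin (d + 1) => spanVec n (d + 1 + 1) θ β u (j + 1))) e' (C ^ n + 1) := by
      intro e' he' hem'
      have hlt : maxWindow (n - (d + 1)) (fun _ => C) e' < C ^ n + 1 := by
        have h1 : C ^ e' ≤ C ^ n := pow_le_pow_right₀ (by linarith) (by omega)
        have := maxWindow_const_le (m := n - (d + 1)) (e := e') (c := C)
        linarith
      obtain ⟨H₀, hH₀⟩ := ih (by omega) (fun _ => C) (fun j => u (j + 1)) (fun _ _ => le_rfl)
        (fun j k => hu _ _) hσ' he' hem' hlt
      rw [show (fun j : Fin (d + 1) => spanVec n (d + 1 + 1) θ β u (j + 1)) = fun j : Fin (d + 1) =>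
        spanVec n (d + 1) θ (fun _ => C) (fun j => u (j + 1)) j from
        funext fun j => spanVec_succ hdn j]
      exact badlyApprox_of_large (by positivity)
        (fun B hB => inf_eq_bot_of_algebraicIndependent (by omega) hσ' hem' hB) hH₀
    have hCC : constC n (d + 1 + 1) = 5 * (n : ℝ) ^ 2 * (C ^ n) ^ 2 := by
      rw [← pow_mul, mul_comm n 2]
      rfl
    have hn2 : (2 : ℝ) ≤ n := by exact_mod_cast hn
    set P := C ^ n with hP
    have hbig : 20 * P ^ 2 ≤ constC n (d + 1 + 1) := by
      rw [hCC]
      have : (4 : ℝ) ≤ (n : ℝ) ^ 2 := by nlinarith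
      have := mul_le_mul_of_nonneg_right this (sq_nonneg P)
      linarith
    have hpos : 0 < constC n (d + 1 + 1) := by nlinarith
    have key := S.exists_height_le_of_close (K := P + 1) (C := constC n (d + 1 + 1)) he hem
      (by linarith) (hbad _ (by omega) (by omega)) (hbad _ (by omega) (by omega))
      (fun i _ => constC_le_multipliers hβ 0 i) (by nlinarith)
      (by
        have h1 : 0 < (P + 1 + 1) / constC n (d + 1 + 1) := by positivity
        have h2 : P + 1 + 1 + 2 ≤ constC n (d + 1 + 1) / (P + 1 + 1) := by
          rw [le_div_iff₀ (by linarith)]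
          nlinarith
        linarith)
      (sub_pos.2 hμ) (firstLine_window_le hn (by omega) hdn hp hθ hβ hu hem μ)
    rw [firstLine_y] at key
    rw [span_spanVec_succ]
    exact key

end

theorem exists_index_eq_maxWindow {m e : ℕ} (β : ℕ → ℝ) (hem : e ≤ m) :
    ∃ i, i + e ≤ m ∧ maxWindow m β e = ∏ k ∈ Finset.Icc (i + 1) (i + e), β k := by
  obtain ⟨i, hi, h⟩ := Finset.exists_mem_eq_sup' (Finset.nonempty_range_add_one (n := m - e))
    fun i => ∏ k ∈ Finset.Icc (i + 1) (i + e), β k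
  exact ⟨i, by have := Finset.mem_range.1 hi; omega, h⟩

/-- The explicit construction realizes the prescribed exponents. -/
theorem exists_explicit {n d : ℕ} (hd : 1 ≤ d) (hdn : d < n) {β : ℕ → ℝ}
    (hβ : ∀ i ∈ Finset.Icc 1 (n - d), constC n d ≤ β i) :
    ∃ A ∈ irrationalSubspaces n d (n - d) 1, IsExplicit n d β A ∧
      ∀ e ∈ Finset.Icc 1 (n - d),
        firstExponent A e = ((maxWindow (n - d) β e : ℝ) : EReal) := by
  have hn : 2 ≤ n := by omega
  have hp : Nat.Prime 5 := by norm_num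
  obtain ⟨u, hu, hσ⟩ := exists_digits (β := β) hdn (le_refl 5) fun j hj i _ =>
    (two_le_constC hn (by omega)).trans (constC_le_multipliers hβ j i)
  set A := Submodule.span ℝ (Set.range fun j : Fin d => spanVec n d 5 β u j) with hA
  have hirr := span_mem_irrationalSubspaces hdn hσ
  rw [← hA] at hirr
  refine ⟨A, hirr, ⟨5, u, hp, le_rfl, hu, hσ, rfl⟩, fun e he => ?_⟩
  obtain ⟨he1, hem⟩ := Finset.mem_Icc.1 he
  have hA0 : A ≠ ⊥ := by
    intro h
    have := hirr.1
    rw [h, finrank_bot] at this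
    omega
  apply le_antisymm
  · refine sSup_le ?_
    rintro _ ⟨μ, -, hinf, rfl⟩
    rw [EReal.coe_le_coe_iff]
    by_contra hlt
    obtain ⟨k, rfl⟩ : ∃ k, d = k + 1 := ⟨d - 1, by omega⟩
    obtain ⟨H₀, hH₀⟩ := exists_height_le_of_maxWindow_lt hn k hdn hp le_rfl β u hβ hu hσ he1 hem
      (not_le.1 hlt)
    refine hinf ((finite_height_le n e H₀).subset ?_)
    rintro B ⟨hB, hang⟩
    have hB0 : B ≠ ⊥ := by
      intro h
      have := finrank_of_mem_ratSubspaces hB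
      rw [h, finrank_bot] at this
      omega
    have hH := Real.rpow_pos_of_pos (height_pos hB) μ
    obtain ⟨X, hX, hX1, Z, hZ, hXZ⟩ := exists_norm_sub_lt_of_firstAngle_lt hA0 hB0
      (hang.trans_lt (show 1 / height B ^ μ < 2 / height B ^ μ by gcongr; norm_num))
    exact ⟨hB, hH₀ B hB X hX hX1 Z hZ hXZ.le⟩
  · by_contra hlt
    obtain ⟨x, hx1, hx2⟩ := EReal.lt_iff_exists_real_btwn.1 (not_le.1 hlt)
    rw [EReal.coe_lt_coe_iff] at hx2
    obtain ⟨i, hi, hw⟩ := exists_index_eq_maxWindow β hem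
    have h1W : 1 < maxWindow (n - d) β e := by
      rw [hw]
      have hC2 := two_le_constC hn hd
      have h1 : ∀ k ∈ Finset.Icc (i + 1) (i + e), (2 : ℝ) ≤ β k := fun k hk => by
        have := Finset.mem_Icc.1 hk
        exact hC2.trans (hβ k (Finset.mem_Icc.2 ⟨by omega, by omega⟩))
      have h2 := Finset.prod_le_prod (fun _ _ => (by norm_num : (0 : ℝ) ≤ 2)) h1
      rw [Finset.prod_const] at h2
      refine lt_of_lt_of_le (one_lt_pow₀ one_lt_two ?_) h2
      rw [Nat.card_Icc]
      omega
    set μ := max x 1 with hμ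
    have hμW : μ < maxWindow (n - d) β e := max_lt hx2 h1W
    have hμ1 : 1 ≤ μ := le_max_right _ _
    let S := firstLine hn hd hdn hp le_rfl hβ hu
    have hyA : S.y ∈ A := Submodule.subset_span ⟨⟨0, hd⟩, rfl⟩
    have hinf := S.infinite_of_frequently hyA he1 hem (sub_pos.2 hμW) (by linarith) fun N₀ => by
      refine ⟨2 * (n - d) * N₀ + i, ?_, ?_⟩
      · have : 1 * N₀ ≤ 2 * (n - d) * N₀ := Nat.mul_le_mul_right _ (by omega)
        omega
      · have hg := firstLine_growth hn hd hdn hp le_rfl hβ hu e (2 * (n - d) * N₀ + i)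
        rw [window_periodicExt_add, window_periodicExt_of_le _ _ hi, ← hw] at hg
        refine le_of_eq (Eq.trans ?_ hg.symm)
        ring
    have hle : ((μ : ℝ) : EReal) ≤ firstExponent A e := le_sSup ⟨μ, by linarith, hinf, rfl⟩
    have : ((x : ℝ) : EReal) ≤ (μ : EReal) := EReal.coe_le_coe_iff.2 (le_max_left _ _)
    exact absurd (this.trans hle) (not_le.2 hx1)

section
variable {m : ℕ} {γ : ℕ → ℝ} {c : ℝ}

theorem pos_of_ratios (hc : 1 ≤ c) (h1 : c ≤ γ 1)
    (h : ∀ i ∈ Finset.Icc 2 m, c * γ (i - 1) ≤ γ i) {i : ℕ} (hi : 1 ≤ i) (him : i ≤ m) :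
    0 < γ i := by
  induction i, hi using Nat.le_induction with
  | base => linarith
  | succ i hi ih =>
    have h2 := h (i + 1) (Finset.mem_Icc.2 ⟨by omega, him⟩)
    rw [Nat.add_sub_cancel] at h2
    have := ih (by omega)
    nlinarith

theorem prod_ratios (hpos : ∀ i, 1 ≤ i → i ≤ m → 0 < γ i) {i e : ℕ} (hi : i + e ≤ m) (he : 1 ≤ e) :
    (if i = 0 then 1 else γ i) * ∏ k ∈ Finset.Icc (i + 1) (i + e), ratios γ k = γ (i + e) := by
  induction e, he using Nat.le_induction with
  | base =>
    rw [Finset.Icc_self, Finset.prod_singleton]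
    unfold ratios
    by_cases h : i = 0
    · simp [h]
    · rw [if_neg h, if_neg (by omega), Nat.add_sub_cancel]
      exact mul_div_cancel₀ _ (hpos i (by omega) (by omega)).ne'
  | succ e he ih =>
    rw [← add_assoc, Finset.prod_Icc_succ_top (by omega), ← mul_assoc, ih (by omega)]
    unfold ratios
    rw [if_neg (by omega), Nat.add_sub_cancel]
    exact mul_div_cancel₀ _ (hpos (i + e) (by omega) (by omega)).ne'

theorem maxWindow_ratios (hpos : ∀ i, 1 ≤ i → i ≤ m → 0 < γ i)
    (hsub : ∀ i ∈ Finset.Icc 1 (m - 1), ∀ j ∈ Finset.Icc 1 (m - 1), i + j ≤ m →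
      γ (i + j) ≤ γ i * γ j) {e : ℕ} (he : 1 ≤ e) (hem : e ≤ m) :
    maxWindow m (ratios γ) e = γ e := by
  have h0 := prod_ratios hpos (i := 0) (e := e) (by omega) he
  rw [if_pos rfl, one_mul, zero_add, zero_add] at h0
  apply le_antisymm
  · refine Finset.sup'_le _ _ fun i hi => ?_
    have hi' := Finset.mem_range.1 hi
    by_cases hi0 : i = 0
    · subst hi0
      simp only [zero_add]
      exact h0.le
    · have h1 := prod_ratios hpos (i := i) (e := e) (by omega) he
      rw [if_neg hi0] at h1
      have h2 := hsub i (Finset.mem_Icc.2 ⟨by omega, by omega⟩) e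
        (Finset.mem_Icc.2 ⟨he, by omega⟩) (by omega)
      rw [← h1] at h2
      exact le_of_mul_le_mul_left h2 (hpos i (by omega) (by omega))
  · refine le_trans (le_of_eq ?_)
      (Finset.le_sup' (fun i => ∏ k ∈ Finset.Icc (i + 1) (i + e), ratios γ k)
        (Finset.mem_range.2 (by omega : 0 < m - e + 1)))
    simp only [zero_add]
    exact h0.symm

end

end RatApprox

theorem mainTheorem2 (n d : ℕ) (hd : 1 ≤ d) (hdn : d + 1 ≤ n) :
    (∀ β : ℕ → ℝ, (∀ i ∈ Finset.Icc 1 (n - d), RatApprox.constC n d ≤ β i) →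
      ∃ A ∈ RatApprox.irrationalSubspaces n d (n - d) 1,
        RatApprox.IsExplicit n d β A ∧
        ∀ e ∈ Finset.Icc 1 (n - d),
          RatApprox.firstExponent A e = ((RatApprox.maxWindow (n - d) β e : ℝ) : EReal)) ∧
    (∀ γ : ℕ → ℝ, RatApprox.constC n d ≤ γ 1 →
      (∀ i ∈ Finset.Icc 2 (n - d), RatApprox.constC n d * γ (i - 1) ≤ γ i) →
      (∀ i ∈ Finset.Icc 1 (n - d - 1), ∀ j ∈ Finset.Icc 1 (n - d - 1),
        i + j ≤ n - d → γ (i + j) ≤ γ i * γ j) →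
      ∃ A ∈ RatApprox.irrationalSubspaces n d (n - d) 1,
        RatApprox.IsExplicit n d (RatApprox.ratios γ) A ∧
        ∀ e ∈ Finset.Icc 1 (n - d),
          RatApprox.firstExponent A e = ((γ e : ℝ) : EReal)) := by
  refine ⟨fun β hβ => RatApprox.exists_explicit hd hdn hβ, fun γ h1 h2 hsub => ?_⟩
  have hc := RatApprox.two_le_constC (n := n) (d := d) (by omega) hd
  have hpos : ∀ i, 1 ≤ i → i ≤ n - d → 0 < γ i := fun i hi him =>
    RatApprox.pos_of_ratios (by linarith) h1 h2 hi him
  obtain ⟨A, hA, hex, hexp⟩ := RatApprox.exists_explicit (β := RatApprox.ratios γ) hd hdn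
    fun i hi => by
      obtain ⟨hi1, him⟩ := Finset.mem_Icc.1 hi
      unfold RatApprox.ratios
      split_ifs with h
      · exact h1
      · rw [le_div_iff₀ (hpos _ (by omega) (by omega))]
        exact h2 i (Finset.mem_Icc.2 ⟨by omega, him⟩)
  refine ⟨A, hA, hex, fun e he => ?_⟩
  rw [hexp e he, RatApprox.maxWindow_ratios hpos hsub (Finset.mem_Icc.1 he).1
    (Finset.mem_Icc.1 he).2]
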